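/- **Setting.** Units $i=1,2,\dots$ have i.i.d. $(A_i,X_i,Y_i^0,Y_i^1,Q_i)$, where $A_i\in[0,\tau]$ is the arrival time, with a continuous distribution ($\tau\in\mathbb N$ fixed), $X_i\in\mathbb R^d$ are covariates, $Y_i^0,Y_i^1\in\mathbb R$ are potential outcomes, and the queue $Q_i\in\{1,\dots,K\}$ is drawn, given $(A_i,X_i,Y_i^0,Y_i^1)$, with probabilities $\theta(X_i)=(\theta_1(X_i),\dots,\theta_K(X_i))\in\Delta_K$ (the probability simplex). The experiment of size $n$ consists of units $1,\dots,n$ and has budgets $b_{t,n}\in\mathbb N$, $1\le t\le\tau$: at the end of period $t$ the $b_{t,n}$ available slots are given to units that have arrived by time $t$ and are still untreated, lower-numbered queues first and in order of arrival within a queue. $Z_i\in\{0,1\}$ is the treatment status of unit $i$ after period $\tau$, and $Y_i=Y_i^{Z_i}$. A letter without unit index refers to a generic unit. Put $\tilde\pi_n(x,q)=\mathbb P(Z=1\mid X=x,Q=q)$, $\pi_n(x)=\mathbb P(Z=1\mid X=x)$, $r_n(x,q)=\tilde\pi_n(x,q)-\pi_n(x)$, $m_n(x)=\mathbb E(Y\mid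 X=x)$ and $\pi(x;\theta)=\lim_{n}\pi_n(x)$. **Assumptions.** 1. $\mathbb E\,\theta(X)=p$. 2. For some $\beta\in(0,1)$, $\max_{1\le t\le\tau}\big|\frac1n\sum_{s\le t}b_{s,n}-\beta\,\mathbb P(A\le t)\big|\to0$. 3. $A$ is independent of $X$. 4. (Partially linear IV model) $Y=\psi_Z Z+g(X)+U$ for every $n$, with the unit-level error $U=Y^0-g(X)$ satisfying $\mathbb E(U\mid X,Q)=0$ and $\mathbb E\,U^2<\infty$, and with $\mathbb E|g(X)|<\infty$; $\sigma(x)=\mathbb E(U^2\mid X=x)$ satisfies $\sigma(X)>0$ a.s. 5. $\widehat\sigma_n,\widehat m_n$ are constructed from a sample $\mathcal D$ independent of the units, with $\|\widehat\sigma_n-\sigma\|_{L_2(\mathbb P)}=o_{\mathbb P}(1)$ and $\|\widehat m_n-m_n\|_{L_2(\mathbb P)}=o_{\mathbb P}(1)$; the estimated instruments are uniformly bounded: $\widehat\sigma_n(X)>0$ and $|r_n(X,Q)/\widehat\sigma_n(X)|\le C$ a.s. for all $n$, with a constant $C$. 6. With $c_k=\sum_{j\le k}p_j$ and $u_+=\max\{u,0\}$,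 let $\alpha_k=\{(\beta-c_{k-1})_+-(\beta-c_k)_+\}/p_k$ if $p_k>0$ and $\alpha_k=0$ otherwise. Then $\mathbb E[\{\alpha_Q-\pi(X;\theta)\}^2]\ge\gamma$ for some $\gamma>0$. **Conclusion.** Let $$I=\mathbb E\Big[\frac{\{\alpha_Q-\pi(X;\theta)\}^2}{\sigma(X)}\Big],\qquad \widehat\Delta_n=\frac1n\sum_{i=1}^n\frac{r_n(X_i,Q_i)}{\widehat\sigma_n(X_i)}\{Z_i-\pi_n(X_i)\},$$ $$\widehat\psi_Z^\star=\frac1{\widehat\Delta_n}\cdot\frac1n\sum_{i=1}^n\frac{r_n(X_i,Q_i)}{\widehat\sigma_n(X_i)}\{Y_i-\widehat m_n(X_i)\}.$$ The limit $\pi(x;\theta)$ exists for almost every $x$, $I>0$, and the asymptotic variance of $\widehat\psi_Z^\star$ given $\mathcal D$ is $I^{-1}$, the i.i.d. efficiency bound at the limiting instrument, in the following sense. For every $c\in(0,I)$, as $n\to\infty$ and in probability over $\mathcal D$, $$\mathbb P\big(|\widehat\Delta_n|\ge c\mid\mathcal D\big)\to1\qquad\text{and}\qquad n\operatorname{Var}\big(\widehat\psi_Z^\star\,\big|\,\mathcal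 D,\ |\widehat\Delta_n|\ge c\big)\to I^{-1},$$ where, with $\mathcal D$-probability tending to one, $\widehat\psi_Z^\star$ has a finite second moment given $\mathcal D$ and $|\widehat\Delta_n|\ge c$. -/

import Mathlib

open MeasureTheory ProbabilityTheory Filter Topology
open scoped ENNReal

noncomputable section

/-- Service order: unit `j` is served before unit `i` if it is in a higher-priority queue
(smaller label), or in the same queue and arrived earlier. (Equal arrival times, which have
probability zero below, are ordered by the unit index.) -/
def ServedBefore {K : ℕ} (a : ℕ → ℝ) (q : ℕ → Fin K) (j i : ℕ) : Prop :=
  q j < q i ∨ (q j = q i ∧ (a j < a i ∨ (a j = a i ∧ j < i)))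

open Classical in
/-- The set of units among `0, …, n - 1` treated by the end of period `t`, when unit `i` arrives at
time `a i` in queue `q i` and `b s` treatment slots become available in period `s`. At the end of
period `t`, the first `b t` units, in service order, of those who have arrived by `t` and are still
untreated are treated. -/
def treatedBy {K : ℕ} (n : ℕ) (a : ℕ → ℝ) (q : ℕ → Fin K) (b : ℕ → ℕ) : ℕ → Finset ℕ
  | 0 => ∅
  | t + 1 =>
    let treated := treatedBy n a q b t
    let waiting := (Finset.range n).filter fun i => a i ≤ ((t + 1 : ℕ) : ℝ) ∧ i ∉ treated
    treated ∪ waiting.filter fun i =>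
      (waiting.filter fun j => ServedBefore a q j i).card < b (t + 1)

/-- The queue-randomizing experiment. Units are `0, 1, 2, …`; the experiment of size `n` consists
of the units `0, …, n - 1`. -/
structure QueueExperiment {Ω : Type*} [MeasurableSpace Ω] (P : Measure Ω) (d K : ℕ) where
  /-- the number of allocation periods -/
  τ : ℕ
  /-- arrival times -/
  A : ℕ → Ω → ℝ
  /-- covariates -/
  X : ℕ → Ω → EuclideanSpace ℝ (Fin d)
  /-- potential outcomes without treatment -/
  Y0 : ℕ → Ω → ℝ
  /-- potential outcomes with treatment -/
  Y1 : ℕ → Ω → ℝ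
  /-- assigned queues; smaller labels have higher priority -/
  Q : ℕ → Ω → Fin K
  /-- the queue-assignment policy -/
  θ : EuclideanSpace ℝ (Fin d) → Fin K → ℝ
  /-- `b n t` is the budget of period `t`, for `1 ≤ t ≤ τ`, in the experiment of size `n` -/
  b : ℕ → ℕ → ℕ
  measurable_A : ∀ i, Measurable (A i)
  measurable_X : ∀ i, Measurable (X i)
  measurable_Y0 : ∀ i, Measurable (Y0 i)
  measurable_Y1 : ∀ i, Measurable (Y1 i)
  measurable_Q : ∀ i, Measurable (Q i)
  measurable_θ : Measurable θ
  θ_mem : ∀ x, θ x ∈ stdSimplex ℝ (Fin K)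
  /-- units are independent -/
  indep : iIndepFun (fun i ω => (A i ω, X i ω, Y0 i ω, Y1 i ω, Q i ω)) P
  /-- units are identically distributed -/
  identDistrib : ∀ i, IdentDistrib (fun ω => (A i ω, X i ω, Y0 i ω, Y1 i ω, Q i ω))
    (fun ω => (A 0 ω, X 0 ω, Y0 0 ω, Y1 0 ω, Q 0 ω)) P P
  /-- arrivals take place in `[0, τ]` -/
  arrival_mem : ∀ᵐ ω ∂P, A 0 ω ∈ Set.Icc (0 : ℝ) τ
  /-- arrival times have a continuous distribution -/
  arrival_continuous : ∀ t : ℝ, P {ω | A 0 ω = t} = 0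
  /-- given `(A, X, Y⁰, Y¹)`, the queue is drawn from `θ(X)` -/
  queue_law : ∀ k : Fin K,
    P[(Q 0 ⁻¹' {k}).indicator (fun _ => (1 : ℝ)) |
        MeasurableSpace.comap (fun ω => (A 0 ω, X 0 ω, Y0 0 ω, Y1 0 ω)) inferInstance]
      =ᵐ[P] fun ω => θ (X 0 ω) k

namespace QueueExperiment

variable {Ω : Type*} [MeasurableSpace Ω] {P : Measure Ω} {d K : ℕ}

open Classical in
/-- Terminal treatment status of unit `i` in the experiment of size `n`. -/
def Z (E : QueueExperiment P d K) (n i : ℕ) (ω : Ω) : ℝ :=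
  if i ∈ treatedBy n (fun j => E.A j ω) (fun j => E.Q j ω) (E.b n) E.τ then 1 else 0

open Classical in
/-- Observed outcome of unit `i` in the experiment of size `n`. -/
def Y (E : QueueExperiment P d K) (n i : ℕ) (ω : Ω) : ℝ :=
  if E.Z n i ω = 1 then E.Y1 i ω else E.Y0 i ω

/-- The law of the covariates. -/
def lawX (E : QueueExperiment P d K) : Measure (EuclideanSpace ℝ (Fin d)) := P.map (E.X 0)

/-- Queue-conditional propensity score `ℙ(Z = 1 ∣ X = x, Q = q)` in the experiment of size `n`
(units are exchangeable, so it is written for unit `0`). -/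
def queuePropensity (E : QueueExperiment P d K) [IsFiniteMeasure P] (n : ℕ)
    (x : EuclideanSpace ℝ (Fin d)) (q : Fin K) : ℝ :=
  (condDistrib (E.Z n 0) (fun ω => (E.X 0 ω, E.Q 0 ω)) P (x, q)).real {1}

/-- Marginal propensity score `ℙ(Z = 1 ∣ X = x)` in the experiment of size `n`. -/
def propensity (E : QueueExperiment P d K) [IsFiniteMeasure P] (n : ℕ)
    (x : EuclideanSpace ℝ (Fin d)) : ℝ :=
  (condDistrib (E.Z n 0) (E.X 0) P x).real {1}

/-- Asymptotic propensity score, the limit of the marginal propensity scores. -/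
def asympPropensity (E : QueueExperiment P d K) [IsFiniteMeasure P]
    (x : EuclideanSpace ℝ (Fin d)) : ℝ :=
  limUnder atTop fun n => E.propensity n x

/-- The recentered instrument `r_n(x, q)`. -/
def instr (E : QueueExperiment P d K) [IsFiniteMeasure P] (n : ℕ)
    (x : EuclideanSpace ℝ (Fin d)) (q : Fin K) : ℝ :=
  E.queuePropensity n x q - E.propensity n x

/-- The outcome regression `m(x) = 𝔼(Y ∣ X = x)` in the experiment of size `n`. -/
def outcomeReg (E : QueueExperiment P d K) [IsFiniteMeasure P] (n : ℕ)
    (x : EuclideanSpace ℝ (Fin d)) : ℝ :=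
  ∫ y, y ∂(condDistrib (E.Y n 0) (E.X 0) P x)

/-- The unit-level error term `U = Y⁰ - g(X)`. -/
def err (E : QueueExperiment P d K) (g : EuclideanSpace ℝ (Fin d) → ℝ) (i : ℕ) (ω : Ω) : ℝ :=
  E.Y0 i ω - g (E.X i ω)

/-- `σ(x) = 𝔼(U² ∣ X = x)`. -/
def errVar (E : QueueExperiment P d K) [IsFiniteMeasure P]
    (g : EuclideanSpace ℝ (Fin d) → ℝ) (x : EuclideanSpace ℝ (Fin d)) : ℝ :=
  ∫ u, u ^ 2 ∂(condDistrib (E.err g 0) (E.X 0) P x)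

/-- The partially linear IV model: `Y = ψ Z + g(X) + U` and `𝔼(U ∣ X, Q) = 0`, with the moments
that make `m(x) = 𝔼(Y ∣ X = x)` and `σ(x) = 𝔼(U² ∣ X = x)` well-defined. -/
structure IsPLIV (E : QueueExperiment P d K) (ψ : ℝ)
    (g : EuclideanSpace ℝ (Fin d) → ℝ) : Prop where
  measurable_g : Measurable g
  integrable_g : Integrable (fun ω => g (E.X 0 ω)) P
  memLp_err : MemLp (E.err g 0) 2 P
  outcome_eq : ∀ n, ∀ i < n, ∀ᵐ ω ∂P, E.Y n i ω = ψ * E.Z n i ω + g (E.X i ω) + E.err g i ω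
  condExp_err : P[E.err g 0 |
    MeasurableSpace.comap (fun ω => (E.X 0 ω, E.Q 0 ω)) inferInstance] =ᵐ[P] 0

/-- Fixed queue proportions: `𝔼 θ(X) = p`. -/
def FixedQueue (E : QueueExperiment P d K) (p : Fin K → ℝ) : Prop :=
  ∀ k, ∫ ω, E.θ (E.X 0 ω) k ∂P = p k

/-- Stable and non-negligible budget with limiting treated fraction `β`. -/
def StableBudget (E : QueueExperiment P d K) (β : ℝ) : Prop :=
  β ∈ Set.Ioo (0 : ℝ) 1 ∧ ∀ t ∈ Finset.Icc 1 E.τ,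
    Tendsto (fun n : ℕ => |(1 / (n : ℝ)) * ∑ s ∈ Finset.Icc 1 t, (E.b n s : ℝ)
      - β * P.real {ω | E.A 0 ω ≤ (t : ℝ)}|) atTop (𝓝 0)

/-- Arrivals independent of covariates. -/
def IndepArrivals (E : QueueExperiment P d K) : Prop := IndepFun (E.A 0) (E.X 0) P

/-- The numerator of the IV estimator with nuisance functions `s` (for `σ`) and `m`. -/
def ivNum (E : QueueExperiment P d K) [IsFiniteMeasure P] (n : ℕ)
    (s m : EuclideanSpace ℝ (Fin d) → ℝ) (ω : Ω) : ℝ :=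
  (1 / (n : ℝ)) * ∑ i ∈ Finset.range n,
    E.instr n (E.X i ω) (E.Q i ω) / s (E.X i ω) * (E.Y n i ω - m (E.X i ω))

/-- The denominator of the IV estimator with nuisance function `s` (for `σ`). -/
def ivDen (E : QueueExperiment P d K) [IsFiniteMeasure P] (n : ℕ)
    (s : EuclideanSpace ℝ (Fin d) → ℝ) (ω : Ω) : ℝ :=
  (1 / (n : ℝ)) * ∑ i ∈ Finset.range n,
    E.instr n (E.X i ω) (E.Q i ω) / s (E.X i ω) * (E.Z n i ω - E.propensity n (E.X i ω))

/-- The IV estimator with nuisance functions `s` (for `σ`) and `m`. -/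
def ivEstimator (E : QueueExperiment P d K) [IsFiniteMeasure P] (n : ℕ)
    (s m : EuclideanSpace ℝ (Fin d) → ℝ) (ω : Ω) : ℝ :=
  E.ivNum n s m ω / E.ivDen n s ω

end QueueExperiment

/-- The limiting probability `α_k(β, p)` of being treated in queue `k`. -/
def queueAlpha {K : ℕ} (β : ℝ) (p : Fin K → ℝ) (k : Fin K) : ℝ :=
  if 0 < p k then
    (max (β - ∑ j ∈ Finset.Iio k, p j) 0 - max (β - ∑ j ∈ Finset.Iic k, p j) 0) / p k
  else 0

/-- The iid efficiency information `𝔼[{α_Q(β, p) - π(X; θ)}² / σ(X)]` at the limiting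
instrument. -/
def QueueExperiment.limitInfo {Ω : Type*} [MeasurableSpace Ω] {P : Measure Ω} {d K : ℕ}
    (E : QueueExperiment P d K) [IsFiniteMeasure P] (β : ℝ) (p : Fin K → ℝ)
    (g : EuclideanSpace ℝ (Fin d) → ℝ) : ℝ :=
  ∫ ω, (queueAlpha β p (E.Q 0 ω) - E.asympPropensity (E.X 0 ω)) ^ 2
    / E.errVar g (E.X 0 ω) ∂P

end

/-! The treatment statuses are dependent because all units share the slots, but this dependence
cancels from the leading term of the estimator. In the partially linear model, Y - m̂ = ψ(Z - π_n) +
U + (m_n - m̂) almost surely. Hence the estimator is ψ + n^{-1/2} G/D, where D is its denominator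
and G is the normalized sum of the i.i.d. scores w(X, Q)(U + m_n - m̂) with weight w = r_n/σ̂
(`ivNum_ae`). The scores are centered, since E(U | X, Q) = 0 and E(r_n | X) = 0. The variance of G
tends to E[(r/σ)² σ] = I, where r is the limit of r_n, because the conditional variance of U does
not depend on the queue (`tendsto_integral_score_sq`). The denominator tends to E[(r/σ) r], which is
again I. The ratio therefore has limiting variance I/I² = 1/I.

The dependence matters only for D, which needs a law of large numbers. A set of top-priority queues
acts as one queue, so its treated count solves a recursion in the period (`card_treatedIn_succ`),
and the limit of the recursion is explicit (`tendsto_card_treatedIn`). Differences give a treated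
fraction α_k in queue k. As service is in order of arrival, the treated units of queue k are
asymptotically those arriving before a cutoff u_k with F(u_k) = α_k, where F is the arrival
distribution function. Replacing Z_i by the indicator of A_i ≤ u_{Q_i} costs o(1) in mean, uniformly
in i (`eventually_integral_Z_sub_limitZ_le`), and leaves an i.i.d. average. For the propensity
scores, the queue of unit 0 is frozen at k: its status is then a function of its arrival time and
the other units, hence independent of its covariates and queue (`condExp_Z_covQueue`), and its mean
tends to α_k (`tendsto_treatProb`).

Convergence of variances of ratios needs uniform integrability of G² (`unifIntegrable_score`).
Truncating U splits the score into a bounded part, whose normalized sum has bounded fourth moment by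
Hoeffding's lemma, and a part that is small in mean square. With the denominator bounded away from
zero, `tendsto_variance_ratio` then gives the limit.

All this is done for deterministic sequences of nuisance functions (`IsConsistent`). An argument by
contradiction along subsequences makes it uniform over L² neighborhoods of the true nuisance
functions (`exists_forall_isNearlyEfficient`), and the estimates lie in such neighborhoods with
probability tending to one. -/

noncomputable section

/-! ### Combinatorics of the priority service discipline. -/

section ServiceOrder

variable {K : ℕ} {a : ℕ → ℝ} {q : ℕ → Fin K}

theorem ServedBefore.trans {i j l : ℕ} (h : ServedBefore a q i j) (h' : ServedBefore a q j l) :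
    ServedBefore a q i l := by
  unfold ServedBefore at *
  grind

theorem ServedBefore.irrefl (i : ℕ) : ¬ ServedBefore a q i i := by
  simp [ServedBefore]

theorem ServedBefore.total {i j : ℕ} (h : i ≠ j) :
    ServedBefore a q i j ∨ ServedBefore a q j i := by
  unfold ServedBefore
  grind

theorem ServedBefore.of_lt {i j : ℕ} (hq : q i = q j) (ha : a i < a j) :
    ServedBefore a q i j := Or.inr ⟨hq, Or.inl ha⟩

open Classical in
/-- In a finite set with a strict total order, exactly `min m (card W)` elements have fewer than
`m` predecessors. -/
theorem card_filter_rank_lt {α : Type*} (R : α → α → Prop)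
    (htrans : ∀ {x y z}, R x y → R y z → R x z) (hirr : ∀ x, ¬ R x x)
    (htot : ∀ {x y}, x ≠ y → R x y ∨ R y x) (W : Finset α) (m : ℕ) :
    (W.filter fun i => (W.filter fun j => R j i).card < m).card = min m W.card := by
  have hlt : ∀ {x y}, x ∈ W → R x y →
      (W.filter fun j => R j x).card < (W.filter fun j => R j y).card := by
    intro x y hx hxy
    apply Finset.card_lt_card
    refine ⟨fun z hz => ?_, fun hsub => ?_⟩
    · simp only [Finset.mem_filter] at hz ⊢
      exact ⟨hz.1, htrans hz.2 hxy⟩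
    · have : x ∈ W.filter fun j => R j x := hsub (by simp [hx, hxy])
      simp only [Finset.mem_filter] at this
      exact hirr x this.2
  have hinj : Set.InjOn (fun i => (W.filter fun j => R j i).card) (W : Set α) := by
    intro x hx y hy hxy
    by_contra hne
    rcases htot hne with h | h
    · exact absurd hxy (hlt hx h).ne
    · exact absurd hxy (hlt hy h).ne'
  -- The ranks are distinct and all lie below the cardinality of `W`, so they exhaust that range.
  have himg : W.image (fun i => (W.filter fun j => R j i).card) = Finset.range W.card := by
    apply Finset.eq_of_subset_of_card_le
    · intro r hr
      simp only [Finset.mem_image] at hr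
      obtain ⟨x, hx, rfl⟩ := hr
      rw [Finset.mem_range]
      apply Finset.card_lt_card
      refine ⟨Finset.filter_subset _ _, fun hsub => ?_⟩
      exact hirr x (Finset.mem_filter.1 (hsub hx)).2
    · rw [Finset.card_range, Finset.card_image_of_injOn hinj]
  have hfi : (W.filter fun i => (W.filter fun j => R j i).card < m).image
      (fun i => (W.filter fun j => R j i).card) = (Finset.range W.card).filter (fun r => r < m) := by
    rw [← himg, Finset.filter_image]
  rw [← Finset.card_image_of_injOn (hinj.mono (Finset.coe_subset.2 (Finset.filter_subset _ _))),
    hfi]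
  have : (Finset.range W.card).filter (fun r => r < m) = Finset.range (min m W.card) := by
    ext r; simp [and_comm]
  rw [this, Finset.card_range]

open Classical in
/-- The units that have arrived by the end of period `t + 1` and were not treated before. -/
def waitingAt (n : ℕ) (a : ℕ → ℝ) (q : ℕ → Fin K) (b : ℕ → ℕ) (t : ℕ) : Finset ℕ :=
  (Finset.range n).filter fun i => a i ≤ ((t + 1 : ℕ) : ℝ) ∧ i ∉ treatedBy n a q b t

variable {n : ℕ} {b : ℕ → ℕ}

open Classical in
theorem treatedBy_succ (t : ℕ) :
    treatedBy n a q b (t + 1) = treatedBy n a q b t ∪ (waitingAt n a q b t).filter fun i =>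
      ((waitingAt n a q b t).filter fun j => ServedBefore a q j i).card < b (t + 1) := rfl

theorem mem_waitingAt {t i : ℕ} : i ∈ waitingAt n a q b t ↔
    i < n ∧ a i ≤ ((t + 1 : ℕ) : ℝ) ∧ i ∉ treatedBy n a q b t := by
  simp [waitingAt]

theorem arrived_of_mem_treatedBy {t i : ℕ} (h : i ∈ treatedBy n a q b t) :
    i < n ∧ a i ≤ (t : ℝ) := by
  induction t with
  | zero => simp [treatedBy] at h
  | succ t ih =>
    rw [treatedBy_succ, Finset.mem_union, Finset.mem_filter, mem_waitingAt] at h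
    rcases h with h | h
    · refine ⟨(ih h).1, (ih h).2.trans ?_⟩
      push_cast; linarith
    · exact ⟨h.1.1, h.1.2.1⟩

open Classical in
/-- Within a queue, units are treated in order of arrival. -/
theorem mem_treatedBy_of_servedBefore {t i j : ℕ} (h : i ∈ treatedBy n a q b t) (hj : j < n)
    (hq : q j = q i) (hji : ServedBefore a q j i) : j ∈ treatedBy n a q b t := by
  induction t with
  | zero => simp [treatedBy] at h
  | succ t ih =>
    rw [treatedBy_succ, Finset.mem_union, Finset.mem_filter] at h ⊢
    rcases h with h | h
    · exact Or.inl (ih h)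
    · by_cases hjt : j ∈ treatedBy n a q b t
      · exact Or.inl hjt
      · refine Or.inr ⟨mem_waitingAt.2 ⟨hj, ?_, hjt⟩, lt_of_le_of_lt ?_ h.2⟩
        · refine le_trans ?_ (mem_waitingAt.1 h.1).2.1
          rcases hji with h1 | ⟨-, h1 | h1⟩
          · exact absurd hq h1.ne
          · exact h1.le
          · exact h1.1.le
        -- Every predecessor of `j` precedes `i` as well, so the rank of `j` is at most that of `i`.
        · apply Finset.card_le_card
          intro l hl
          rw [Finset.mem_filter] at hl ⊢
          exact ⟨hl.1, hl.2.trans hji⟩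

open Classical in
/-- The units in a set `L` of queues that have arrived by the time `u`. -/
def arrivedIn (n : ℕ) (a : ℕ → ℝ) (q : ℕ → Fin K) (L : Finset (Fin K)) (u : ℝ) : Finset ℕ :=
  (Finset.range n).filter fun i => a i ≤ u ∧ q i ∈ L

/-- The units in a set `L` of queues that are treated by the end of period `t`. -/
def treatedIn (n : ℕ) (a : ℕ → ℝ) (q : ℕ → Fin K) (b : ℕ → ℕ) (L : Finset (Fin K)) (t : ℕ) :
    Finset ℕ :=
  (treatedBy n a q b t).filter fun i => q i ∈ L

/-- A set of top-priority queues behaves like a single queue: in each period, the available slots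
are used as long as there are waiting units. -/
theorem card_treatedIn_succ {L : Finset (Fin K)} (hL : IsLowerSet (L : Set (Fin K))) (t : ℕ) :
    (treatedIn n a q b L (t + 1)).card =
      min ((treatedIn n a q b L t).card + b (t + 1))
        (arrivedIn n a q L ((t + 1 : ℕ) : ℝ)).card := by
  classical
  set W := (waitingAt n a q b t).filter fun i => q i ∈ L with hW
  have hdisj : Disjoint (treatedIn n a q b L t) W := by
    rw [Finset.disjoint_left]
    intro i hi hi'
    exact (mem_waitingAt.1 (Finset.mem_filter.1 hi').1).2.2 (Finset.mem_filter.1 hi).1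
  have harr : arrivedIn n a q L ((t + 1 : ℕ) : ℝ) = treatedIn n a q b L t ∪ W := by
    ext i
    simp only [arrivedIn, treatedIn, hW, Finset.mem_filter, Finset.mem_union, Finset.mem_range,
      mem_waitingAt]
    constructor
    · tauto
    · rintro (h | h)
      · have := arrived_of_mem_treatedBy h.1
        refine ⟨this.1, this.2.trans ?_, h.2⟩
        push_cast; linarith
      · tauto
  have htr : treatedIn n a q b L (t + 1) = treatedIn n a q b L t ∪
      W.filter fun i => (W.filter fun j => ServedBefore a q j i).card < b (t + 1) := by
    ext i
    -- Only units in `L` can precede a unit in `L`, because `L` is a lower set of labels; the rest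
    -- of the population is invisible to it.
    have key : q i ∈ L → ((waitingAt n a q b t).filter fun j => ServedBefore a q j i)
        = W.filter fun j => ServedBefore a q j i := by
      intro hi
      ext j
      simp only [hW, Finset.mem_filter]
      refine ⟨fun h => ⟨⟨h.1, ?_⟩, h.2⟩, fun h => ⟨h.1.1, h.2⟩⟩
      have hle : q j ≤ q i := by
        rcases h.2 with h1 | h1
        · exact h1.le
        · exact h1.1.le
      exact hL hle hi
    simp only [treatedIn, treatedBy_succ, Finset.mem_filter, Finset.mem_union]
    by_cases hi : q i ∈ L
    · rw [key hi]
      simp [hW, hi]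
    · simp [hW, hi]
  have hd2 : Disjoint (treatedIn n a q b L t)
      (W.filter fun i => (W.filter fun j => ServedBefore a q j i).card < b (t + 1)) :=
    hdisj.mono_right (Finset.filter_subset _ _)
  rw [harr, htr, Finset.card_union_of_disjoint hdisj, Finset.card_union_of_disjoint hd2,
    card_filter_rank_lt (ServedBefore a q) (fun h h' => h.trans h') ServedBefore.irrefl
      ServedBefore.total]
  omega

/-- If more units of queue `k` are treated than have arrived by `u`, then all units of the queue
that have arrived by `u` are treated. -/
theorem mem_treatedBy_of_card_lt {k : Fin K} {t : ℕ} {u : ℝ}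
    (h : (arrivedIn n a q {k} u).card < (treatedIn n a q b {k} t).card) {i : ℕ} (hi : i < n)
    (hq : q i = k) (ha : a i ≤ u) : i ∈ treatedBy n a q b t := by
  -- Pigeonhole: some treated unit of the queue arrived after `u`, and service in order of arrival
  -- then covers everyone who came by `u`.
  obtain ⟨j, hj, hj'⟩ := Finset.exists_mem_notMem_of_card_lt_card h
  simp only [treatedIn, arrivedIn, Finset.mem_filter, Finset.mem_singleton, Finset.mem_range]
    at hj hj'
  have hjn := (arrived_of_mem_treatedBy hj.1).1
  have hju : u < a j := by
    by_contra hju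
    exact hj' ⟨hjn, not_lt.1 hju, hj.2⟩
  exact mem_treatedBy_of_servedBefore hj.1 hi (hq.trans hj.2.symm)
    (ServedBefore.of_lt (hq.trans hj.2.symm) (ha.trans_lt hju))

/-- If fewer units of queue `k` are treated than have arrived by `u`, then no unit of the queue
that arrived after `u` is treated. -/
theorem notMem_treatedBy_of_card_lt {k : Fin K} {t : ℕ} {u : ℝ}
    (h : (treatedIn n a q b {k} t).card < (arrivedIn n a q {k} u).card) {i : ℕ}
    (hq : q i = k) (ha : u < a i) : i ∉ treatedBy n a q b t := by
  intro hi
  obtain ⟨j, hj, hj'⟩ := Finset.exists_mem_notMem_of_card_lt_card h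
  simp only [treatedIn, arrivedIn, Finset.mem_filter, Finset.mem_singleton, Finset.mem_range]
    at hj hj'
  exact hj' ⟨mem_treatedBy_of_servedBefore hi hj.1 (hj.2.2.trans hq.symm)
    (ServedBefore.of_lt (hj.2.2.trans hq.symm) (hj.2.1.trans_lt ha)), hj.2.2⟩

/-- Queue `k` is what the queues up to `k` have in addition to those before `k`. -/
theorem card_treatedIn_singleton (k : Fin K) (t : ℕ) :
    (treatedIn n a q b {k} t).card + (treatedIn n a q b (Finset.Iio k) t).card =
      (treatedIn n a q b (Finset.Iic k) t).card := by
  classical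
  rw [← Finset.card_union_of_disjoint]
  · congr 1
    ext i
    simp only [treatedIn, Finset.mem_union, Finset.mem_filter, Finset.mem_singleton,
      Finset.mem_Iio, Finset.mem_Iic, le_iff_lt_or_eq]
    tauto
  · rw [Finset.disjoint_left]
    intro i hi hi'
    simp only [treatedIn, Finset.mem_filter, Finset.mem_singleton, Finset.mem_Iio] at hi hi'
    exact absurd hi.2 hi'.2.ne

end ServiceOrder

/-! ### Measurability of the assignment. -/

section Measurability

variable {Ω : Type*} [MeasurableSpace Ω] {K : ℕ} {a : ℕ → Ω → ℝ} {q : ℕ → Ω → Fin K}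

theorem measurableSet_servedBefore (ha : ∀ i, Measurable (a i)) (hq : ∀ i, Measurable (q i))
    (j i : ℕ) : MeasurableSet {ω | ServedBefore (fun l => a l ω) (fun l => q l ω) j i} := by
  have h1 : MeasurableSet {ω | q j ω < q i ω} :=
    ((hq j).prodMk (hq i)) (MeasurableSet.of_discrete (s := {x : Fin K × Fin K | x.1 < x.2}))
  have h2 : MeasurableSet {ω | q j ω = q i ω} :=
    ((hq j).prodMk (hq i)) (MeasurableSet.of_discrete (s := {x : Fin K × Fin K | x.1 = x.2}))
  have h3 : MeasurableSet {ω | a j ω < a i ω} := measurableSet_lt (ha j) (ha i)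
  have h4 : MeasurableSet {ω | a j ω = a i ω} := measurableSet_eq_fun (ha j) (ha i)
  exact h1.union (h2.inter (h3.union (h4.inter (MeasurableSet.const (j < i)))))

/-- The cardinality of a random subset of `{0, …, n - 1}` is measurable. -/
theorem measurable_card_of_subset_range {n : ℕ} {S : Ω → Finset ℕ}
    (hS : ∀ ω, S ω ⊆ Finset.range n) (hmeas : ∀ i, MeasurableSet {ω | i ∈ S ω}) :
    Measurable fun ω => (S ω).card := by
  classical
  have : (fun ω => (S ω).card) = fun ω => ∑ i ∈ Finset.range n, if i ∈ S ω then 1 else 0 := by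
    ext ω
    rw [← Finset.sum_filter, ← Finset.card_eq_sum_ones, Finset.filter_mem_eq_inter,
      Finset.inter_eq_right.2 (hS ω)]
  rw [this]
  exact Finset.measurable_fun_sum _ fun i _ =>
    Measurable.ite (hmeas i) measurable_const measurable_const

/-- Stated for arbitrary measurable arrival times and queues, over any σ-algebra, so that it also
applies to the assignment with one queue frozen. -/
theorem measurableSet_mem_treatedBy (ha : ∀ i, Measurable (a i)) (hq : ∀ i, Measurable (q i))
    (n : ℕ) (b : ℕ → ℕ) (t i : ℕ) :
    MeasurableSet {ω | i ∈ treatedBy n (fun l => a l ω) (fun l => q l ω) b t} := by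
  classical
  induction t generalizing i with
  | zero => simp [treatedBy]
  | succ t ih =>
    have hw : ∀ i, MeasurableSet {ω | i ∈ waitingAt n (fun l => a l ω) (fun l => q l ω) b t} := by
      intro i
      simp only [mem_waitingAt]
      exact (MeasurableSet.const _).inter
        ((measurableSet_le (ha i) measurable_const).inter (ih i).compl)
    have hc : Measurable fun ω => ((waitingAt n (fun l => a l ω) (fun l => q l ω) b t).filter
        fun j => ServedBefore (fun l => a l ω) (fun l => q l ω) j i).card := by
      apply measurable_card_of_subset_range (n := n)
      · intro ω j hj
        exact Finset.mem_range.2 (mem_waitingAt.1 (Finset.mem_filter.1 hj).1).1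
      · intro j
        simp only [Finset.mem_filter]
        exact (hw j).inter (measurableSet_servedBefore ha hq j i)
    simp only [treatedBy_succ, Finset.mem_union, Finset.mem_filter]
    refine (ih i).union ((hw i).inter ?_)
    convert! measurableSet_lt hc (measurable_const (a := b (t + 1))) using 1

end Measurability

/-! ### The joint law of a unit's arrival, covariates and queue. -/

namespace QueueExperiment

variable {Ω : Type*} [MeasurableSpace Ω] {P : Measure Ω} {d K : ℕ}

/-- The data of unit `i` apart from its queue. -/
def prim (E : QueueExperiment P d K) (i : ℕ) (ω : Ω) :
    ℝ × EuclideanSpace ℝ (Fin d) × ℝ × ℝ := (E.A i ω, E.X i ω, E.Y0 i ω, E.Y1 i ω)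

/-- All data of unit `i`. -/
def unit (E : QueueExperiment P d K) (i : ℕ) (ω : Ω) :
    ℝ × EuclideanSpace ℝ (Fin d) × ℝ × ℝ × Fin K :=
  (E.A i ω, E.X i ω, E.Y0 i ω, E.Y1 i ω, E.Q i ω)

theorem measurable_prim (E : QueueExperiment P d K) (i : ℕ) : Measurable (E.prim i) :=
  (E.measurable_A i).prodMk ((E.measurable_X i).prodMk
    ((E.measurable_Y0 i).prodMk (E.measurable_Y1 i)))

theorem measurable_unit (E : QueueExperiment P d K) (i : ℕ) : Measurable (E.unit i) :=
  (E.measurable_A i).prodMk ((E.measurable_X i).prodMk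
    ((E.measurable_Y0 i).prodMk ((E.measurable_Y1 i).prodMk (E.measurable_Q i))))

theorem iIndepFun_unit (E : QueueExperiment P d K) : iIndepFun E.unit P := E.indep

theorem identDistrib_unit (E : QueueExperiment P d K) (i : ℕ) :
    IdentDistrib (E.unit i) (E.unit 0) P P := E.identDistrib i

/-- An almost sure property of unit `0` holds for every unit. -/
theorem ae_unit (E : QueueExperiment P d K)
    {p : ℝ × EuclideanSpace ℝ (Fin d) × ℝ × ℝ × Fin K → Prop} (hp : MeasurableSet {w | p w})
    (h : ∀ᵐ ω ∂P, p (E.unit 0 ω)) (i : ℕ) : ∀ᵐ ω ∂P, p (E.unit i ω) :=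
  (E.identDistrib_unit i).symm.ae_snd hp h

open Classical in
theorem measurable_Z (E : QueueExperiment P d K) (n i : ℕ) : Measurable (E.Z n i) :=
  Measurable.ite (measurableSet_mem_treatedBy E.measurable_A E.measurable_Q n (E.b n) E.τ i)
    measurable_const measurable_const

theorem Z_eq_zero_or_one (E : QueueExperiment P d K) (n i : ℕ) (ω : Ω) :
    E.Z n i ω = 0 ∨ E.Z n i ω = 1 := by
  unfold Z; split_ifs <;> simp

theorem Z_nonneg (E : QueueExperiment P d K) (n i : ℕ) (ω : Ω) : 0 ≤ E.Z n i ω := by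
  rcases E.Z_eq_zero_or_one n i ω with h | h <;> simp [h]

theorem Z_le_one (E : QueueExperiment P d K) (n i : ℕ) (ω : Ω) : E.Z n i ω ≤ 1 := by
  rcases E.Z_eq_zero_or_one n i ω with h | h <;> simp [h]

open Classical in
theorem measurable_err (E : QueueExperiment P d K) {g : EuclideanSpace ℝ (Fin d) → ℝ}
    (hg : Measurable g) (i : ℕ) : Measurable (E.err g i) :=
  (E.measurable_Y0 i).sub (hg.comp (E.measurable_X i))

theorem θ_nonneg (E : QueueExperiment P d K) (x : EuclideanSpace ℝ (Fin d)) (k : Fin K) :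
    0 ≤ E.θ x k := (E.θ_mem x).1 k

theorem θ_sum (E : QueueExperiment P d K) (x : EuclideanSpace ℝ (Fin d)) :
    ∑ k, E.θ x k = 1 := (E.θ_mem x).2

theorem θ_le_one (E : QueueExperiment P d K) (x : EuclideanSpace ℝ (Fin d)) (k : Fin K) :
    E.θ x k ≤ 1 := by
  rw [← E.θ_sum x]
  exact Finset.single_le_sum (fun j _ => E.θ_nonneg x j) (Finset.mem_univ k)

theorem abs_θ_le_one (E : QueueExperiment P d K) (x : EuclideanSpace ℝ (Fin d)) (k : Fin K) :
    |E.θ x k| ≤ 1 := by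
  rw [abs_of_nonneg (E.θ_nonneg x k)]
  exact E.θ_le_one x k

theorem measurable_θ_X (E : QueueExperiment P d K) (k : Fin K) :
    Measurable fun ω => E.θ (E.X 0 ω) k :=
  (measurable_pi_apply k).comp (E.measurable_θ.comp (E.measurable_X 0))

section QueueLaw

variable (E : QueueExperiment P d K) {G : Fin K → ℝ × EuclideanSpace ℝ (Fin d) × ℝ × ℝ → ℝ}

theorem integrable_mul_indicator_queue
    (hint : Integrable (fun ω => G (E.Q 0 ω) (E.prim 0 ω)) P) (k : Fin K) :
    Integrable (fun ω => G k (E.prim 0 ω) * (E.Q 0 ⁻¹' {k}).indicator (fun _ => (1 : ℝ)) ω) P := by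
  have hk : MeasurableSet (E.Q 0 ⁻¹' {k}) := E.measurable_Q 0 (measurableSet_singleton k)
  refine (hint.indicator hk).congr (ae_of_all _ fun ω => ?_)
  by_cases h : E.Q 0 ω = k
  · simp [h]
  · simp [h]

variable [IsProbabilityMeasure P]

/-- Given `(A, X, Y⁰, Y¹)`, the queue is drawn from `θ(X)`. -/
theorem condExp_mul_indicator_queue (hG : ∀ k, Measurable (G k))
    (hint : Integrable (fun ω => G (E.Q 0 ω) (E.prim 0 ω)) P) (k : Fin K) :
    P[fun ω => G k (E.prim 0 ω) * (E.Q 0 ⁻¹' {k}).indicator (fun _ => (1 : ℝ)) ω |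
      MeasurableSpace.comap (E.prim 0) inferInstance]
      =ᵐ[P] fun ω => G k (E.prim 0 ω) * E.θ (E.X 0 ω) k := by
  have hk : MeasurableSet (E.Q 0 ⁻¹' {k}) := E.measurable_Q 0 (measurableSet_singleton k)
  have h1 := condExp_mul_of_stronglyMeasurable_left
    (m := MeasurableSpace.comap (E.prim 0) inferInstance) (μ := P)
    (f := fun ω => G k (E.prim 0 ω)) (g := (E.Q 0 ⁻¹' {k}).indicator (fun _ => (1 : ℝ)))
    ((hG k).comp (comap_measurable _)).stronglyMeasurable
    (E.integrable_mul_indicator_queue hint k) ((integrable_const 1).indicator hk)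
  refine h1.trans ?_
  filter_upwards [E.queue_law k] with ω hω
  simp only [Pi.mul_apply]
  congr 1

/-- Decomposing over the queue and conditioning on the other data replaces each queue indicator by
θ_k(X). Every later use of the randomization of queues against potential outcomes goes through this
formula. -/
theorem integral_queue (hG : ∀ k, Measurable (G k))
    (hint : Integrable (fun ω => G (E.Q 0 ω) (E.prim 0 ω)) P) :
    ∫ ω, G (E.Q 0 ω) (E.prim 0 ω) ∂P = ∑ k, ∫ ω, G k (E.prim 0 ω) * E.θ (E.X 0 ω) k ∂P := by
  have h1 : ∀ ω, G (E.Q 0 ω) (E.prim 0 ω)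
      = ∑ k, G k (E.prim 0 ω) * (E.Q 0 ⁻¹' {k}).indicator (fun _ => (1 : ℝ)) ω := by
    intro ω
    rw [Finset.sum_eq_single (E.Q 0 ω)]
    · simp
    · intro k _ hk
      simp [hk.symm]
    · simp
  simp_rw [h1]
  rw [integral_finsetSum _ fun k _ => E.integrable_mul_indicator_queue hint k]
  refine Finset.sum_congr rfl fun k _ => ?_
  rw [← integral_congr_ae (E.condExp_mul_indicator_queue hG hint k),
    integral_condExp (E.measurable_prim 0).comap_le]

/-- The arrival time is independent of the covariates and the queue. -/
theorem indepFun_arrival (hA : E.IndepArrivals) :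
    IndepFun (E.A 0) (fun ω => (E.X 0 ω, E.Q 0 ω)) P := by
  rw [indepFun_iff_measure_inter_preimage_eq_mul]
  intro s t hs ht
  classical
  have htk : ∀ k, MeasurableSet {x | (x, k) ∈ t} := fun k => measurable_prodMk_right ht
  have hG : ∀ (s : Set ℝ), MeasurableSet s → ∀ k : Fin K,
      Measurable fun z : ℝ × EuclideanSpace ℝ (Fin d) × ℝ × ℝ =>
      s.indicator (fun _ => (1 : ℝ)) z.1 * {x | (x, k) ∈ t}.indicator (fun _ => (1 : ℝ)) z.2.1 :=
    fun s hs k => ((measurable_const.indicator hs).comp measurable_fst).mul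
      ((measurable_const.indicator (htk k)).comp measurable_snd.fst)
  have hQt : MeasurableSet ((fun ω => (E.X 0 ω, E.Q 0 ω)) ⁻¹' t) :=
    ((E.measurable_X 0).prodMk (E.measurable_Q 0)) ht
  -- The factor on the right does not involve `s`; the choice `s = Set.univ` below identifies it as
  -- the probability of `t`.
  have hcalc : ∀ s : Set ℝ, MeasurableSet s →
      P.real (E.A 0 ⁻¹' s ∩ (fun ω => (E.X 0 ω, E.Q 0 ω)) ⁻¹' t) =
      P.real (E.A 0 ⁻¹' s) * ∑ k, ∫ ω, {x | (x, k) ∈ t}.indicator (fun _ => (1 : ℝ)) (E.X 0 ω)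
        * E.θ (E.X 0 ω) k ∂P := by
    intro s hs
    have hst : MeasurableSet (E.A 0 ⁻¹' s ∩ (fun ω => (E.X 0 ω, E.Q 0 ω)) ⁻¹' t) :=
      (E.measurable_A 0 hs).inter hQt
    have heq : ∀ ω, (E.A 0 ⁻¹' s ∩ (fun ω => (E.X 0 ω, E.Q 0 ω)) ⁻¹' t).indicator
        (1 : Ω → ℝ) ω = s.indicator (fun _ => (1 : ℝ)) (E.prim 0 ω).1 *
          {x | (x, E.Q 0 ω) ∈ t}.indicator (fun _ => (1 : ℝ)) (E.prim 0 ω).2.1 := by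
      intro ω
      simp only [Set.indicator, Set.mem_inter_iff, Set.mem_preimage, Set.mem_ofPred_eq, prim, Pi.one_apply]
      split_ifs <;> simp_all
    have hint : Integrable (fun ω => s.indicator (fun _ => (1 : ℝ)) (E.prim 0 ω).1 *
          {x | (x, E.Q 0 ω) ∈ t}.indicator (fun _ => (1 : ℝ)) (E.prim 0 ω).2.1) P :=
      ((integrable_const (1 : ℝ)).indicator hst).congr (ae_of_all _ heq)
    rw [← integral_indicator_one hst, integral_congr_ae (ae_of_all _ heq),
      E.integral_queue (hG s hs) hint, Finset.mul_sum]
    refine Finset.sum_congr rfl fun k _ => ?_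
    -- θ_k(X) is a function of X, so independence of A and X is all that is needed here.
    have hind : IndepFun (fun ω => s.indicator (fun _ => (1 : ℝ)) (E.A 0 ω))
        (fun ω => {x | (x, k) ∈ t}.indicator (fun _ => (1 : ℝ)) (E.X 0 ω)
        * E.θ (E.X 0 ω) k) P :=
      hA.comp (measurable_const.indicator hs) ((measurable_const.indicator (htk k)).mul
        ((measurable_pi_apply k).comp E.measurable_θ))
    have hAs : P.real (E.A 0 ⁻¹' s) = ∫ ω, s.indicator (fun _ => (1 : ℝ)) (E.A 0 ω) ∂P := by
      rw [← integral_indicator_one (E.measurable_A 0 hs)]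
      rfl
    rw [hAs, ← hind.integral_fun_mul_eq_mul_integral]
    · simp only [prim, mul_assoc]
    · exact ((measurable_const.indicator hs).comp (E.measurable_A 0)).aestronglyMeasurable
    · exact (((measurable_const.indicator (htk k)).mul
        ((measurable_pi_apply k).comp E.measurable_θ)).comp
          (E.measurable_X 0)).aestronglyMeasurable
  have h1 := hcalc s hs
  have h2 := hcalc Set.univ MeasurableSet.univ
  rw [Set.preimage_univ, Set.univ_inter, probReal_univ, one_mul] at h2
  rw [← h2] at h1
  rwa [← ENNReal.toReal_eq_toReal_iff' (measure_ne_top _ _)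
    (ENNReal.mul_ne_top (measure_ne_top _ _) (measure_ne_top _ _)), ENNReal.toReal_mul]

theorem prob_queue {p : Fin K → ℝ} (hp : E.FixedQueue p) (k : Fin K) :
    P.real {ω | E.Q 0 ω = k} = p k := by
  have hk : MeasurableSet (E.Q 0 ⁻¹' {k}) := E.measurable_Q 0 (measurableSet_singleton k)
  rw [← hp k, ← integral_congr_ae (E.queue_law k)]
  refine Eq.trans ?_ (integral_condExp (E.measurable_prim 0).comap_le).symm
  rw [integral_indicator_const _ hk, smul_eq_mul, mul_one]
  rfl

end QueueLaw

end QueueExperiment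

/-! ### Laws of large numbers and the limiting assignment. -/

namespace QueueExperiment

variable {Ω : Type*} [MeasurableSpace Ω] {P : Measure Ω} {d K : ℕ}

/-- The distribution function of the arrival times. -/
def arrCdf (E : QueueExperiment P d K) (t : ℝ) : ℝ := P.real {ω | E.A 0 ω ≤ t}

variable (E : QueueExperiment P d K)

/-- The strong law of large numbers for functions of the units. -/
theorem strong_law_unit {f : ℝ × EuclideanSpace ℝ (Fin d) × ℝ × ℝ × Fin K → ℝ}
    (hf : Measurable f) (hint : Integrable (fun ω => f (E.unit 0 ω)) P) :
    ∀ᵐ ω ∂P, Tendsto (fun n : ℕ => (∑ i ∈ Finset.range n, f (E.unit i ω)) / n) atTop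
      (𝓝 (∫ ω, f (E.unit 0 ω) ∂P)) :=
  strong_law_ae_real (fun i ω => f (E.unit i ω)) hint
    (fun _ _ hij => (E.iIndepFun_unit.indepFun hij).comp hf hf)
    (fun i => (E.identDistrib_unit i).comp hf)

theorem arrCdf_nonneg (t : ℝ) : 0 ≤ E.arrCdf t := measureReal_nonneg

theorem arrCdf_zero : E.arrCdf 0 = 0 := by
  have h : P {ω | E.A 0 ω ≤ 0} ≤ P {ω | E.A 0 ω = 0} := by
    apply measure_mono_ae
    filter_upwards [E.arrival_mem] with ω hω h
    exact le_antisymm h hω.1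
  rw [E.arrival_continuous] at h
  simp [arrCdf, measureReal_def, nonpos_iff_eq_zero.1 h]

/-- The budget condition starts at period 1; at `t = 0` both sides vanish, since arrivals are
nonnegative and have no atom at zero. -/
theorem tendsto_budget {β : ℝ} (hb : E.StableBudget β) {t : ℕ} (ht : t ≤ E.τ) :
    Tendsto (fun n : ℕ => (∑ s ∈ Finset.Icc 1 t, (E.b n s : ℝ)) / n) atTop
      (𝓝 (β * E.arrCdf t)) := by
  rcases Nat.eq_zero_or_pos t with rfl | hpos
  · simp [E.arrCdf_zero]
  · have h := hb.2 t (Finset.mem_Icc.2 ⟨hpos, ht⟩)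
    have h2 := ((tendsto_zero_iff_abs_tendsto_zero _).2 h).add_const (β * E.arrCdf t)
    rw [zero_add] at h2
    refine h2.congr fun n => ?_
    rw [arrCdf]; ring

theorem tendsto_budget_succ {β : ℝ} (hb : E.StableBudget β) {t : ℕ} (ht : t + 1 ≤ E.τ) :
    Tendsto (fun n : ℕ => (E.b n (t + 1) : ℝ) / n) atTop
      (𝓝 (β * (E.arrCdf ((t + 1 : ℕ) : ℝ) - E.arrCdf t))) := by
  have h := (E.tendsto_budget hb ht).sub (E.tendsto_budget hb (Nat.le_of_succ_le ht))
  rw [← mul_sub] at h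
  refine h.congr fun n => ?_
  rw [Finset.sum_Icc_succ_top (by omega)]
  ring

/-- The treatment status of unit `i` in the limit: units are treated in queue `q` if they arrive by
the time `u q`. -/
def limitZ (E : QueueExperiment P d K) (u : Fin K → ℝ) (i : ℕ) (ω : Ω) : ℝ :=
  (Set.Iic (u (E.Q i ω))).indicator (fun _ => 1) (E.A i ω)

theorem limitZ_eq_zero_or_one (u : Fin K → ℝ) (i : ℕ) (ω : Ω) :
    E.limitZ u i ω = 0 ∨ E.limitZ u i ω = 1 := by
  unfold limitZ
  by_cases h : E.A i ω ∈ Set.Iic (u (E.Q i ω)) <;> simp [h]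

theorem measurable_card_treatedIn (n : ℕ) (L : Finset (Fin K))
    (t : ℕ) : Measurable fun ω =>
      (treatedIn n (fun j => E.A j ω) (fun j => E.Q j ω) (E.b n) L t).card := by
  refine measurable_card_of_subset_range (n := n) (fun ω i hi => ?_) (fun i => ?_)
  · exact Finset.mem_range.2 (arrived_of_mem_treatedBy (Finset.mem_filter.1 hi).1).1
  · simp only [treatedIn, Finset.mem_filter]
    exact (measurableSet_mem_treatedBy E.measurable_A E.measurable_Q n _ t i).inter
      (E.measurable_Q i (MeasurableSet.of_discrete (s := {k : Fin K | k ∈ L})))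

theorem measurable_card_arrivedIn (n : ℕ) (L : Finset (Fin K))
    (u : ℝ) : Measurable fun ω =>
      (arrivedIn n (fun j => E.A j ω) (fun j => E.Q j ω) L u).card := by
  refine measurable_card_of_subset_range (n := n) (fun ω i hi => ?_) (fun i => ?_)
  · exact (Finset.mem_filter.1 hi).1
  · simp only [arrivedIn, Finset.mem_filter]
    exact (MeasurableSet.const _).inter ((measurableSet_le (E.measurable_A i) measurable_const).inter
      (E.measurable_Q i (MeasurableSet.of_discrete (s := {k : Fin K | k ∈ L}))))

theorem measurable_limitZ (u : Fin K → ℝ) (i : ℕ) :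
    Measurable (E.limitZ u i) := by
  have : E.limitZ u i = fun ω => if E.A i ω ≤ u (E.Q i ω) then 1 else 0 := by
    ext ω; simp [limitZ, Set.indicator]
  rw [this]
  exact Measurable.ite (measurableSet_le (E.measurable_A i)
    ((measurable_of_finite u).comp (E.measurable_Q i))) measurable_const measurable_const

variable [IsProbabilityMeasure P]

theorem arrCdf_mono : Monotone E.arrCdf := fun _ _ h =>
  measureReal_mono fun _ hω => le_trans hω h

theorem arrCdf_τ : E.arrCdf E.τ = 1 := by
  have h : P {ω | E.A 0 ω ≤ E.τ} = P Set.univ := by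
    apply measure_congr
    filter_upwards [E.arrival_mem] with ω hω
    exact eq_true hω.2
  simp [arrCdf, measureReal_def, h]

/-- The jump of a distribution function at a point is the mass of that point, which is zero here. -/
theorem continuous_arrCdf : Continuous E.arrCdf := by
  have hprob : IsProbabilityMeasure (P.map (E.A 0)) :=
    Measure.isProbabilityMeasure_map (E.measurable_A 0).aemeasurable
  have hF : E.arrCdf = fun t => cdf (P.map (E.A 0)) t := by
    ext t
    rw [cdf_eq_real, map_measureReal_apply (E.measurable_A 0) measurableSet_Iic]
    rfl
  rw [hF, continuous_iff_continuousAt]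
  intro t
  rw [(monotone_cdf _).continuousAt_iff_leftLim_eq_rightLim, StieltjesFunction.rightLim_eq]
  have h1 := StieltjesFunction.measure_singleton (cdf (P.map (E.A 0))) t
  rw [measure_cdf, Measure.map_apply (E.measurable_A 0) (measurableSet_singleton t)] at h1
  have h2 : P (E.A 0 ⁻¹' {t}) = 0 := E.arrival_continuous t
  rw [h2, eq_comm, ENNReal.ofReal_eq_zero] at h1
  have h3 := (monotone_cdf (P.map (E.A 0))).leftLim_le (le_refl t)
  linarith

/-- Intermediate value theorem between 0 and τ. It provides the cutoff times u_k with F(u_k) = α_k,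
as well as cutoffs slightly to either side. -/
theorem exists_arrCdf_eq {v : ℝ} (hv : v ∈ Set.Icc (0 : ℝ) 1) : ∃ u, E.arrCdf u = v := by
  have h := intermediate_value_Icc (Nat.cast_nonneg (α := ℝ) E.τ) E.continuous_arrCdf.continuousOn
  rw [E.arrCdf_zero, E.arrCdf_τ] at h
  obtain ⟨u, -, hu⟩ := h hv
  exact ⟨u, hu⟩

variable {E} {p : Fin K → ℝ} {β : ℝ}

theorem prob_arrival_queue (hp : E.FixedQueue p) (hA : E.IndepArrivals) (u : ℝ)
    (L : Finset (Fin K)) :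
    P.real {ω | E.A 0 ω ≤ u ∧ E.Q 0 ω ∈ L} = E.arrCdf u * ∑ k ∈ L, p k := by
  classical
  have hL : P.real {ω | E.Q 0 ω ∈ L} = ∑ k ∈ L, p k := by
    have hset : {ω | E.Q 0 ω ∈ L} = ⋃ k ∈ L, {ω | E.Q 0 ω = k} := by
      ext ω; simp
    rw [hset, measureReal_biUnion_finset]
    · exact Finset.sum_congr rfl fun k _ => E.prob_queue hp k
    · intro j _ k _ hjk
      refine Set.disjoint_left.2 fun ω hj hk => hjk ?_
      exact (Eq.symm hj).trans hk
    · exact fun k _ => E.measurable_Q 0 (measurableSet_singleton k)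
  have h := ((E.indepFun_arrival hA).comp measurable_id measurable_snd).measure_inter_preimage_eq_mul
    (Set.Iic u) (L : Set (Fin K)) measurableSet_Iic MeasurableSet.of_discrete
  rw [← hL, arrCdf, measureReal_def, measureReal_def, measureReal_def, ← ENNReal.toReal_mul]
  congr 1

/-- The fraction of units that have arrived by `u` in a set of queues converges. -/
theorem tendsto_card_arrivedIn (hp : E.FixedQueue p) (hA : E.IndepArrivals) (u : ℝ)
    (L : Finset (Fin K)) :
    ∀ᵐ ω ∂P, Tendsto (fun n : ℕ =>
      ((arrivedIn n (fun j => E.A j ω) (fun j => E.Q j ω) L u).card : ℝ) / n) atTop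
      (𝓝 (E.arrCdf u * ∑ k ∈ L, p k)) := by
  classical
  set T : Set (ℝ × EuclideanSpace ℝ (Fin d) × ℝ × ℝ × Fin K) :=
    {w | w.1 ≤ u ∧ w.2.2.2.2 ∈ L} with hT
  have hTm : MeasurableSet T :=
    (measurableSet_le measurable_fst measurable_const).inter
      (measurable_snd.snd.snd.snd (MeasurableSet.of_discrete (s := {k : Fin K | k ∈ L})))
  have hpre : MeasurableSet {ω | E.A 0 ω ≤ u ∧ E.Q 0 ω ∈ L} := E.measurable_unit 0 hTm
  have hcomp : ∀ i ω, T.indicator (fun _ => (1 : ℝ)) (E.unit i ω)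
      = if E.A i ω ≤ u ∧ E.Q i ω ∈ L then 1 else 0 := fun i ω => by
    by_cases h : E.A i ω ≤ u ∧ E.Q i ω ∈ L <;> simp [T, unit, Set.indicator, h]
  have h0 : (fun ω => T.indicator (fun _ => (1 : ℝ)) (E.unit 0 ω))
      = {ω | E.A 0 ω ≤ u ∧ E.Q 0 ω ∈ L}.indicator 1 := rfl
  have h := E.strong_law_unit (f := T.indicator fun _ => (1 : ℝ))
    (measurable_const.indicator hTm)
    (by rw [h0]; exact (integrable_const (1 : ℝ)).indicator hpre)
  rw [h0, integral_indicator_one hpre, prob_arrival_queue hp hA] at h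
  filter_upwards [h] with ω hω
  refine hω.congr fun n => ?_
  simp only [hcomp, arrivedIn, Finset.sum_boole]

/-- The treated fraction in a set of top-priority queues converges. -/
theorem tendsto_card_treatedIn (hp : E.FixedQueue p) (hA : E.IndepArrivals)
    (hb : E.StableBudget β) {L : Finset (Fin K)} (hL : IsLowerSet (L : Set (Fin K))) :
    ∀ᵐ ω ∂P, ∀ t ≤ E.τ, Tendsto (fun n : ℕ =>
      ((treatedIn n (fun j => E.A j ω) (fun j => E.Q j ω) (E.b n) L t).card : ℝ) / n) atTop
      (𝓝 (min (∑ k ∈ L, p k) β * E.arrCdf t)) := by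
  have h1 : ∀ᵐ ω ∂P, ∀ t : ℕ, Tendsto (fun n : ℕ =>
      ((arrivedIn n (fun j => E.A j ω) (fun j => E.Q j ω) L t).card : ℝ) / n) atTop
      (𝓝 (E.arrCdf t * ∑ k ∈ L, p k)) :=
    ae_all_iff.2 fun t => tendsto_card_arrivedIn hp hA t L
  filter_upwards [h1] with ω hω t
  induction t with
  | zero =>
    intro _
    simp [treatedIn, treatedBy, E.arrCdf_zero]
  | succ t ih =>
    intro ht
    have h2 := ((ih (Nat.le_of_succ_le ht)).add (E.tendsto_budget_succ hb ht)).min (hω (t + 1))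
    have hmono : E.arrCdf t ≤ E.arrCdf ((t + 1 : ℕ) : ℝ) := E.arrCdf_mono (by simp)
    -- With c the total share of `L`, the limiting recursion x(t+1) = min(x(t) + β(F(t+1) - F(t)), c
    -- F(t+1)) is solved by min(c, β) F(t): arrivals bind in every period if c ≤ β, and the budget
    -- binds otherwise.
    have hlim : min (min (∑ k ∈ L, p k) β * E.arrCdf t
        + β * (E.arrCdf ((t + 1 : ℕ) : ℝ) - E.arrCdf t))
        (E.arrCdf ((t + 1 : ℕ) : ℝ) * ∑ k ∈ L, p k)
        = min (∑ k ∈ L, p k) β * E.arrCdf ((t + 1 : ℕ) : ℝ) := by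
      set x := E.arrCdf t
      set y := E.arrCdf ((t + 1 : ℕ) : ℝ)
      have hy : 0 ≤ y := E.arrCdf_nonneg _
      rcases le_total (∑ k ∈ L, p k) β with h | h
      · rw [min_eq_left h, min_eq_right]
        · ring
        · nlinarith
      · rw [min_eq_right h, min_eq_left]
        · ring
        · nlinarith
    rw [hlim] at h2
    refine h2.congr fun n => ?_
    rw [card_treatedIn_succ hL, ← add_div, min_div_div_right (Nat.cast_nonneg n)]
    push_cast
    rfl

/-- Since (β - x)₊ = β - min(x, β), the quantity α_k p_k is the limiting treated fraction of the
queues up to k minus that of the queues before k. -/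
theorem queueAlpha_mul {k : Fin K} (hk : 0 < p k) :
    queueAlpha β p k * p k = min (∑ j ∈ Finset.Iic k, p j) β - min (∑ j ∈ Finset.Iio k, p j) β := by
  rw [queueAlpha, if_pos hk, div_mul_cancel₀ _ hk.ne']
  rcases le_total (∑ j ∈ Finset.Iio k, p j) β with h | h <;>
  rcases le_total (∑ j ∈ Finset.Iic k, p j) β with h' | h' <;>
  simp [h, h']

theorem sum_Iic_eq (k : Fin K) :
    ∑ j ∈ Finset.Iic k, p j = ∑ j ∈ Finset.Iio k, p j + p k := by
  rw [← Finset.Iio_insert, Finset.sum_insert (by simp), add_comm]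

/-- The map x ↦ min(x, β) is nondecreasing and 1-Lipschitz, and `queueAlpha` is its difference
quotient over an interval of length p_k. -/
theorem queueAlpha_mem (k : Fin K) : queueAlpha β p k ∈ Set.Icc (0 : ℝ) 1 := by
  by_cases hk : 0 < p k
  · have h := queueAlpha_mul (β := β) hk
    rw [sum_Iic_eq] at h
    have h1 : 0 ≤ min (∑ j ∈ Finset.Iio k, p j + p k) β - min (∑ j ∈ Finset.Iio k, p j) β :=
      sub_nonneg.2 (min_le_min_right _ (by linarith))
    have h2 : min (∑ j ∈ Finset.Iio k, p j + p k) β - min (∑ j ∈ Finset.Iio k, p j) β ≤ p k := by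
      rcases le_total (∑ j ∈ Finset.Iio k, p j) β with h3 | h3
      · rw [min_eq_left h3]; linarith [min_le_left (∑ j ∈ Finset.Iio k, p j + p k) β]
      · rw [min_eq_right h3]; linarith [min_le_right (∑ j ∈ Finset.Iio k, p j + p k) β]
    rw [← h] at h1 h2
    exact ⟨nonneg_of_mul_nonneg_left h1 hk, by
      by_contra hlt
      nlinarith [not_le.1 hlt]⟩
  · simp [queueAlpha, hk]

/-- The treated fraction in queue `k` converges. -/
theorem tendsto_card_treatedIn_singleton (hp : E.FixedQueue p) (hA : E.IndepArrivals)
    (hb : E.StableBudget β) {k : Fin K} (hk : 0 < p k) :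
    ∀ᵐ ω ∂P, Tendsto (fun n : ℕ =>
      ((treatedIn n (fun j => E.A j ω) (fun j => E.Q j ω) (E.b n) {k} E.τ).card : ℝ) / n) atTop
      (𝓝 (queueAlpha β p k * p k)) := by
  filter_upwards [tendsto_card_treatedIn hp hA hb (L := Finset.Iic k) (by
      simpa using isLowerSet_Iic k), tendsto_card_treatedIn hp hA hb (L := Finset.Iio k) (by
      simpa using isLowerSet_Iio k)] with ω h1 h2
  have h := (h1 E.τ le_rfl).sub (h2 E.τ le_rfl)
  rw [E.arrCdf_τ, mul_one, mul_one, ← queueAlpha_mul hk] at h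
  refine h.congr fun n => ?_
  rw [← card_treatedIn_singleton]
  push_cast
  ring

/-- If `a n / n` and `c n / n` have different limits, the order of the limits is eventually that
of the sequences. -/
theorem eventually_lt_of_tendsto_div {a c : ℕ → ℕ} {x y : ℝ}
    (ha : Tendsto (fun n : ℕ => (a n : ℝ) / n) atTop (𝓝 x))
    (hc : Tendsto (fun n : ℕ => (c n : ℝ) / n) atTop (𝓝 y)) (hxy : x < y) :
    ∀ᶠ n in atTop, a n < c n := by
  filter_upwards [ha.eventually_lt hc hxy] with n hn
  by_contra hle
  have : (c n : ℝ) ≤ a n := by exact_mod_cast not_lt.1 hle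
  exact absurd hn (not_lt.2 (div_le_div_of_nonneg_right this (Nat.cast_nonneg n)))

theorem tendsto_measureReal_zero_of_ae_eventually {S : ℕ → Set Ω}
    (hS : ∀ n, MeasurableSet (S n)) (h : ∀ᵐ ω ∂P, ∀ᶠ n in atTop, ω ∉ S n) :
    Tendsto (fun n => P.real (S n)) atTop (𝓝 0) := by
  have h1 := tendsto_measure_of_ae_tendsto_indicator_of_isFiniteMeasure (μ := P) (A := ∅)
    atTop MeasurableSet.empty hS (by
      filter_upwards [h] with ω hω
      filter_upwards [hω] with n hn
      simp [hn])
  rw [measure_empty] at h1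
  exact (ENNReal.tendsto_toReal ENNReal.zero_ne_top).comp h1

theorem prob_arrival_Ioc (E : QueueExperiment P d K) (i : ℕ) (u v : ℝ) :
    P.real {ω | u < E.A i ω ∧ E.A i ω ≤ v} ≤ |E.arrCdf v - E.arrCdf u| := by
  have hid : P.real {ω | u < E.A i ω ∧ E.A i ω ≤ v} = P.real {ω | u < E.A 0 ω ∧ E.A 0 ω ≤ v} := by
    have h := ((E.identDistrib_unit i).comp measurable_fst).measure_mem_eq
      (measurableSet_Ioc (a := u) (b := v))
    exact congrArg ENNReal.toReal h
  rw [hid]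
  rcases le_total u v with huv | huv
  · have hd : {ω | u < E.A 0 ω ∧ E.A 0 ω ≤ v} = {ω | E.A 0 ω ≤ v} \ {ω | E.A 0 ω ≤ u} := by
      ext ω; simp [and_comm]
    rw [hd, measureReal_sdiff (show {ω | E.A 0 ω ≤ u} ⊆ {ω | E.A 0 ω ≤ v} from fun ω hω => le_trans hω huv)
      (measurableSet_le (E.measurable_A 0) measurable_const)]
    exact le_abs_self _
  · have he : {ω | u < E.A 0 ω ∧ E.A 0 ω ≤ v} = ∅ := by
      ext ω; simp; intro h; exact huv.trans_lt h
    rw [he, measureReal_empty]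
    exact abs_nonneg _

variable {u : Fin K → ℝ}

/-- In queue `k`, the treated units are asymptotically those that arrive by the time `u k`,
uniformly over the units. -/
theorem eventually_prob_Z_ne_limitZ_le_queue (hp : E.FixedQueue p) (hA : E.IndepArrivals)
    (hb : E.StableBudget β) (hu : ∀ k, E.arrCdf (u k) = queueAlpha β p k) {k : Fin K}
    (hk : 0 < p k) {η : ℝ} (hη : 0 < η) :
    ∀ᶠ n in atTop, ∀ i < n, P.real {ω | E.Z n i ω ≠ E.limitZ u i ω ∧ E.Q i ω = k} ≤ 4 * η := by
  set α := queueAlpha β p k with hα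
  have hα01 : α ∈ Set.Icc (0 : ℝ) 1 := queueAlpha_mem k
  -- The cutoffs `v` and `w` bracket `u k`: their levels are α - η and α + η, truncated to the unit
  -- interval.
  obtain ⟨v, hv⟩ := E.exists_arrCdf_eq (v := max (α - η) 0)
    ⟨le_max_right _ _, max_le (by linarith [hα01.2]) zero_le_one⟩
  obtain ⟨w, hw⟩ := E.exists_arrCdf_eq (v := min (α + η) 1)
    ⟨le_min (by linarith [hα01.1]) zero_le_one, min_le_right _ _⟩
  let M : ℕ → Ω → ℕ := fun n ω =>
    (treatedIn n (fun j => E.A j ω) (fun j => E.Q j ω) (E.b n) {k} E.τ).card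
  let N : ℝ → ℕ → Ω → ℕ := fun u n ω =>
    (arrivedIn n (fun j => E.A j ω) (fun j => E.Q j ω) {k} u).card
  have hMm : ∀ n, Measurable (M n) := fun n => E.measurable_card_treatedIn n {k} E.τ
  have hNm : ∀ u n, Measurable (N u n) := fun u n => E.measurable_card_arrivedIn n {k} u
  have hM := tendsto_card_treatedIn_singleton hp hA hb hk
  have hN : ∀ u, ∀ᵐ ω ∂P, Tendsto (fun n : ℕ => (N u n ω : ℝ) / n) atTop
      (𝓝 (E.arrCdf u * p k)) := fun u => by
    simpa using tendsto_card_arrivedIn hp hA u {k}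
  -- early arrivals
  have hearly : Tendsto (fun n => P.real {ω | E.arrCdf v ≠ 0 ∧ M n ω ≤ N v n ω}) atTop (𝓝 0) := by
    refine tendsto_measureReal_zero_of_ae_eventually (fun n => (MeasurableSet.const _).inter
      (measurableSet_le (hMm n) (hNm v n))) ?_
    filter_upwards [hM, hN v] with ω h1 h2
    by_cases h0 : E.arrCdf v = 0
    · simp [h0]
    · have hlt : E.arrCdf v < α := by
        rw [hv] at h0 ⊢
        rcases max_choice (α - η) 0 with h | h
        · rw [h]; linarith
        · exact absurd h h0
      filter_upwards [eventually_lt_of_tendsto_div h2 h1 (mul_lt_mul_of_pos_right hlt hk)] with n hn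
      exact fun hω => absurd hn (not_lt.2 hω.2)
  have hlate : Tendsto (fun n => P.real {ω | E.arrCdf w ≠ 1 ∧ N w n ω ≤ M n ω}) atTop (𝓝 0) := by
    refine tendsto_measureReal_zero_of_ae_eventually (fun n => (MeasurableSet.const _).inter
      (measurableSet_le (hNm w n) (hMm n))) ?_
    filter_upwards [hM, hN w] with ω h1 h2
    by_cases h0 : E.arrCdf w = 1
    · simp [h0]
    · have hlt : α < E.arrCdf w := by
        rw [hw] at h0 ⊢
        rcases min_choice (α + η) 1 with h | h
        · rw [h]; linarith
        · exact absurd h h0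
      filter_upwards [eventually_lt_of_tendsto_div h1 h2 (mul_lt_mul_of_pos_right hlt hk)] with n hn
      exact fun hω => absurd hn (not_lt.2 hω.2)
  -- If a level was truncated to 0 or 1, the counts need not separate, but then almost no unit
  -- arrives outside the cutoff and there is nothing to show on that side.
  have hv0 : E.arrCdf v = 0 → ∀ i, ∀ᵐ ω ∂P, v < E.A i ω := by
    intro h0
    refine E.ae_unit (p := fun x => v < x.1) (measurableSet_lt measurable_const measurable_fst) ?_
    rw [arrCdf, measureReal_eq_zero_iff] at h0
    rw [ae_iff]
    simpa [unit] using h0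
  have hw1 : E.arrCdf w = 1 → ∀ i, ∀ᵐ ω ∂P, E.A i ω ≤ w := by
    intro h1
    refine E.ae_unit (p := fun x => x.1 ≤ w) (measurableSet_le measurable_fst measurable_const) ?_
    have := prob_compl_eq_zero_iff (μ := P) (s := {ω | E.A 0 ω ≤ w})
      (measurableSet_le (E.measurable_A 0) measurable_const)
    exact this.2 (by
      rwa [arrCdf, measureReal_def, ENNReal.toReal_eq_one_iff] at h1)
  filter_upwards [hearly.eventually_le_const hη, hlate.eventually_le_const hη] with n h1 h2 i hi
  -- A mismatch requires either that one of two count comparisons fails, which does not involve `i`,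
  -- or that the arrival falls between `u k` and a bracketing cutoff. Each of the four events has
  -- probability at most η, uniformly in `i`.
  have hsub : P.real {ω | E.Z n i ω ≠ E.limitZ u i ω ∧ E.Q i ω = k} ≤
      P.real (({ω | E.arrCdf v ≠ 0 ∧ M n ω ≤ N v n ω} ∪ {ω | E.arrCdf w ≠ 1 ∧ N w n ω ≤ M n ω}) ∪
        ({ω | v < E.A i ω ∧ E.A i ω ≤ u k} ∪ {ω | u k < E.A i ω ∧ E.A i ω ≤ w})) := by
    refine ENNReal.toReal_mono (measure_ne_top _ _) (measure_mono_ae ?_)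
    have hv' : ∀ᵐ ω ∂P, E.arrCdf v = 0 → v < E.A i ω := by
      by_cases h0 : E.arrCdf v = 0
      · filter_upwards [hv0 h0 i] with ω hω _ using hω
      · exact ae_of_all _ fun ω h => absurd h h0
    have hw' : ∀ᵐ ω ∂P, E.arrCdf w = 1 → E.A i ω ≤ w := by
      by_cases h0 : E.arrCdf w = 1
      · filter_upwards [hw1 h0 i] with ω hω _ using hω
      · exact ae_of_all _ fun ω h => absurd h h0
    filter_upwards [hv', hw'] with ω hvω hwω hω
    obtain ⟨hne, hq⟩ := hω
    by_contra hnot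
    change ¬ (((E.arrCdf v ≠ 0 ∧ M n ω ≤ N v n ω) ∨ (E.arrCdf w ≠ 1 ∧ N w n ω ≤ M n ω)) ∨
      (v < E.A i ω ∧ E.A i ω ≤ u k) ∨ (u k < E.A i ω ∧ E.A i ω ≤ w)) at hnot
    simp only [not_or, not_and, not_le] at hnot
    obtain ⟨⟨he, hl⟩, hI1, hI2⟩ := hnot
    apply hne
    unfold limitZ Z
    rw [hq]
    by_cases hA' : E.A i ω ≤ u k
    · have hAv : E.A i ω ≤ v := by
        by_contra hlt
        exact absurd hA' (not_le.2 (hI1 (not_le.1 hlt)))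
      have h0 : E.arrCdf v ≠ 0 := fun h0 => absurd (hvω h0) (not_lt.2 hAv)
      rw [if_pos (mem_treatedBy_of_card_lt (he h0) hi hq hAv)]
      simp [hA']
    · have hAw : w < E.A i ω := hI2 (not_le.1 hA')
      have h0 : E.arrCdf w ≠ 1 := fun h0 => absurd (hwω h0) (not_le.2 hAw)
      rw [if_neg (notMem_treatedBy_of_card_lt (hl h0) hq hAw)]
      simp [hA']
  refine hsub.trans ((measureReal_union_le _ _).trans ?_)
  have h3 := measureReal_union_le (μ := P) {ω | E.arrCdf v ≠ 0 ∧ M n ω ≤ N v n ω}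
    {ω | E.arrCdf w ≠ 1 ∧ N w n ω ≤ M n ω}
  have h4 := measureReal_union_le (μ := P) {ω | v < E.A i ω ∧ E.A i ω ≤ u k}
    {ω | u k < E.A i ω ∧ E.A i ω ≤ w}
  have h5 := E.prob_arrival_Ioc i v (u k)
  have h6 := E.prob_arrival_Ioc i (u k) w
  rw [hu, ← hα, hv] at h5
  rw [hu, ← hα, hw] at h6
  have h7 : |α - max (α - η) 0| ≤ η := by
    rw [abs_le]
    constructor
    · rcases max_choice (α - η) 0 with h | h <;> rw [h] <;> linarith [hα01.1]
    · linarith [le_max_left (α - η) 0]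
  have h8 : |min (α + η) 1 - α| ≤ η := by
    rw [abs_le]
    constructor
    · rcases min_choice (α + η) 1 with h | h <;> rw [h] <;> linarith [hα01.2]
    · linarith [min_le_left (α + η) 1]
  linarith

theorem prob_queue_unit (hp : E.FixedQueue p) (i : ℕ) (k : Fin K) :
    P.real {ω | E.Q i ω = k} = p k := by
  rw [← E.prob_queue hp k]
  have h := ((E.identDistrib_unit i).comp
    (measurable_snd.snd.snd.snd)).measure_mem_eq (measurableSet_singleton k)
  exact congrArg ENNReal.toReal h

/-- The treatment status of a unit is close to its limit, uniformly over the units. -/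
theorem eventually_integral_Z_sub_limitZ_le (hp : E.FixedQueue p) (hA : E.IndepArrivals)
    (hb : E.StableBudget β) (hu : ∀ k, E.arrCdf (u k) = queueAlpha β p k) {ε : ℝ} (hε : 0 < ε) :
    ∀ᶠ n in atTop, ∀ i < n, ∫ ω, |E.Z n i ω - E.limitZ u i ω| ∂P ≤ ε := by
  have hK : 0 < (K : ℝ) + 1 := by positivity
  have h : ∀ᶠ n in atTop, ∀ k : Fin K, ∀ i < n,
      P.real {ω | E.Z n i ω ≠ E.limitZ u i ω ∧ E.Q i ω = k} ≤ ε / (K + 1) := by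
    refine eventually_all.2 fun k => ?_
    have hpk : 0 ≤ p k := by rw [← E.prob_queue hp k]; exact measureReal_nonneg
    -- A queue of probability zero contributes nothing; its treated fraction is never examined.
    rcases hpk.eq_or_lt with h0 | hk
    · refine Eventually.of_forall fun n i _ => ?_
      refine (measureReal_mono (s₂ := {ω | E.Q i ω = k}) fun ω hω => hω.2).trans ?_
      rw [prob_queue_unit hp, ← h0]
      positivity
    · have := eventually_prob_Z_ne_limitZ_le_queue hp hA hb hu hk
        (η := ε / (K + 1) / 4) (by positivity)
      filter_upwards [this] with n hn i hi
      linarith [hn i hi]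
  filter_upwards [h] with n hn i hi
  have hm : MeasurableSet {ω | E.Z n i ω ≠ E.limitZ u i ω} :=
    (measurableSet_eq_fun (E.measurable_Z n i) (E.measurable_limitZ u i)).compl
  have h1 : ∫ ω, |E.Z n i ω - E.limitZ u i ω| ∂P = P.real {ω | E.Z n i ω ≠ E.limitZ u i ω} := by
    rw [← integral_indicator_one hm]
    congr 1
    ext ω
    by_cases h : E.Z n i ω = E.limitZ u i ω
    · simp [h]
    · rw [Set.indicator_of_mem (show ω ∈ {ω | E.Z n i ω ≠ E.limitZ u i ω} from h)]
      rcases E.Z_eq_zero_or_one n i ω with h1 | h1 <;>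
      rcases E.limitZ_eq_zero_or_one u i ω with h2 | h2 <;>
      simp_all
  have h2 : {ω | E.Z n i ω ≠ E.limitZ u i ω}
      ⊆ ⋃ k : Fin K, {ω | E.Z n i ω ≠ E.limitZ u i ω ∧ E.Q i ω = k} := by
    intro ω hω
    exact Set.mem_iUnion.2 ⟨E.Q i ω, hω, rfl⟩
  rw [h1]
  calc P.real {ω | E.Z n i ω ≠ E.limitZ u i ω}
      ≤ ∑ k : Fin K, P.real {ω | E.Z n i ω ≠ E.limitZ u i ω ∧ E.Q i ω = k} :=
        (measureReal_mono h2).trans (measureReal_iUnion_fintype_le _)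
    _ ≤ ∑ _k : Fin K, ε / (K + 1) := Finset.sum_le_sum fun k _ => hn k i hi
    _ = K * (ε / (K + 1)) := by simp
    _ ≤ ε := by rw [mul_div_assoc', div_le_iff₀ hK]; nlinarith

end QueueExperiment

/-! ### Propensity scores, by freezing the queue of one unit. -/

/-- If `m₁` is independent of `m₂` and `m₁ ⊔ m₂` of `m₃`, then `m₁ ⊔ m₃` is independent of `m₂`. -/
theorem indep_sup_of_indep_of_indep_sup {Ω : Type*} {m₁ m₂ m₃ m : MeasurableSpace Ω}
    {μ : Measure Ω} [IsProbabilityMeasure μ] (h₁ : m₁ ≤ m) (h₂ : m₂ ≤ m) (h₃ : m₃ ≤ m)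
    (h₁₂ : Indep m₁ m₂ μ) (h : Indep (m₁ ⊔ m₂) m₃ μ) : Indep (m₁ ⊔ m₃) m₂ μ := by
  -- Intersections of an `m₁`-set and an `m₃`-set form a generating π-system, on which the product
  -- rule follows by splitting off first the `m₃`-set and then the `m₂`-set.
  set S : Set (Set Ω) := {u | ∃ s t, MeasurableSet[m₁] s ∧ MeasurableSet[m₃] t ∧ u = s ∩ t} with hS
  have hgen : m₁ ⊔ m₃ = MeasurableSpace.generateFrom S := by
    apply le_antisymm
    · refine sup_le (fun s hs => ?_) (fun t ht => ?_)
      · exact MeasurableSpace.measurableSet_generateFrom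
          ⟨s, Set.univ, hs, MeasurableSet.univ, (Set.inter_univ s).symm⟩
      · exact MeasurableSpace.measurableSet_generateFrom
          ⟨Set.univ, t, MeasurableSet.univ, ht, (Set.univ_inter t).symm⟩
    · refine MeasurableSpace.generateFrom_le ?_
      rintro _ ⟨s, t, hs, ht, rfl⟩
      exact (le_sup_left (a := m₁) (b := m₃) s hs).inter (le_sup_right (a := m₁) (b := m₃) t ht)
  refine IndepSets.indep (sup_le h₁ h₃) h₂ (p1 := S) (p2 := {s | MeasurableSet[m₂] s}) ?_
    (@MeasurableSpace.isPiSystem_measurableSet Ω m₂) hgen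
    (@MeasurableSpace.generateFrom_measurableSet Ω m₂).symm ?_
  · rintro _ ⟨s, t, hs, ht, rfl⟩ _ ⟨s', t', hs', ht', rfl⟩ -
    exact ⟨s ∩ s', t ∩ t', hs.inter hs', ht.inter ht', Set.inter_inter_inter_comm _ _ _ _⟩
  · rw [IndepSets_iff]
    rintro _ v ⟨s, t, hs, ht, rfl⟩ hv
    have hs' : MeasurableSet[m₁ ⊔ m₂] s := le_sup_left (a := m₁) (b := m₂) s hs
    have hv' : MeasurableSet[m₁ ⊔ m₂] v := le_sup_right (a := m₁) (b := m₂) v hv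
    rw [Indep_iff] at h h₁₂
    rw [Set.inter_right_comm, h _ _ (hs'.inter hv') ht, h₁₂ _ _ hs hv, h _ _ hs' ht]
    ring

namespace QueueExperiment

variable {Ω : Type*} [MeasurableSpace Ω] {P : Measure Ω} {d K : ℕ}

open Classical in
/-- The treatment status of unit `0` if its queue is set to `k`. -/
def frozenZ (E : QueueExperiment P d K) (n : ℕ) (k : Fin K) (ω : Ω) : ℝ :=
  if 0 ∈ treatedBy n (fun j => E.A j ω) (fun j => if j = 0 then k else E.Q j ω) (E.b n) E.τ
    then 1 else 0

/-- The σ-algebra of the units other than unit `0`. -/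
abbrev otherUnits (E : QueueExperiment P d K) : MeasurableSpace Ω :=
  ⨆ j ∈ ({0}ᶜ : Set ℕ), MeasurableSpace.comap (E.unit j) inferInstance

/-- The σ-algebra generated by covariates and queue. -/
abbrev covQueueSpace (E : QueueExperiment P d K) : MeasurableSpace Ω :=
  MeasurableSpace.comap (fun ω => (E.X 0 ω, E.Q 0 ω)) inferInstance

variable (E : QueueExperiment P d K)

theorem Z_zero_eq_frozenZ (n : ℕ) (ω : Ω) : E.Z n 0 ω = E.frozenZ n (E.Q 0 ω) ω := by
  have h : (fun j => E.Q j ω) = fun j => if j = 0 then E.Q 0 ω else E.Q j ω := by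
    ext j; split_ifs with hj <;> simp [hj]
  unfold Z frozenZ
  rw [← h]

theorem otherUnits_le : E.otherUnits ≤ ‹MeasurableSpace Ω› :=
  iSup₂_le fun j _ => (E.measurable_unit j).comap_le

theorem frozenZ_mem (n : ℕ) (k : Fin K) (ω : Ω) : E.frozenZ n k ω ∈ Set.Icc (0 : ℝ) 1 := by
  unfold frozenZ; split_ifs <;> simp

-- With its queue fixed at `k`, unit 0 enters the assignment only through its arrival time.
open Classical in
theorem measurable_frozenZ (n : ℕ) (k : Fin K) :
    Measurable[MeasurableSpace.comap (E.A 0) inferInstance ⊔ E.otherUnits] (E.frozenZ n k) := by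
  have hu : ∀ j ≠ 0, Measurable[MeasurableSpace.comap (E.A 0) inferInstance ⊔ E.otherUnits]
      (E.unit j) := fun j hj => by
    refine Measurable.mono (comap_measurable (E.unit j)) (le_trans ?_ le_sup_right) le_rfl
    exact le_iSup₂ (f := fun j (_ : j ∈ ({0}ᶜ : Set ℕ)) =>
      MeasurableSpace.comap (E.unit j) inferInstance) j hj
  refine Measurable.ite ?_ measurable_const measurable_const
  refine @measurableSet_mem_treatedBy Ω
    (MeasurableSpace.comap (E.A 0) inferInstance ⊔ E.otherUnits) K E.A
    (fun j ω => if j = 0 then k else E.Q j ω) ?_ ?_ n (E.b n) E.τ 0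
  · intro j
    by_cases hj : j = 0
    · subst hj
      exact Measurable.mono (comap_measurable (E.A 0)) le_sup_left le_rfl
    · exact measurable_fst.comp (hu j hj)
  · intro j
    by_cases hj : j = 0
    · simp [hj]
    · simp only [hj, if_false]
      exact measurable_snd.snd.snd.snd.comp (hu j hj)

theorem Z_zero_eq_sum (n : ℕ) :
    E.Z n 0 = ∑ k, (E.Q 0 ⁻¹' {k}).indicator (E.frozenZ n k) := by
  ext ω
  rw [E.Z_zero_eq_frozenZ, Finset.sum_apply, Finset.sum_eq_single (E.Q 0 ω)]
  · simp
  · intro k _ hk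
    simp [hk.symm]
  · simp

theorem preimage_Z_indicator (n i : ℕ) :
    (E.Z n i ⁻¹' {1}).indicator (fun _ => (1 : ℝ)) = E.Z n i := by
  ext ω
  rcases E.Z_eq_zero_or_one n i ω with h | h <;> simp [Set.indicator, h]

theorem comap_X_le_covQueue : MeasurableSpace.comap (E.X 0) inferInstance ≤
    MeasurableSpace.comap (fun ω => (E.X 0 ω, E.Q 0 ω)) inferInstance :=
  (measurable_fst.comp (comap_measurable (fun ω => (E.X 0 ω, E.Q 0 ω)))).comap_le

theorem measurable_covQueue : Measurable fun ω => (E.X 0 ω, E.Q 0 ω) :=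
  (E.measurable_X 0).prodMk (E.measurable_Q 0)

variable [IsProbabilityMeasure P]

/-- The arrival time of unit 0 is independent of its covariates and queue, and the other units are
independent of all of unit 0. Regrouping yields the independence that makes the queue-conditional
propensity free of x. -/
theorem indep_frozen (hA : E.IndepArrivals) :
    Indep (MeasurableSpace.comap (E.A 0) inferInstance ⊔ E.otherUnits)
      (MeasurableSpace.comap (fun ω => (E.X 0 ω, E.Q 0 ω)) inferInstance) P := by
  refine indep_sup_of_indep_of_indep_sup (E.measurable_A 0).comap_le
    ((E.measurable_X 0).prodMk (E.measurable_Q 0)).comap_le E.otherUnits_le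
    ((IndepFun_iff_Indep _ _ _).1 (E.indepFun_arrival hA)) ?_
  have h := indep_iSup_of_disjoint (fun j => (E.measurable_unit j).comap_le)
    ((iIndepFun_iff_iIndep _ _ _).1 E.iIndepFun_unit) (S := {0}) (T := {0}ᶜ) disjoint_compl_right
  refine indep_of_indep_of_le_left h ?_
  have h0 : MeasurableSpace.comap (E.unit 0) inferInstance
      ≤ ⨆ j ∈ ({0} : Set ℕ), MeasurableSpace.comap (E.unit j) inferInstance :=
    le_iSup₂ (f := fun j (_ : j ∈ ({0} : Set ℕ)) =>
      MeasurableSpace.comap (E.unit j) inferInstance) 0 rfl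
  refine le_trans (sup_le ?_ ?_) h0
  · exact (measurable_fst.comp (comap_measurable (E.unit 0))).comap_le
  · exact (measurable_snd.fst.prodMk measurable_snd.snd.snd.snd |>.comp
      (comap_measurable (E.unit 0))).comap_le

/-- The probability of treatment of a unit in queue `k`. -/
def treatProb (E : QueueExperiment P d K) (n : ℕ) (k : Fin K) : ℝ := ∫ ω, E.frozenZ n k ω ∂P

theorem integrable_frozenZ (n : ℕ) (k : Fin K) : Integrable (E.frozenZ n k) P := by
  refine Integrable.of_bound (C := 1) ?_ (ae_of_all _ fun ω => ?_)
  · exact ((E.measurable_frozenZ n k).mono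
      (sup_le (E.measurable_A 0).comap_le E.otherUnits_le) le_rfl).aestronglyMeasurable
  · rw [Real.norm_of_nonneg (E.frozenZ_mem n k ω).1]
    exact (E.frozenZ_mem n k ω).2

theorem integrable_Z (n i : ℕ) : Integrable (E.Z n i) P := by
  refine Integrable.of_bound (C := 1) (E.measurable_Z n i).aestronglyMeasurable
    (ae_of_all _ fun ω => ?_)
  rw [Real.norm_of_nonneg (E.Z_nonneg n i ω)]
  exact E.Z_le_one n i ω

/-- The treatment probability given covariates and queue depends only on the queue. -/
theorem condExp_Z_covQueue (hA : E.IndepArrivals) (n : ℕ) :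
    P[E.Z n 0 | MeasurableSpace.comap (fun ω => (E.X 0 ω, E.Q 0 ω)) inferInstance]
      =ᵐ[P] fun ω => E.treatProb n (E.Q 0 ω) := by
  have hmle : E.covQueueSpace ≤ ‹MeasurableSpace Ω› := ((E.measurable_X 0).prodMk (E.measurable_Q 0)).comap_le
  have hQ : Measurable[E.covQueueSpace] (E.Q 0) := measurable_snd.comp (comap_measurable _)
  have hk : ∀ k, MeasurableSet[E.covQueueSpace] (E.Q 0 ⁻¹' {k}) := fun k => hQ (measurableSet_singleton k)
  rw [E.Z_zero_eq_sum]
  refine (condExp_finsetSum (fun k _ => (E.integrable_frozenZ n k).indicator (hmle _ (hk k)))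
    E.covQueueSpace).trans ?_
  -- On the event that the queue is `k` the status equals the frozen one, which is independent of
  -- the conditioning σ-algebra, so its conditional expectation is its mean.
  have h1 : ∀ k, P[(E.Q 0 ⁻¹' {k}).indicator (E.frozenZ n k) | E.covQueueSpace]
      =ᵐ[P] (E.Q 0 ⁻¹' {k}).indicator fun _ => E.treatProb n k := fun k => by
    refine (condExp_indicator (E.integrable_frozenZ n k) (hk k)).trans ?_
    have := condExp_indep_eq (sup_le (E.measurable_A 0).comap_le E.otherUnits_le) hmle
      (E.measurable_frozenZ n k).stronglyMeasurable (E.indep_frozen hA)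
    filter_upwards [this] with ω hω
    simp only [Set.indicator, hω]
    rfl
  filter_upwards [ae_all_iff.2 h1] with ω hω
  rw [Finset.sum_apply, Finset.sum_congr rfl fun k _ => hω k, Finset.sum_eq_single (E.Q 0 ω)]
  · simp
  · intro k _ hk
    simp [hk.symm]
  · simp

theorem queuePropensity_ae (n : ℕ) :
    (fun ω => E.queuePropensity n (E.X 0 ω) (E.Q 0 ω)) =ᵐ[P]
      P[E.Z n 0 | MeasurableSpace.comap (fun ω => (E.X 0 ω, E.Q 0 ω)) inferInstance] := by
  have h := condDistrib_ae_eq_condExp (μ := P) ((E.measurable_X 0).prodMk (E.measurable_Q 0))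
    (E.measurable_Z n 0) (measurableSet_singleton (1 : ℝ))
  rwa [E.preimage_Z_indicator] at h

theorem propensity_ae (n : ℕ) :
    (fun ω => E.propensity n (E.X 0 ω)) =ᵐ[P]
      P[E.Z n 0 | MeasurableSpace.comap (E.X 0) inferInstance] := by
  have h := condDistrib_ae_eq_condExp (μ := P) (E.measurable_X 0)
    (E.measurable_Z n 0) (measurableSet_singleton (1 : ℝ))
  rwa [E.preimage_Z_indicator] at h

/-- The recentered instrument has conditional mean zero given the covariates. -/
theorem condExp_instr (n : ℕ) :
    P[fun ω => E.instr n (E.X 0 ω) (E.Q 0 ω) | MeasurableSpace.comap (E.X 0) inferInstance]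
      =ᵐ[P] 0 := by
  have h1 : (fun ω => E.instr n (E.X 0 ω) (E.Q 0 ω)) =ᵐ[P]
      P[E.Z n 0 | MeasurableSpace.comap (fun ω => (E.X 0 ω, E.Q 0 ω)) inferInstance] -
        P[E.Z n 0 | MeasurableSpace.comap (E.X 0) inferInstance] :=
    (E.queuePropensity_ae n).sub (E.propensity_ae n)
  refine (condExp_congr_ae h1).trans ((condExp_sub integrable_condExp integrable_condExp _).trans ?_)
  filter_upwards [condExp_condExp_of_le (f := E.Z n 0) (μ := P) E.comap_X_le_covQueue
    E.measurable_covQueue.comap_le, condExp_condExp_of_le (f := E.Z n 0) (μ := P)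
      (le_refl (MeasurableSpace.comap (E.X 0) inferInstance)) (E.measurable_X 0).comap_le]
    with ω h2 h3
  simp [h2, h3]

/-- Given the covariates, the queue is drawn from `θ(X)`. -/
theorem condExp_queue_covariates (k : Fin K) :
    P[(E.Q 0 ⁻¹' {k}).indicator (fun _ => (1 : ℝ)) | MeasurableSpace.comap (E.X 0) inferInstance]
      =ᵐ[P] fun ω => E.θ (E.X 0 ω) k := by
  have hle : MeasurableSpace.comap (E.X 0) inferInstance ≤
      MeasurableSpace.comap (E.prim 0) inferInstance :=
    (measurable_snd.fst.comp (comap_measurable (E.prim 0))).comap_le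
  have h1 := (condExp_condExp_of_le (f := (E.Q 0 ⁻¹' {k}).indicator (fun _ => (1 : ℝ))) (μ := P)
    hle (E.measurable_prim 0).comap_le).symm
  refine h1.trans ((condExp_congr_ae (E.queue_law k)).trans ?_)
  rw [condExp_of_stronglyMeasurable (E.measurable_X 0).comap_le]
  · exact (((measurable_pi_apply k).comp E.measurable_θ).comp
      (comap_measurable (E.X 0))).stronglyMeasurable
  · refine Integrable.of_bound (C := 1) (E.measurable_θ_X k).aestronglyMeasurable
      (ae_of_all _ fun ω => ?_)
    rw [Real.norm_of_nonneg (E.θ_nonneg _ k)]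
    exact E.θ_le_one _ k

/-- Tower property: the queue-conditional probabilities are constants, and they are averaged with
the weights θ_k(X). -/
theorem propensity_ae_eq_sum (hA : E.IndepArrivals) (n : ℕ) :
    (fun ω => E.propensity n (E.X 0 ω)) =ᵐ[P]
      fun ω => ∑ k, E.θ (E.X 0 ω) k * E.treatProb n k := by
  have hQ : ∀ k, MeasurableSet (E.Q 0 ⁻¹' {k}) :=
    fun k => E.measurable_Q 0 (measurableSet_singleton k)
  have h1 := (condExp_condExp_of_le (f := E.Z n 0) (μ := P) E.comap_X_le_covQueue
    E.measurable_covQueue.comap_le).symm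
  refine (E.propensity_ae n).trans (h1.trans ((condExp_congr_ae (E.condExp_Z_covQueue hA n)).trans ?_))
  have h2 : (fun ω => E.treatProb n (E.Q 0 ω))
      = ∑ k, E.treatProb n k • (E.Q 0 ⁻¹' {k}).indicator (fun _ => (1 : ℝ)) := by
    ext ω
    rw [Finset.sum_apply, Finset.sum_eq_single (E.Q 0 ω)]
    · simp
    · intro k _ hk
      simp [hk.symm]
    · simp
  rw [h2]
  refine (condExp_finsetSum (fun k _ => ((integrable_const (1 : ℝ)).indicator (hQ k)).smul _)
    _).trans ?_
  have h3 : ∀ k, P[E.treatProb n k • (E.Q 0 ⁻¹' {k}).indicator (fun _ => (1 : ℝ)) |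
      MeasurableSpace.comap (E.X 0) inferInstance]
      =ᵐ[P] fun ω => E.treatProb n k * E.θ (E.X 0 ω) k := fun k => by
    refine (condExp_smul _ _ _).trans ?_
    filter_upwards [E.condExp_queue_covariates k] with ω hω
    simp [hω]
  filter_upwards [ae_all_iff.2 h3] with ω hω
  rw [Finset.sum_apply, Finset.sum_congr rfl fun k _ => hω k]
  exact Finset.sum_congr rfl fun k _ => mul_comm _ _

variable {E} {p : Fin K → ℝ} {β : ℝ}

/-- On the event that unit 0 is in queue k, the status integrates to the treatment probability times
p_k, and the limiting status to α_k p_k. Both differ by at most the mean distance of the two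
statuses, and p_k > 0 can be divided out. -/
theorem tendsto_treatProb (hp : E.FixedQueue p) (hA : E.IndepArrivals)
    (hb : E.StableBudget β) {k : Fin K} (hk : 0 < p k) :
    Tendsto (fun n => E.treatProb n k) atTop (𝓝 (queueAlpha β p k)) := by
  choose u hu using fun k : Fin K => E.exists_arrCdf_eq (queueAlpha_mem (p := p) (β := β) k)
  have hQ : MeasurableSet (E.Q 0 ⁻¹' {k}) := E.measurable_Q 0 (measurableSet_singleton k)
  have hQm : MeasurableSet[MeasurableSpace.comap (fun ω => (E.X 0 ω, E.Q 0 ω)) inferInstance]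
      (E.Q 0 ⁻¹' {k}) :=
    (measurable_snd.comp (comap_measurable (fun ω => (E.X 0 ω, E.Q 0 ω))))
      (measurableSet_singleton k)
  have h1 : ∀ n, ∫ ω in E.Q 0 ⁻¹' {k}, E.Z n 0 ω ∂P = E.treatProb n k * p k := fun n => by
    rw [← setIntegral_condExp E.measurable_covQueue.comap_le (E.integrable_Z n 0) hQm,
      setIntegral_congr_ae (g := fun _ => E.treatProb n k) hQ (by
        filter_upwards [E.condExp_Z_covQueue hA n] with ω hω hωk
        rw [hω, show E.Q 0 ω = k from hωk]), setIntegral_const, ← E.prob_queue hp k, smul_eq_mul,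
      mul_comm]
    rfl
  have h2 : ∫ ω in E.Q 0 ⁻¹' {k}, E.limitZ u 0 ω ∂P = queueAlpha β p k * p k := by
    have hs : MeasurableSet {ω | E.A 0 ω ≤ u k} :=
      measurableSet_le (E.measurable_A 0) measurable_const
    rw [setIntegral_congr_fun (g := {ω | E.A 0 ω ≤ u k}.indicator 1) hQ
      (fun ω (hω : E.Q 0 ω = k) => by simp [limitZ, hω, Set.indicator]),
      integral_indicator_one hs, measureReal_restrict_apply hs]
    have h := prob_arrival_queue hp hA (u k) {k}
    rw [hu, Finset.sum_singleton] at h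
    rw [← h]
    congr 1
    ext ω; simp
  rw [tendsto_iff_norm_sub_tendsto_zero]
  have hlim : Tendsto (fun n => ∫ ω, |E.Z n 0 ω - E.limitZ u 0 ω| ∂P) atTop (𝓝 0) := by
    rw [Metric.tendsto_atTop']
    intro ε hε
    obtain ⟨N, hN⟩ := eventually_atTop.1
      (eventually_integral_Z_sub_limitZ_le hp hA hb hu (half_pos hε))
    refine ⟨N, fun n hn => ?_⟩
    have := hN n hn.le 0 (by omega)
    rw [Real.dist_0_eq_abs, abs_of_nonneg (integral_nonneg fun ω => abs_nonneg _)]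
    linarith
  have hint : Integrable (E.limitZ u 0) P := by
    refine Integrable.of_bound (C := 1) (E.measurable_limitZ u 0).aestronglyMeasurable
      (ae_of_all _ fun ω => ?_)
    rcases E.limitZ_eq_zero_or_one u 0 ω with h | h <;> simp [h]
  refine squeeze_zero (fun n => norm_nonneg _) (fun n => ?_) (by simpa using hlim.div_const (p k))
  have hmul : ∀ x : ℝ, |x| * p k = |x * p k| := fun x => by rw [abs_mul, abs_of_pos hk]
  rw [le_div_iff₀ hk, Real.norm_eq_abs, hmul, sub_mul, ← h1, ← h2,
    ← integral_sub (E.integrable_Z n 0).integrableOn hint.integrableOn]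
  refine (abs_integral_le_integral_abs).trans ?_
  exact setIntegral_le_integral ((E.integrable_Z n 0).sub hint).abs
    (ae_of_all _ fun ω => abs_nonneg _)

theorem θ_ae_eq_zero (hp : E.FixedQueue p) {k : Fin K} (hk : ¬ 0 < p k) :
    ∀ᵐ ω ∂P, E.θ (E.X 0 ω) k = 0 := by
  have h0 : 0 ≤ p k := by rw [← E.prob_queue hp k]; exact measureReal_nonneg
  have hpk : p k = 0 := le_antisymm (not_lt.1 hk) h0
  have h := hp k
  rw [hpk, integral_eq_zero_iff_of_nonneg (fun ω => E.θ_nonneg _ k)] at h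
  · exact h
  · refine Integrable.of_bound (C := 1) (E.measurable_θ_X k).aestronglyMeasurable
      (ae_of_all _ fun ω => ?_)
    rw [Real.norm_of_nonneg (E.θ_nonneg _ k)]
    exact E.θ_le_one _ k

/-- A queue with p_k = 0 has θ_k(X) = 0 almost surely, so the terms for which no limit of the
treatment probability is known drop out of the sum. -/
theorem tendsto_propensity_ae (hp : E.FixedQueue p) (hA : E.IndepArrivals)
    (hb : E.StableBudget β) : ∀ᵐ ω ∂P, Tendsto (fun n => E.propensity n (E.X 0 ω)) atTop
      (𝓝 (∑ k, E.θ (E.X 0 ω) k * queueAlpha β p k)) := by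
  have h0 : ∀ᵐ ω ∂P, ∀ k, ¬ 0 < p k → E.θ (E.X 0 ω) k = 0 := by
    refine ae_all_iff.2 fun k => ?_
    by_cases hk : 0 < p k
    · exact ae_of_all _ fun ω h => absurd hk h
    · filter_upwards [θ_ae_eq_zero hp hk] with ω hω _ using hω
  filter_upwards [h0, ae_all_iff.2 (E.propensity_ae_eq_sum hA)] with ω h0ω hω
  simp_rw [hω]
  refine tendsto_finsetSum _ fun k _ => ?_
  by_cases hk : 0 < p k
  · exact (tendsto_treatProb hp hA hb hk).const_mul _
  · simp [h0ω k hk]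

theorem asympPropensity_ae (hp : E.FixedQueue p) (hA : E.IndepArrivals)
    (hb : E.StableBudget β) : ∀ᵐ ω ∂P, Tendsto (fun n => E.propensity n (E.X 0 ω)) atTop
      (𝓝 (E.asympPropensity (E.X 0 ω))) := by
  filter_upwards [tendsto_propensity_ae hp hA hb] with ω hω
  rw [asympPropensity, hω.limUnder_eq]
  exact hω

theorem measurable_propensity (n : ℕ) : Measurable (E.propensity n) :=
  (Kernel.measurable_coe _ (measurableSet_singleton 1)).ennreal_toReal

theorem measurable_queuePropensity (n : ℕ) :
    Measurable fun z : EuclideanSpace ℝ (Fin d) × Fin K => E.queuePropensity n z.1 z.2 :=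
  (Kernel.measurable_coe _ (measurableSet_singleton 1)).ennreal_toReal

theorem measurable_instr (n : ℕ) :
    Measurable fun z : EuclideanSpace ℝ (Fin d) × Fin K => E.instr n z.1 z.2 :=
  (measurable_queuePropensity n).sub ((measurable_propensity n).comp measurable_fst)

theorem propensity_mem (n : ℕ) (x : EuclideanSpace ℝ (Fin d)) :
    E.propensity n x ∈ Set.Icc (0 : ℝ) 1 :=
  ⟨measureReal_nonneg, measureReal_le_one⟩

theorem queuePropensity_mem (n : ℕ) (x : EuclideanSpace ℝ (Fin d)) (k : Fin K) :
    E.queuePropensity n x k ∈ Set.Icc (0 : ℝ) 1 :=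
  ⟨measureReal_nonneg, measureReal_le_one⟩

theorem abs_instr_le_one (n : ℕ) (x : EuclideanSpace ℝ (Fin d)) (k : Fin K) :
    |E.instr n x k| ≤ 1 := by
  have h1 := E.propensity_mem n x
  have h2 := E.queuePropensity_mem n x k
  rw [instr, abs_le]
  constructor <;> linarith [h1.1, h1.2, h2.1, h2.2]

theorem tendsto_queuePropensity_ae (hp : E.FixedQueue p) (hA : E.IndepArrivals)
    (hb : E.StableBudget β) : ∀ᵐ ω ∂P, Tendsto (fun n => E.queuePropensity n (E.X 0 ω) (E.Q 0 ω))
      atTop (𝓝 (queueAlpha β p (E.Q 0 ω))) := by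
  have h0 : ∀ᵐ ω ∂P, 0 < p (E.Q 0 ω) := by
    have : ∀ k, ∀ᵐ ω ∂P, E.Q 0 ω = k → 0 < p k := fun k => by
      by_cases hk : 0 < p k
      · exact ae_of_all _ fun _ _ => hk
      · have h1 : p k = 0 := le_antisymm (not_lt.1 hk) (by
          rw [← E.prob_queue hp k]; exact measureReal_nonneg)
        rw [← E.prob_queue hp k, measureReal_eq_zero_iff] at h1
        rw [ae_iff]
        refine measure_mono_null (fun ω hω => ?_) h1
        by_contra hne
        exact hω fun h => absurd h hne
    filter_upwards [ae_all_iff.2 this] with ω hω using hω _ rfl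
  filter_upwards [h0, ae_all_iff.2 fun n => (E.queuePropensity_ae n).trans
    (E.condExp_Z_covQueue hA n)] with ω h0ω hω
  simp_rw [hω]
  exact tendsto_treatProb hp hA hb h0ω

theorem tendsto_instr_ae (hp : E.FixedQueue p) (hA : E.IndepArrivals)
    (hb : E.StableBudget β) : ∀ᵐ ω ∂P, Tendsto (fun n => E.instr n (E.X 0 ω) (E.Q 0 ω))
      atTop (𝓝 (queueAlpha β p (E.Q 0 ω) - E.asympPropensity (E.X 0 ω))) := by
  filter_upwards [tendsto_queuePropensity_ae hp hA hb, asympPropensity_ae hp hA hb] with ω h1 h2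
  exact h1.sub h2

end QueueExperiment

/-! ### Second and fourth moments of normalized i.i.d. sums. -/

section NormalizedSum

variable {Ω S : Type*} [MeasurableSpace Ω] [MeasurableSpace S] {P : Measure Ω}

/-- The sum of `F (W i)` over `i < n`, divided by `√n`. -/
def normalizedSum (W : ℕ → Ω → S) (F : S → ℝ) (n : ℕ) (ω : Ω) : ℝ :=
  (√n)⁻¹ * ∑ i ∈ Finset.range n, F (W i ω)

variable {W : ℕ → Ω → S} {F : S → ℝ} {n : ℕ}

theorem memLp_normalizedSum (hid : ∀ i, IdentDistrib (W i) (W 0) P P) (hF : Measurable F)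
    {q : ℝ≥0∞} (hL : MemLp (fun ω => F (W 0 ω)) q P) : MemLp (normalizedSum W F n) q P :=
  (memLp_finsetSum _ fun i _ => ((hid i).comp hF).memLp_iff.2 hL).const_mul _

theorem integral_normalizedSum (hid : ∀ i, IdentDistrib (W i) (W 0) P P) (hF : Measurable F)
    (hL : Integrable (fun ω => F (W 0 ω)) P) (h0 : ∫ ω, F (W 0 ω) ∂P = 0) :
    ∫ ω, normalizedSum W F n ω ∂P = 0 := by
  have hi : ∀ i, ∫ ω, F (W i ω) ∂P = 0 := fun i => by
    rw [← h0]; exact ((hid i).comp hF).integral_eq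
  unfold normalizedSum
  have hint : ∀ i, Integrable (fun ω => F (W i ω)) P :=
    fun i => ((hid i).comp hF).integrable_iff.2 hL
  rw [integral_const_mul, integral_finsetSum _ fun i _ => hint i]
  simp [hi]

variable [IsProbabilityMeasure P]

/-- The second moment of a normalized sum of centered i.i.d. variables is that of a summand. -/
theorem integral_normalizedSum_sq (hind : iIndepFun W P)
    (hid : ∀ i, IdentDistrib (W i) (W 0) P P) (hF : Measurable F)
    (hL : MemLp (fun ω => F (W 0 ω)) 2 P) (h0 : ∫ ω, F (W 0 ω) ∂P = 0) (hn : 0 < n) :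
    ∫ ω, normalizedSum W F n ω ^ 2 ∂P = ∫ ω, F (W 0 ω) ^ 2 ∂P := by
  have hi : ∀ i, IdentDistrib (fun ω => F (W i ω)) (fun ω => F (W 0 ω)) P P :=
    fun i => (hid i).comp hF
  have hLi : ∀ i, MemLp (fun ω => F (W i ω)) 2 P := fun i => (hi i).memLp_iff.2 hL
  have hvar : ∀ {f : Ω → ℝ}, MemLp f 2 P → ∫ ω, f ω ∂P = 0 → Var[f; P] = ∫ ω, f ω ^ 2 ∂P := by
    intro f hf hf0
    rw [variance_eq_sub hf, hf0]
    simp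
  rw [← hvar (memLp_normalizedSum hid hF hL) (integral_normalizedSum hid hF
    (hL.integrable one_le_two) h0), ← hvar hL h0]
  have h1 : normalizedSum W F n = fun ω => (√n)⁻¹ * (∑ i ∈ Finset.range n,
      fun ω => F (W i ω)) ω := by
    ext ω; simp [normalizedSum]
  rw [h1, variance_const_mul, IndepFun.variance_sum (fun i _ => hLi i)
    (fun i _ j _ hij => (hind.indepFun hij).comp hF hF),
    Finset.sum_congr rfl fun i _ => (hi i).variance_eq, Finset.sum_const, Finset.card_range,
    nsmul_eq_mul, inv_pow, Real.sq_sqrt (Nat.cast_nonneg n), inv_mul_cancel_left₀]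
  exact_mod_cast hn.ne'

/-- A single term of the exponential series, y⁴/4! ≤ exp y for y ≥ 0. It converts bounds on the
moment generating function at ±1 into a fourth moment bound. -/
theorem pow_four_le_exp_add_exp (x : ℝ) : x ^ 4 ≤ 24 * (Real.exp x + Real.exp (-x)) := by
  have h : ∀ y : ℝ, 0 ≤ y → y ^ 4 ≤ 24 * Real.exp y := by
    intro y hy
    have := Real.pow_div_factorial_le_exp y hy 4
    norm_num [Nat.factorial] at this
    linarith
  rcases le_total 0 x with hx | hx
  · linarith [h x hx, Real.exp_pos (-x)]
  · have := h (-x) (by linarith)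
    rw [neg_pow, show (-1 : ℝ) ^ 4 = 1 by norm_num, one_mul] at this
    linarith [Real.exp_pos x]

/-- The fourth moment of a normalized sum of bounded centered i.i.d. variables is bounded. -/
theorem integral_normalizedSum_pow_four_le (hind : iIndepFun W P)
    (hid : ∀ i, IdentDistrib (W i) (W 0) P P) (hF : Measurable F) {M : ℝ}
    (hM : ∀ s, |F s| ≤ M) (hn : 0 < n) :
    Integrable (fun ω => normalizedSum W (fun s => F s - ∫ ω, F (W 0 ω) ∂P) n ω ^ 4) P ∧
    ∫ ω, normalizedSum W (fun s => F s - ∫ ω, F (W 0 ω) ∂P) n ω ^ 4 ∂P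
      ≤ 48 * Real.exp (M ^ 2 / 2) := by
  set m := ∫ ω, F (W 0 ω) ∂P with hm
  set G := normalizedSum W (fun s => F s - m) n with hG
  have hi : ∀ i, IdentDistrib (fun ω => F (W i ω)) (fun ω => F (W 0 ω)) P P :=
    fun i => (hid i).comp hF
  have hsub : ∀ i, HasSubgaussianMGF (fun ω => F (W i ω) - m) ((‖M - -M‖₊ / 2) ^ 2) P := by
    intro i
    have := hasSubgaussianMGF_of_mem_Icc (μ := P) (X := fun ω => F (W i ω)) (a := -M) (b := M)
      (hF.comp_aemeasurable (hid i).aemeasurable_fst) (ae_of_all _ fun ω => abs_le.1 (hM _))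
    rwa [(hi i).integral_eq] at this
  have hindF : iIndepFun (fun i ω => F (W i ω) - m) P :=
    hind.comp (fun _ s => F s - m) fun _ => hF.sub_const m
  -- By Hoeffding's lemma each centered summand is sub-Gaussian with variance proxy M²; adding n of
  -- them and dividing by √n preserves the proxy.
  obtain ⟨v, hc, hsum⟩ : ∃ v : NNReal, (v : ℝ) = M ^ 2 ∧ HasSubgaussianMGF G v P := by
    refine ⟨_, ?_, (HasSubgaussianMGF.sum_of_iIndepFun hindF (s := Finset.range n)
      fun i _ => hsub i).const_mul (√n)⁻¹⟩
    refine (NNReal.coe_mul _ _).trans ?_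
    change (√(n : ℝ))⁻¹ ^ 2 * ((∑ _i ∈ Finset.range n, (‖M - -M‖₊ / 2) ^ 2 : NNReal) : ℝ) = M ^ 2
    have h1 : (|M - -M| / 2) ^ 2 = M ^ 2 := by
      rw [div_pow, sq_abs]; ring
    rw [Finset.sum_const, Finset.card_range, nsmul_eq_mul]
    push_cast
    rw [Real.norm_eq_abs, h1, inv_pow, Real.sq_sqrt (Nat.cast_nonneg n), inv_mul_cancel_left₀]
    exact_mod_cast hn.ne'
  have hmgf : ∀ t : ℝ, t ^ 2 = 1 → Integrable (fun ω => Real.exp (t * G ω)) P ∧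
      ∫ ω, Real.exp (t * G ω) ∂P ≤ Real.exp (M ^ 2 / 2) := by
    intro t ht
    refine ⟨hsum.integrable_exp_mul t, ?_⟩
    have := hsum.mgf_le t
    rwa [hc, ht, mul_one] at this
  obtain ⟨hi1, h1⟩ := hmgf 1 (by norm_num)
  obtain ⟨hi2, h2⟩ := hmgf (-1) (by norm_num)
  simp only [one_mul, neg_mul] at hi1 h1 hi2 h2
  have hint : Integrable (fun ω => 24 * (Real.exp (G ω) + Real.exp (-G ω))) P :=
    (hi1.add hi2).const_mul 24
  have hGm : AEStronglyMeasurable G P :=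
    (hsum.aestronglyMeasurable)
  have hle : ∀ ω, G ω ^ 4 ≤ 24 * (Real.exp (G ω) + Real.exp (-G ω)) :=
    fun ω => pow_four_le_exp_add_exp _
  have hint4 : Integrable (fun ω => G ω ^ 4) P := by
    refine hint.mono' (hGm.pow 4) (ae_of_all _ fun ω => ?_)
    rw [Real.norm_of_nonneg (by positivity)]
    exact hle ω
  refine ⟨hint4, (integral_mono hint4 hint hle).trans ?_⟩
  rw [integral_const_mul, integral_add hi1 hi2]
  linarith

/-- If a centered function is the sum of a bounded part and a part that is small in mean square,
then the square of its normalized sum is small in mean on events of small probability. -/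
theorem setIntegral_normalizedSum_sq_le (hind : iIndepFun W P)
    (hid : ∀ i, IdentDistrib (W i) (W 0) P P) {F₁ F₂ : S → ℝ} (hF₁ : Measurable F₁)
    (hF₂ : Measurable F₂) {M : ℝ} (hM : ∀ s, |F₁ s| ≤ M)
    (hL : MemLp (fun ω => F₂ (W 0 ω)) 2 P)
    (h0 : ∫ ω, (F₁ (W 0 ω) + F₂ (W 0 ω)) ∂P = 0) (hn : 0 < n) (B : Set Ω)
    {L : ℝ} (hLpos : 0 < L) :
    ∫ ω in B, normalizedSum W (fun s => F₁ s + F₂ s) n ω ^ 2 ∂P ≤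
      2 * (L * P.real B + 48 * Real.exp (M ^ 2 / 2) / L) + 2 * ∫ ω, F₂ (W 0 ω) ^ 2 ∂P := by
  set m₁ := ∫ ω, F₁ (W 0 ω) ∂P with hm₁
  set m₂ := ∫ ω, F₂ (W 0 ω) ∂P with hm₂
  have hW0 := (hid 0).aemeasurable_fst
  have hL₁ : MemLp (fun ω => F₁ (W 0 ω)) 2 P := by
    refine MemLp.of_bound (hF₁.comp_aemeasurable hW0).aestronglyMeasurable M
      (ae_of_all _ fun ω => hM _)
  -- Only the sum of the two parts is centered. Their means cancel, so each part may be centered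
  -- separately.
  have hm : m₁ + m₂ = 0 := by
    rw [← h0, integral_add (hL₁.integrable one_le_two) (hL.integrable one_le_two)]
  set G₁ := normalizedSum W (fun s => F₁ s - m₁) n
  set G₂ := normalizedSum W (fun s => F₂ s - m₂) n
  have hG : ∀ ω, normalizedSum W (fun s => F₁ s + F₂ s) n ω = G₁ ω + G₂ ω := by
    intro ω
    simp only [G₁, G₂, normalizedSum]
    rw [← mul_add, ← Finset.sum_add_distrib]
    congr 1
    refine Finset.sum_congr rfl fun i _ => ?_
    linarith
  obtain ⟨hi4, h4⟩ := integral_normalizedSum_pow_four_le hind hid hF₁ hM hn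
  have hL₂' : MemLp (fun ω => F₂ (W 0 ω) - m₂) 2 P := hL.sub (memLp_const _)
  have hL₁' : MemLp (fun ω => F₁ (W 0 ω) - m₁) 2 P := hL₁.sub (memLp_const _)
  have hG₁ : MemLp G₁ 2 P :=
    memLp_normalizedSum hid (F := fun s => F₁ s - m₁) (hF₁.sub_const m₁) hL₁'
  have hG₂ : MemLp G₂ 2 P :=
    memLp_normalizedSum hid (F := fun s => F₂ s - m₂) (hF₂.sub_const m₂) hL₂'
  have hsq₂ : ∫ ω, G₂ ω ^ 2 ∂P ≤ ∫ ω, F₂ (W 0 ω) ^ 2 ∂P := by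
    rw [integral_normalizedSum_sq hind hid (F := fun s => F₂ s - m₂) (hF₂.sub_const m₂) hL₂' (by
      rw [integral_sub (hL.integrable one_le_two) (integrable_const _)]; simp [hm₂]) hn]
    have := variance_le_expectation_sq (μ := P) hL.aestronglyMeasurable
    rwa [variance_eq_integral hL.aemeasurable] at this
  -- Either G₁² ≤ L, or G₁² is at most G₁⁴/L. The first bound is paid for by the probability of `B`,
  -- the second by the fourth moment.
  have hpt : ∀ ω, G₁ ω ^ 2 ≤ L + G₁ ω ^ 4 / L := by
    intro ω
    have : G₁ ω ^ 4 / L = (G₁ ω ^ 2) ^ 2 / L := by ring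
    rw [this, ← sub_nonneg]
    have h : L + (G₁ ω ^ 2) ^ 2 / L - G₁ ω ^ 2
        = ((G₁ ω ^ 2 - L) ^ 2 + G₁ ω ^ 2 * L) / L := by field_simp; ring
    rw [h]; positivity
  have hi4' : Integrable (fun ω => G₁ ω ^ 4) P := hi4
  calc ∫ ω in B, normalizedSum W (fun s => F₁ s + F₂ s) n ω ^ 2 ∂P
      ≤ ∫ ω in B, (2 * (L + G₁ ω ^ 4 / L) + 2 * G₂ ω ^ 2) ∂P := by
        refine setIntegral_mono ?_ ?_ fun ω => ?_
        · simp_rw [hG]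
          exact (hG₁.add hG₂).integrable_sq.integrableOn
        · exact ((((integrable_const L).add (hi4'.div_const L)).const_mul 2).add
            (hG₂.integrable_sq.const_mul 2)).integrableOn
        · rw [hG]
          nlinarith [hpt ω, sq_nonneg (G₁ ω - G₂ ω)]
    _ = 2 * (L * P.real B + (∫ ω in B, G₁ ω ^ 4 ∂P) / L) + 2 * ∫ ω in B, G₂ ω ^ 2 ∂P := by
        rw [integral_add, integral_const_mul, integral_const_mul, integral_add, integral_div,
          setIntegral_const, smul_eq_mul, mul_comm L]
        · exact (integrable_const L).integrableOn
        · exact (hi4'.div_const L).integrableOn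
        · exact (((integrable_const L).add (hi4'.div_const L)).const_mul 2).integrableOn
        · exact (hG₂.integrable_sq.const_mul 2).integrableOn
    _ ≤ _ := by
        have h5 : ∫ ω in B, G₁ ω ^ 4 ∂P ≤ ∫ ω, G₁ ω ^ 4 ∂P :=
          setIntegral_le_integral hi4' (ae_of_all _ fun ω => by positivity)
        have h6 : ∫ ω in B, G₂ ω ^ 2 ∂P ≤ ∫ ω, G₂ ω ^ 2 ∂P :=
          setIntegral_le_integral hG₂.integrable_sq (ae_of_all _ fun ω => by positivity)
        have h7 : (∫ ω in B, G₁ ω ^ 4 ∂P) / L ≤ 48 * Real.exp (M ^ 2 / 2) / L :=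
          div_le_div_of_nonneg_right (h5.trans h4) hLpos.le
        linarith [h6.trans hsq₂]

end NormalizedSum

/-! ### The conditional variance of a ratio. -/

section Ratio

variable {Ω : Type*} [MeasurableSpace Ω] {P : Measure Ω} [IsProbabilityMeasure P]

/-- Uniformly integrable functions times bounded functions that tend to zero in probability tend to
zero in mean. -/
theorem tendsto_integral_mul_abs_zero {H R : ℕ → Ω → ℝ} (hH0 : ∀ j ω, 0 ≤ H j ω)
    (hH : ∀ j, Integrable (H j) P) {c : ℝ} (hc : ∀ j, ∫ ω, H j ω ∂P ≤ c)
    (hui : ∀ ε : ℝ, 0 < ε → ∃ δ : ℝ, 0 < δ ∧ ∀ᶠ j in atTop, ∀ B, MeasurableSet B →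
      P.real B ≤ δ → ∫ ω in B, H j ω ∂P ≤ ε)
    (hR : ∀ j, Measurable (R j)) {b : ℝ} (hb : ∀ j ω, |R j ω| ≤ b)
    (hR0 : ∀ η : ℝ, 0 < η → Tendsto (fun j => P.real {ω | η ≤ |R j ω|}) atTop (𝓝 0)) :
    Tendsto (fun j => ∫ ω, H j ω * |R j ω| ∂P) atTop (𝓝 0) := by
  have hc0 : 0 ≤ c := (integral_nonneg (hH0 0)).trans (hc 0)
  have hb0 : 0 ≤ b := by
    obtain ⟨ω⟩ := nonempty_of_isProbabilityMeasure P
    exact (abs_nonneg _).trans (hb 0 ω)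
  rw [Metric.tendsto_atTop']
  intro ε hε
  -- Split according to whether |R| ≥ η: below the threshold the mean of `H` gives at most ηc, above
  -- it uniform integrability applies. The added ones keep the divisors positive.
  set η := ε / (4 * (c + 1)) with hη
  have hηpos : 0 < η := by positivity
  obtain ⟨δ, hδ, hui⟩ := hui (ε / (4 * (b + 1))) (by positivity)
  obtain ⟨N, hN⟩ := eventually_atTop.1 (hui.and ((hR0 η hηpos).eventually_le_const hδ))
  refine ⟨N, fun j hj => ?_⟩
  obtain ⟨h1, h2⟩ := hN j hj.le
  have hB : MeasurableSet {ω | η ≤ |R j ω|} := measurableSet_le measurable_const (hR j).abs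
  have h3 := h1 _ hB h2
  have hint : Integrable (fun ω => H j ω * |R j ω|) P :=
    (hH j).mul_bdd (c := b) (hR j).abs.aestronglyMeasurable
      (ae_of_all _ fun ω => by simpa using hb j ω)
  have h4 : ∫ ω, H j ω * |R j ω| ∂P ≤
      ∫ ω, (η * H j ω + b * {ω | η ≤ |R j ω|}.indicator (H j) ω) ∂P := by
    refine integral_mono hint (((hH j).const_mul η).add (((hH j).indicator hB).const_mul b))
      fun ω => ?_
    by_cases hω : η ≤ |R j ω|
    · rw [Set.indicator_of_mem (show ω ∈ {ω | η ≤ |R j ω|} from hω)]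
      nlinarith [hH0 j ω, hb j ω, mul_nonneg hηpos.le (hH0 j ω)]
    · rw [Set.indicator_of_notMem (show ω ∉ {ω | η ≤ |R j ω|} from hω)]
      nlinarith [hH0 j ω, not_le.1 hω]
  rw [integral_add ((hH j).const_mul η) (((hH j).indicator hB).const_mul b), integral_const_mul,
    integral_const_mul, integral_indicator hB] at h4
  rw [Real.dist_0_eq_abs, abs_of_nonneg (integral_nonneg fun ω =>
    mul_nonneg (hH0 j ω) (abs_nonneg _))]
  have h5 : η * ∫ ω, H j ω ∂P ≤ ε / 4 := by
    calc η * ∫ ω, H j ω ∂P ≤ η * (c + 1) := by gcongr; linarith [hc j]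
      _ = ε / 4 := by rw [hη]; field_simp
  have h6 : b * ∫ ω in {ω | η ≤ |R j ω|}, H j ω ∂P ≤ ε / 4 := by
    calc b * ∫ ω in {ω | η ≤ |R j ω|}, H j ω ∂P ≤ (b + 1) * (ε / (4 * (b + 1))) := by
          refine mul_le_mul (by linarith) h3 (integral_nonneg (hH0 j)) (by linarith)
      _ = ε / 4 := by field_simp
  linarith

/-- A continuous function of a sequence that converges in probability to a constant. -/
theorem tendsto_prob_comp_of_continuousAt {D : ℕ → Ω → ℝ} {I : ℝ}
    (hD : ∀ η : ℝ, 0 < η → Tendsto (fun j => P.real {ω | η ≤ |D j ω - I|}) atTop (𝓝 0))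
    {φ : ℝ → ℝ} (hφ : ContinuousAt φ I) (η : ℝ) (hη : 0 < η) :
    Tendsto (fun j => P.real {ω | η ≤ |φ (D j ω) - φ I|}) atTop (𝓝 0) := by
  obtain ⟨δ, hδ, h⟩ := Metric.continuousAt_iff.1 hφ η hη
  refine squeeze_zero (fun j => measureReal_nonneg) (fun j => measureReal_mono fun ω hω => ?_)
    (hD δ hδ)
  change δ ≤ |D j ω - I|
  by_contra hlt
  exact absurd (h (x := D j ω) (not_le.1 hlt)) (not_lt.2 hω)

/-- The mean square of a ratio of a centered, uniformly square integrable numerator and a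
denominator that converges in probability, given that the denominator is bounded away from zero. -/
theorem tendsto_variance_ratio {G D : ℕ → Ω → ℝ} {I c : ℝ} (hc : 0 < c) (hcI : c < I)
    (hG : ∀ j, MemLp (G j) 2 P) (hG0 : ∀ j, ∫ ω, G j ω ∂P = 0)
    (hG2 : Tendsto (fun j => ∫ ω, G j ω ^ 2 ∂P) atTop (𝓝 I))
    (hui : ∀ ε : ℝ, 0 < ε → ∃ δ : ℝ, 0 < δ ∧ ∀ᶠ j in atTop, ∀ B, MeasurableSet B →
      P.real B ≤ δ → ∫ ω in B, G j ω ^ 2 ∂P ≤ ε)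
    (hDm : ∀ j, Measurable (D j))
    (hD : ∀ η : ℝ, 0 < η → Tendsto (fun j => P.real {ω | η ≤ |D j ω - I|}) atTop (𝓝 0)) :
    Tendsto (fun j => P.real {ω | c ≤ |D j ω|}) atTop (𝓝 1) ∧
    (∀ᶠ j in atTop, IsProbabilityMeasure P[|{ω | c ≤ |D j ω|}]) ∧
    (∀ j, MemLp (fun ω => G j ω / D j ω) 2 P[|{ω | c ≤ |D j ω|}]) ∧
    Tendsto (fun j => Var[fun ω => G j ω / D j ω; P[|{ω | c ≤ |D j ω|}]]) atTop (𝓝 I⁻¹) := by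
  have hI : 0 < I := hc.trans hcI
  have hEm : ∀ j, MeasurableSet {ω | c ≤ |D j ω|} := fun j =>
    measurableSet_le measurable_const (hDm j).abs
  have hEm' : MeasurableSet {x : ℝ | c ≤ |x|} :=
    measurableSet_le measurable_const continuous_abs.measurable
  -- the function that is the reciprocal away from zero
  set φ : ℝ → ℝ := {x : ℝ | c ≤ |x|}.indicator fun x => x⁻¹ with hφ
  have hφm : Measurable φ := measurable_inv.indicator hEm'
  have hφb : ∀ x, |φ x| ≤ c⁻¹ := by
    intro x
    by_cases hx : c ≤ |x|
    · rw [hφ, Set.indicator_of_mem (show x ∈ {x : ℝ | c ≤ |x|} from hx), abs_inv]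
      exact inv_anti₀ hc hx
    · rw [hφ, Set.indicator_of_notMem (show x ∉ {x : ℝ | c ≤ |x|} from hx), abs_zero]
      positivity
  have hφeq : φ =ᶠ[𝓝 I] fun x => x⁻¹ := by
    filter_upwards [lt_mem_nhds hcI] with x hx
    rw [hφ, Set.indicator_of_mem]
    exact hx.le.trans (le_abs_self x)
  have hφc : ContinuousAt φ I := (continuousAt_inv₀ hI.ne').congr hφeq.symm
  have hφI : φ I = I⁻¹ := hφeq.eq_of_nhds
  -- probability of the event
  have hprob : Tendsto (fun j => P.real {ω | c ≤ |D j ω|}) atTop (𝓝 1) := by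
    have h1 := hD (I - c) (by linarith)
    have h2 : ∀ j, 1 - P.real {ω | I - c ≤ |D j ω - I|} ≤ P.real {ω | c ≤ |D j ω|} := by
      intro j
      have hm : MeasurableSet {ω | I - c ≤ |D j ω - I|} :=
        measurableSet_le measurable_const ((hDm j).sub_const I).abs
      rw [← probReal_compl_eq_one_sub hm]
      refine measureReal_mono fun ω hω => ?_
      have : |D j ω - I| < I - c := not_le.1 hω
      change c ≤ |D j ω|
      refine le_trans ?_ (le_abs_self _)
      linarith [(abs_lt.1 this).1]
    have h3 : Tendsto (fun j => 1 - P.real {ω | I - c ≤ |D j ω - I|}) atTop (𝓝 1) := by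
      simpa using h1.const_sub 1
    exact tendsto_of_tendsto_of_tendsto_of_le_of_le h3 tendsto_const_nhds h2
      fun j => measureReal_le_one
  -- the sequence `1 + G²`
  obtain ⟨C, hC⟩ := hG2.bddAbove_range
  have hGi : ∀ j, Integrable (G j) P := fun j => (hG j).integrable one_le_two
  have hHi : ∀ j, Integrable (fun ω => 1 + G j ω ^ 2) P :=
    fun j => (integrable_const _).add (hG j).integrable_sq
  have hui' : ∀ ε : ℝ, 0 < ε → ∃ δ : ℝ, 0 < δ ∧ ∀ᶠ j in atTop, ∀ B, MeasurableSet B →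
      P.real B ≤ δ → ∫ ω in B, (1 + G j ω ^ 2) ∂P ≤ ε := by
    intro ε hε
    obtain ⟨δ, hδ, h⟩ := hui (ε / 2) (half_pos hε)
    refine ⟨min δ (ε / 2), lt_min hδ (half_pos hε), ?_⟩
    filter_upwards [h] with j hj B hB hPB
    rw [integral_add (integrable_const _).integrableOn (hG j).integrable_sq.integrableOn,
      setIntegral_const, smul_eq_mul, mul_one]
    linarith [hj B hB (hPB.trans (min_le_left _ _)), hPB.trans (min_le_right _ _)]
  -- The weight 1 + G² dominates both |G| and G², so this one statement serves the first and the
  -- second moment.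
  have hkey : ∀ ψ : ℝ → ℝ, Measurable ψ → ContinuousAt ψ I → (∃ b, ∀ x, |ψ x| ≤ b) →
      Tendsto (fun j => ∫ ω, (1 + G j ω ^ 2) * |ψ (D j ω) - ψ I| ∂P) atTop (𝓝 0) := by
    rintro ψ hψm hψc ⟨b, hb⟩
    refine tendsto_integral_mul_abs_zero (c := 1 + C) (b := b + b)
      (R := fun j ω => ψ (D j ω) - ψ I) (fun j ω => by positivity) hHi
      (fun j => ?_) hui' (fun j => (hψm.comp (hDm j)).sub_const _) (fun j ω => ?_)
      (tendsto_prob_comp_of_continuousAt hD hψc)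
    · rw [integral_add (integrable_const _) (hG j).integrable_sq]
      have := hC (Set.mem_range_self j)
      simp only [integral_const, probReal_univ, one_smul]
      linarith
    · exact (abs_sub _ _).trans (add_le_add (hb _) (hb _))
  -- second moment
  have hm2 : Tendsto (fun j => ∫ ω, G j ω ^ 2 * φ (D j ω) ^ 2 ∂P) atTop (𝓝 (I * I⁻¹ ^ 2)) := by
    have hb2 : ∀ x, |φ x ^ 2| ≤ c⁻¹ ^ 2 := fun x => by
      rw [abs_pow]; exact pow_le_pow_left₀ (abs_nonneg _) (hφb x) 2
    have h1 := hkey (fun x => φ x ^ 2) (hφm.pow_const 2) (hφc.pow 2) ⟨_, hb2⟩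
    have h2 : Tendsto (fun j => ∫ ω, G j ω ^ 2 * φ (D j ω) ^ 2 ∂P - φ I ^ 2 * ∫ ω, G j ω ^ 2 ∂P)
        atTop (𝓝 0) := by
      refine squeeze_zero_norm (fun j => ?_) h1
      have hi1 : Integrable (fun ω => G j ω ^ 2 * φ (D j ω) ^ 2) P :=
        (hG j).integrable_sq.mul_bdd (c := c⁻¹ ^ 2)
          ((hφm.pow_const 2).comp (hDm j)).aestronglyMeasurable (ae_of_all _ fun ω => hb2 _)
      have hi2 : Integrable (fun ω => (1 + G j ω ^ 2) * |φ (D j ω) ^ 2 - φ I ^ 2|) P := by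
        refine (hHi j).mul_bdd (c := c⁻¹ ^ 2 + c⁻¹ ^ 2)
          ((((hφm.pow_const 2).comp (hDm j)).sub_const _).abs).aestronglyMeasurable
          (ae_of_all _ fun ω => ?_)
        rw [Real.norm_eq_abs, abs_abs]
        exact (abs_sub _ _).trans (add_le_add (hb2 _) (hb2 _))
      rw [← integral_const_mul, ← integral_sub hi1 ((hG j).integrable_sq.const_mul _)]
      refine norm_integral_le_of_norm_le hi2 (ae_of_all _ fun ω => ?_)
      have h3 : G j ω ^ 2 * φ (D j ω) ^ 2 - φ I ^ 2 * G j ω ^ 2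
          = G j ω ^ 2 * (φ (D j ω) ^ 2 - φ I ^ 2) := by ring
      rw [h3, norm_mul, Real.norm_eq_abs, Real.norm_eq_abs, abs_of_nonneg (sq_nonneg (G j ω))]
      gcongr
      linarith
    have h3 := h2.add (hG2.const_mul (φ I ^ 2))
    rw [zero_add, hφI, mul_comm] at h3
    refine h3.congr fun j => ?_
    ring
  -- first moment
  have hm1 : Tendsto (fun j => ∫ ω, G j ω * φ (D j ω) ∂P) atTop (𝓝 0) := by
    have h1 := hkey φ hφm hφc ⟨_, hφb⟩
    refine squeeze_zero_norm (fun j => ?_) h1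
    have hi1 : Integrable (fun ω => G j ω * φ (D j ω)) P :=
      (hGi j).mul_bdd (c := c⁻¹) (hφm.comp (hDm j)).aestronglyMeasurable
        (ae_of_all _ fun ω => hφb _)
    have hi2 : Integrable (fun ω => (1 + G j ω ^ 2) * |φ (D j ω) - φ I|) P := by
      refine (hHi j).mul_bdd (c := c⁻¹ + c⁻¹)
        (((hφm.comp (hDm j)).sub_const _).abs).aestronglyMeasurable (ae_of_all _ fun ω => ?_)
      rw [Real.norm_eq_abs, abs_abs]
      exact (abs_sub _ _).trans (add_le_add (hφb _) (hφb _))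
    -- As `G` is centered, subtracting φ(I) G changes nothing and leaves the small factor φ(D) -
    -- φ(I).
    have h4 : ∫ ω, G j ω * φ (D j ω) ∂P
        = ∫ ω, (G j ω * φ (D j ω) - φ I * G j ω) ∂P := by
      rw [integral_sub hi1 ((hGi j).const_mul _), integral_const_mul, hG0, mul_zero, sub_zero]
    rw [h4]
    refine norm_integral_le_of_norm_le hi2 (ae_of_all _ fun ω => ?_)
    have h3 : G j ω * φ (D j ω) - φ I * G j ω = G j ω * (φ (D j ω) - φ I) := by ring
    rw [h3, norm_mul, Real.norm_eq_abs, Real.norm_eq_abs]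
    gcongr
    nlinarith [sq_abs (G j ω), sq_nonneg (|G j ω| - 1), abs_nonneg (G j ω)]
  have hint : ∀ (j : ℕ) (f : Ω → ℝ), ∫ ω, f ω ∂P[|{ω | c ≤ |D j ω|}]
      = (P.real {ω | c ≤ |D j ω|})⁻¹ * ∫ ω, {ω | c ≤ |D j ω|}.indicator f ω ∂P := by
    intro j f
    rw [ProbabilityTheory.cond, integral_smul_measure, integral_indicator (hEm j),
      ENNReal.toReal_inv, smul_eq_mul]
    rfl
  have hmem : ∀ j, MemLp (fun ω => G j ω / D j ω) 2 P[|{ω | c ≤ |D j ω|}] := by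
    intro j
    -- Conditioning on a null event gives the zero measure, for which membership is trivial.
    by_cases h0 : P {ω | c ≤ |D j ω|} = 0
    · rw [cond_eq_zero_of_meas_eq_zero h0]
      simp
    refine MemLp.smul_measure ?_ (ENNReal.inv_ne_top.2 h0)
    have h1 : MemLp (fun ω => c⁻¹ * G j ω) 2 (P.restrict {ω | c ≤ |D j ω|}) :=
      ((hG j).restrict _).const_mul _
    refine h1.mono ((hG j).aestronglyMeasurable.restrict.aemeasurable.div
      (hDm j).aemeasurable).aestronglyMeasurable ?_
    filter_upwards [ae_restrict_mem (hEm j)] with ω hω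
    have hω' : c ≤ |D j ω| := hω
    rw [norm_div, norm_mul, div_eq_inv_mul, norm_inv, Real.norm_of_nonneg hc.le]
    gcongr
    exact hω'
  have hev : ∀ᶠ j in atTop, 0 < P.real {ω | c ≤ |D j ω|} :=
    hprob.eventually_const_lt zero_lt_one
  have hevp : ∀ᶠ j in atTop, IsProbabilityMeasure P[|{ω | c ≤ |D j ω|}] := by
    filter_upwards [hev] with j hj
    refine cond_isProbabilityMeasure fun h0 => ?_
    simp [measureReal_def, h0] at hj
  refine ⟨hprob, hevp, hmem, ?_⟩
  -- The conditional variance is E[G²φ²]/P(E) - (E[Gφ]/P(E))², where E is the conditioning event;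
  -- the second term vanishes in the limit.
  have hlim := ((hprob.inv₀ one_ne_zero).mul hm2).sub (((hprob.inv₀ one_ne_zero).mul hm1).pow 2)
  have hval : (1 : ℝ)⁻¹ * (I * I⁻¹ ^ 2) - (1⁻¹ * 0) ^ 2 = I⁻¹ := by field_simp; ring
  rw [hval] at hlim
  refine hlim.congr' ?_
  filter_upwards [hevp] with j hj
  have e1 : ∫ ω, {ω | c ≤ |D j ω|}.indicator (fun ω => G j ω / D j ω) ω ∂P
      = ∫ ω, G j ω * φ (D j ω) ∂P := by
    refine integral_congr_ae (ae_of_all _ fun ω => ?_)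
    by_cases hω : c ≤ |D j ω| <;> simp [φ, Set.indicator, hω, div_eq_mul_inv]
  have e2 : ∫ ω, {ω | c ≤ |D j ω|}.indicator ((fun ω => G j ω / D j ω) ^ 2) ω ∂P
      = ∫ ω, G j ω ^ 2 * φ (D j ω) ^ 2 ∂P := by
    refine integral_congr_ae (ae_of_all _ fun ω => ?_)
    by_cases hω : c ≤ |D j ω| <;> simp [φ, Set.indicator, hω, div_eq_mul_inv, mul_pow]
  rw [variance_eq_sub (hmem j), hint, hint, e1, e2]

end Ratio

/-! ### Moment identities in the partially linear model. -/

namespace QueueExperiment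

variable {Ω : Type*} [MeasurableSpace Ω] {P : Measure Ω} {d K : ℕ} [IsProbabilityMeasure P]
  (E : QueueExperiment P d K) {p : Fin K → ℝ} {β ψ : ℝ} {g : EuclideanSpace ℝ (Fin d) → ℝ}

theorem measurable_outcomeReg (n : ℕ) : Measurable (E.outcomeReg n) :=
  (StronglyMeasurable.integral_condDistrib (X := E.X 0) (Y := E.Y n 0) (μ := P)
    (f := fun z => z.2) measurable_snd.stronglyMeasurable).measurable

theorem measurable_errVar (g : EuclideanSpace ℝ (Fin d) → ℝ) : Measurable (E.errVar g) :=
  (StronglyMeasurable.integral_condDistrib (X := E.X 0) (Y := E.err g 0) (μ := P)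
    (f := fun z => z.2 ^ 2) (measurable_snd.pow_const 2).stronglyMeasurable).measurable

variable {E}

theorem IsPLIV.integrable_err (hm : E.IsPLIV ψ g) : Integrable (E.err g 0) P :=
  hm.memLp_err.integrable one_le_two

/-- The error is uncorrelated with functions of covariates and queue. -/
theorem IsPLIV.integral_mul_err (hm : E.IsPLIV ψ g)
    {φ : EuclideanSpace ℝ (Fin d) × Fin K → ℝ} (hφ : Measurable φ)
    (hint : Integrable (fun ω => φ (E.X 0 ω, E.Q 0 ω) * E.err g 0 ω) P) :
    ∫ ω, φ (E.X 0 ω, E.Q 0 ω) * E.err g 0 ω ∂P = 0 := by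
  have h := condExp_mul_of_stronglyMeasurable_left (μ := P) (m := E.covQueueSpace)
    (f := fun ω => φ (E.X 0 ω, E.Q 0 ω)) (g := E.err g 0)
    (hφ.comp (comap_measurable _)).stronglyMeasurable hint hm.integrable_err
  rw [← integral_condExp E.measurable_covQueue.comap_le]
  refine (integral_congr_ae (h.trans ?_)).trans (integral_zero Ω ℝ)
  filter_upwards [hm.condExp_err] with ω hω
  simp only [Pi.mul_apply]
  rw [hω]
  simp

/-- The recentered instrument is uncorrelated with functions of the covariates. -/
theorem integral_mul_instr (n : ℕ) {φ : EuclideanSpace ℝ (Fin d) → ℝ} (hφ : Measurable φ)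
    (hint : Integrable (fun ω => φ (E.X 0 ω) * E.instr n (E.X 0 ω) (E.Q 0 ω)) P) :
    ∫ ω, φ (E.X 0 ω) * E.instr n (E.X 0 ω) (E.Q 0 ω) ∂P = 0 := by
  have hi : Integrable (fun ω => E.instr n (E.X 0 ω) (E.Q 0 ω)) P :=
    Integrable.of_bound (C := 1)
      ((measurable_instr n).comp E.measurable_covQueue).aestronglyMeasurable
      (ae_of_all _ fun ω => E.abs_instr_le_one n _ _)
  have h := condExp_mul_of_stronglyMeasurable_left (μ := P)
    (m := MeasurableSpace.comap (E.X 0) inferInstance)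
    (f := fun ω => φ (E.X 0 ω)) (g := fun ω => E.instr n (E.X 0 ω) (E.Q 0 ω))
    (hφ.comp (comap_measurable _)).stronglyMeasurable hint hi
  rw [← integral_condExp (E.measurable_X 0).comap_le]
  refine (integral_congr_ae (h.trans ?_)).trans (integral_zero Ω ℝ)
  filter_upwards [E.condExp_instr n] with ω hω
  simp only [Pi.mul_apply]
  rw [hω]
  simp

theorem IsPLIV.errVar_ae (hm : E.IsPLIV ψ g) :
    P[fun ω => E.err g 0 ω ^ 2 | MeasurableSpace.comap (E.X 0) inferInstance]
      =ᵐ[P] fun ω => E.errVar g (E.X 0 ω) :=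
  condExp_ae_eq_integral_condDistrib (E.measurable_X 0)
    (E.measurable_err hm.measurable_g 0).aemeasurable
    (f := fun u : ℝ => u ^ 2) (measurable_id.pow_const 2).stronglyMeasurable
    hm.memLp_err.integrable_sq

theorem IsPLIV.integrable_errVar (hm : E.IsPLIV ψ g) :
    Integrable (fun ω => E.errVar g (E.X 0 ω)) P :=
  integrable_condExp.congr hm.errVar_ae

theorem IsPLIV.integral_mul_err_sq_covariates (hm : E.IsPLIV ψ g)
    {φ : EuclideanSpace ℝ (Fin d) → ℝ} (hφ : Measurable φ) {c : ℝ} (hc : ∀ x, |φ x| ≤ c) :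
    ∫ ω, φ (E.X 0 ω) * E.err g 0 ω ^ 2 ∂P = ∫ ω, φ (E.X 0 ω) * E.errVar g (E.X 0 ω) ∂P := by
  have hint : Integrable (fun ω => φ (E.X 0 ω) * E.err g 0 ω ^ 2) P :=
    hm.memLp_err.integrable_sq.bdd_mul (c := c) (hφ.comp (E.measurable_X 0)).aestronglyMeasurable
      (ae_of_all _ fun ω => hc _)
  have h := condExp_mul_of_stronglyMeasurable_left (μ := P)
    (m := MeasurableSpace.comap (E.X 0) inferInstance)
    (f := fun ω => φ (E.X 0 ω)) (g := fun ω => E.err g 0 ω ^ 2)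
    (hφ.comp (comap_measurable _)).stronglyMeasurable hint hm.memLp_err.integrable_sq
  rw [← integral_condExp (E.measurable_X 0).comap_le]
  refine integral_congr_ae (h.trans ?_)
  filter_upwards [hm.errVar_ae] with ω hω
  simp only [Pi.mul_apply]
  rw [hω]

/-- The conditional variance of the error does not depend on the queue. -/
theorem IsPLIV.integral_mul_err_sq (hm : E.IsPLIV ψ g)
    {φ : EuclideanSpace ℝ (Fin d) × Fin K → ℝ} (hφ : Measurable φ) {c : ℝ}
    (hc : ∀ z, |φ z| ≤ c) :
    ∫ ω, φ (E.X 0 ω, E.Q 0 ω) * E.err g 0 ω ^ 2 ∂P =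
      ∫ ω, φ (E.X 0 ω, E.Q 0 ω) * E.errVar g (E.X 0 ω) ∂P := by
  have hφk : ∀ k, Measurable fun x => φ (x, k) := fun k => hφ.comp measurable_prodMk_right
  have hφm := (hφ.comp E.measurable_covQueue).aestronglyMeasurable (μ := P)
  have h1 := E.integral_queue (G := fun k z => φ (z.2.1, k) * (z.2.2.1 - g z.2.1) ^ 2)
    (fun k => ((hφk k).comp measurable_snd.fst).mul
      ((measurable_snd.snd.fst.sub (hm.measurable_g.comp measurable_snd.fst)).pow_const 2))
    (hm.memLp_err.integrable_sq.bdd_mul (c := c) hφm (ae_of_all _ fun ω => hc _))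
  have h2 := E.integral_queue (G := fun k z => φ (z.2.1, k) * E.errVar g z.2.1)
    (fun k => ((hφk k).comp measurable_snd.fst).mul
      ((E.measurable_errVar g).comp measurable_snd.fst))
    (hm.integrable_errVar.bdd_mul (c := c) hφm (ae_of_all _ fun ω => hc _))
  refine h1.trans (Eq.trans ?_ h2.symm)
  refine Finset.sum_congr rfl fun k _ => ?_
  -- After averaging over the queue, the factor θ_k(X) is a function of the covariates and can be
  -- absorbed into the test function. This is where the queue being drawn independently of Y⁰ given
  -- X is used.
  have h3 := hm.integral_mul_err_sq_covariates (φ := fun x => φ (x, k) * E.θ x k) (c := c)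
    ((hφk k).mul ((measurable_pi_apply k).comp E.measurable_θ)) (fun x => by
      rw [abs_mul]
      calc |φ (x, k)| * |E.θ x k| ≤ |φ (x, k)| * 1 := by
            gcongr; exact E.abs_θ_le_one x k
        _ ≤ c := by rw [mul_one]; exact hc _)
  refine Eq.trans (integral_congr_ae (ae_of_all _ fun ω => ?_))
    (h3.trans (integral_congr_ae (ae_of_all _ fun ω => ?_)))
  · simp only [prim, err]; ring
  · simp only [prim]; ring

/-- Averaging the limiting treatment status over the arrival time. -/
theorem integral_mul_limitZ (hA : E.IndepArrivals) {u : Fin K → ℝ}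
    (hu : ∀ k, E.arrCdf (u k) = queueAlpha β p k)
    {φ : EuclideanSpace ℝ (Fin d) × Fin K → ℝ} (hφ : Measurable φ) {c : ℝ}
    (hc : ∀ z, |φ z| ≤ c) :
    ∫ ω, φ (E.X 0 ω, E.Q 0 ω) * E.limitZ u 0 ω ∂P =
      ∫ ω, φ (E.X 0 ω, E.Q 0 ω) * queueAlpha β p (E.Q 0 ω) ∂P := by
  have hdec : ∀ (f : Fin K → ℝ) (ω : Ω), φ (E.X 0 ω, E.Q 0 ω) * f (E.Q 0 ω)
      = ∑ k, {z : EuclideanSpace ℝ (Fin d) × Fin K | z.2 = k}.indicator φ (E.X 0 ω, E.Q 0 ω)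
        * f k := by
    intro f ω
    rw [Finset.sum_eq_single (E.Q 0 ω)]
    · simp [Set.indicator]
    · intro k _ hk
      simp [Set.indicator, hk.symm]
    · simp
  have hψ : ∀ k, Measurable ({z : EuclideanSpace ℝ (Fin d) × Fin K | z.2 = k}.indicator φ) :=
    fun k => hφ.indicator (measurable_snd (measurableSet_singleton k))
  have hψi : ∀ k, Integrable (fun ω => {z : EuclideanSpace ℝ (Fin d) × Fin K |
      z.2 = k}.indicator φ (E.X 0 ω, E.Q 0 ω)) P := fun k => by
    refine Integrable.of_bound (C := c)
      ((hψ k).comp E.measurable_covQueue).aestronglyMeasurable (ae_of_all _ fun ω => ?_)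
    exact (norm_indicator_le_norm_self _ _).trans (hc _)
  have hIic : ∀ k, Measurable ((Set.Iic (u k)).indicator fun _ : ℝ => (1 : ℝ)) :=
    fun k => measurable_const.indicator measurableSet_Iic
  have h1 : ∀ ω, φ (E.X 0 ω, E.Q 0 ω) * E.limitZ u 0 ω
      = ∑ k, {z : EuclideanSpace ℝ (Fin d) × Fin K | z.2 = k}.indicator φ (E.X 0 ω, E.Q 0 ω)
        * (Set.Iic (u k)).indicator (fun _ => (1 : ℝ)) (E.A 0 ω) :=
    fun ω => hdec (fun k => (Set.Iic (u k)).indicator (fun _ => (1 : ℝ)) (E.A 0 ω)) ω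
  simp_rw [h1, hdec (queueAlpha β p)]
  rw [integral_finsetSum, integral_finsetSum]
  · refine Finset.sum_congr rfl fun k _ => ?_
    -- In queue k the limiting status is the indicator of A ≤ u_k, which is independent of (X, Q)
    -- and has mean F(u_k) = α_k.
    have hind : IndepFun (fun ω => {z : EuclideanSpace ℝ (Fin d) × Fin K |
        z.2 = k}.indicator φ (E.X 0 ω, E.Q 0 ω))
        (fun ω => (Set.Iic (u k)).indicator (fun _ => (1 : ℝ)) (E.A 0 ω)) P :=
      ((E.indepFun_arrival hA).comp (hIic k) (hψ k)).symm
    rw [hind.integral_fun_mul_eq_mul_integral (hψi k).aestronglyMeasurable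
      ((hIic k).comp (E.measurable_A 0)).aestronglyMeasurable, integral_mul_const]
    congr 1
    have hs : MeasurableSet {ω | E.A 0 ω ≤ u k} :=
      measurableSet_le (E.measurable_A 0) measurable_const
    rw [← hu k, arrCdf, ← integral_indicator_one hs]
    rfl
  · exact fun k _ => (hψi k).mul_const _
  · intro k _
    refine (hψi k).mul_bdd (c := 1) ((hIic k).comp (E.measurable_A 0)).aestronglyMeasurable
      (ae_of_all _ fun ω => ?_)
    exact (norm_indicator_le_norm_self _ _).trans (by simp)

/-- The outcome regression in the partially linear model. -/
theorem IsPLIV.outcomeReg_ae (hm : E.IsPLIV ψ g) {n : ℕ} (hn : 0 < n) :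
    ∀ᵐ ω ∂P, E.outcomeReg n (E.X 0 ω) = ψ * E.propensity n (E.X 0 ω) + g (E.X 0 ω) := by
  have hle := (E.measurable_X 0).comap_le
  have hiZ : Integrable (ψ • E.Z n 0) P := (E.integrable_Z n 0).smul ψ
  have hig : Integrable (fun ω => g (E.X 0 ω)) P := hm.integrable_g
  -- The outcome equation covers only units of the experiment, so unit 0 requires n > 0.
  have hY : E.Y n 0 =ᵐ[P] ψ • E.Z n 0 + (fun ω => g (E.X 0 ω)) + E.err g 0 := by
    filter_upwards [hm.outcome_eq n 0 hn] with ω hω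
    simpa using hω
  have hiY : Integrable (E.Y n 0) P := ((hiZ.add hig).add hm.integrable_err).congr hY.symm
  have h0 : P[E.err g 0 | MeasurableSpace.comap (E.X 0) inferInstance] =ᵐ[P] 0 := by
    refine (condExp_condExp_of_le (f := E.err g 0) (μ := P) E.comap_X_le_covQueue
      E.measurable_covQueue.comap_le).symm.trans ((condExp_congr_ae hm.condExp_err).trans ?_)
    rw [condExp_zero]
  filter_upwards [condExp_ae_eq_integral_condDistrib' (μ := P) (E.measurable_X 0) hiY,
    condExp_congr_ae (m := MeasurableSpace.comap (E.X 0) inferInstance) hY,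
    condExp_add (hiZ.add hig) hm.integrable_err (MeasurableSpace.comap (E.X 0) inferInstance),
    condExp_add hiZ hig (MeasurableSpace.comap (E.X 0) inferInstance),
    condExp_smul (μ := P) ψ (E.Z n 0) (MeasurableSpace.comap (E.X 0) inferInstance),
    E.propensity_ae n, h0] with ω h1 h2 h3 h4 h5 h6 h7
  have h8 : P[fun ω => g (E.X 0 ω) | MeasurableSpace.comap (E.X 0) inferInstance] ω
      = g (E.X 0 ω) := by
    exact congrFun (condExp_of_stronglyMeasurable hle (f := fun ω => g (E.X 0 ω))
      (hm.measurable_g.comp (comap_measurable _)).stronglyMeasurable hig) ω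
  have h1' : E.outcomeReg n (E.X 0 ω)
      = P[E.Y n 0 | MeasurableSpace.comap (E.X 0) inferInstance] ω := h1.symm
  rw [h1', h2, h3, Pi.add_apply, h4, Pi.add_apply, h5, h7, h8, Pi.smul_apply, ← h6]
  simp

end QueueExperiment

/-! ### Weights and scores along consistent nuisance functions. -/

namespace QueueExperiment

variable {Ω : Type*} [MeasurableSpace Ω] {P : Measure Ω} {d K : ℕ} [IsProbabilityMeasure P]

/-- A sequence of nuisance functions along a sequence `ν` of sample sizes that is consistent and
leads to bounded estimated instruments. -/
structure IsConsistent (E : QueueExperiment P d K) (g : EuclideanSpace ℝ (Fin d) → ℝ) (C : ℝ)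
    (ν : ℕ → ℕ) (s m : ℕ → EuclideanSpace ℝ (Fin d) → ℝ) : Prop where
  tendsto_index : Tendsto ν atTop atTop
  index_pos : ∀ j, 0 < ν j
  measurable_s : ∀ j, Measurable (s j)
  measurable_m : ∀ j, Measurable (m j)
  tendsto_s : ∀ᵐ ω ∂P, Tendsto (fun j => s j (E.X 0 ω)) atTop (𝓝 (E.errVar g (E.X 0 ω)))
  memLp_m : ∀ j, MemLp (fun ω => E.outcomeReg (ν j) (E.X 0 ω) - m j (E.X 0 ω)) 2 P
  tendsto_m : Tendsto (fun j => ∫ ω, (E.outcomeReg (ν j) (E.X 0 ω) - m j (E.X 0 ω)) ^ 2 ∂P)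
    atTop (𝓝 0)
  bound : ∀ j, ∀ᵐ ω ∂P, |E.instr (ν j) (E.X 0 ω) (E.Q 0 ω) / s j (E.X 0 ω)| ≤ C

/-- The estimated instrument, clipped to `[-C, C]`. -/
def weight (E : QueueExperiment P d K) (C : ℝ) (n : ℕ) (s : EuclideanSpace ℝ (Fin d) → ℝ)
    (z : EuclideanSpace ℝ (Fin d) × Fin K) : ℝ :=
  max (-C) (min C (E.instr n z.1 z.2 / s z.1))

/-- The contribution of a unit to the numerator of the centered estimator. -/
def score (E : QueueExperiment P d K) (g : EuclideanSpace ℝ (Fin d) → ℝ) (C : ℝ) (n : ℕ)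
    (s m : EuclideanSpace ℝ (Fin d) → ℝ)
    (w : ℝ × EuclideanSpace ℝ (Fin d) × ℝ × ℝ × Fin K) : ℝ :=
  E.weight C n s (w.2.1, w.2.2.2.2) * ((w.2.2.1 - g w.2.1) + (E.outcomeReg n w.2.1 - m w.2.1))

/-- The denominator of the estimator with clipped instruments. -/
def clippedDen (E : QueueExperiment P d K) (C : ℝ) (n : ℕ) (s : EuclideanSpace ℝ (Fin d) → ℝ)
    (ω : Ω) : ℝ :=
  (1 / (n : ℝ)) * ∑ i ∈ Finset.range n,
    E.weight C n s (E.X i ω, E.Q i ω) * (E.Z n i ω - E.propensity n (E.X i ω))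

variable {E : QueueExperiment P d K} {p : Fin K → ℝ} {β ψ : ℝ}
  {g : EuclideanSpace ℝ (Fin d) → ℝ} {C : ℝ} {ν : ℕ → ℕ}
  {s m : ℕ → EuclideanSpace ℝ (Fin d) → ℝ}

theorem measurable_weight {n : ℕ} {s : EuclideanSpace ℝ (Fin d) → ℝ} (hs : Measurable s) :
    Measurable (E.weight C n s) :=
  measurable_const.max (measurable_const.min
    ((measurable_instr n).div (hs.comp measurable_fst)))

theorem abs_weight_le (hC : 0 ≤ C) {n : ℕ} {s : EuclideanSpace ℝ (Fin d) → ℝ}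
    (z : EuclideanSpace ℝ (Fin d) × Fin K) : |E.weight C n s z| ≤ C := by
  rw [abs_le]
  exact ⟨le_max_left _ _, max_le (by linarith) (min_le_left _ _)⟩

theorem weight_eq_of_abs_le {n : ℕ} {s : EuclideanSpace ℝ (Fin d) → ℝ}
    {z : EuclideanSpace ℝ (Fin d) × Fin K} (h : |E.instr n z.1 z.2 / s z.1| ≤ C) :
    E.weight C n s z = E.instr n z.1 z.2 / s z.1 := by
  rw [abs_le] at h
  rw [weight, min_eq_right h.2, max_eq_right h.1]

theorem measurable_score (hg : Measurable g) {n : ℕ} {s m : EuclideanSpace ℝ (Fin d) → ℝ}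
    (hs : Measurable s) (hm : Measurable m) : Measurable (E.score g C n s m) :=
  ((measurable_weight hs).comp (measurable_snd.fst.prodMk measurable_snd.snd.snd.snd)).mul
    ((measurable_snd.snd.fst.sub (hg.comp measurable_snd.fst)).add
      (((E.measurable_outcomeReg n).comp measurable_snd.fst).sub (hm.comp measurable_snd.fst)))

theorem measurable_clippedDen {n : ℕ} {s : EuclideanSpace ℝ (Fin d) → ℝ} (hs : Measurable s) :
    Measurable (E.clippedDen C n s) :=
  (Finset.measurable_fun_sum _ fun i _ => ((measurable_weight hs).comp
    ((E.measurable_X i).prodMk (E.measurable_Q i))).mul ((E.measurable_Z n i).sub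
      ((measurable_propensity n).comp (E.measurable_X i)))).const_mul _

namespace IsConsistent

theorem C_nonneg (h : E.IsConsistent g C ν s m) : 0 ≤ C := by
  obtain ⟨ω, hω⟩ := (h.bound 0).exists
  exact (abs_nonneg _).trans hω

theorem abs_weight_le (h : E.IsConsistent g C ν s m) (j : ℕ)
    (z : EuclideanSpace ℝ (Fin d) × Fin K) : |E.weight C (ν j) (s j) z| ≤ C :=
  QueueExperiment.abs_weight_le h.C_nonneg z

theorem weight_sq_le (h : E.IsConsistent g C ν s m) (j : ℕ)
    (z : EuclideanSpace ℝ (Fin d) × Fin K) : E.weight C (ν j) (s j) z ^ 2 ≤ C ^ 2 := by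
  rw [← sq_abs]
  exact pow_le_pow_left₀ (abs_nonneg _) (h.abs_weight_le j z) 2

/-- The almost sure bound for unit 0 transfers to every unit by identical distribution. Clipping is
thus almost surely inactive, yet it makes the weight bounded everywhere. -/
theorem weight_ae (h : E.IsConsistent g C ν s m) (j i : ℕ) :
    ∀ᵐ ω ∂P, E.weight C (ν j) (s j) (E.X i ω, E.Q i ω)
      = E.instr (ν j) (E.X i ω) (E.Q i ω) / s j (E.X i ω) := by
  have hmeas : MeasurableSet {w : ℝ × EuclideanSpace ℝ (Fin d) × ℝ × ℝ × Fin K |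
      |E.instr (ν j) w.2.1 w.2.2.2.2 / s j w.2.1| ≤ C} :=
    measurableSet_le ((((measurable_instr (E := E) (ν j)).comp
      (measurable_snd.fst.prodMk measurable_snd.snd.snd.snd)).div
        ((h.measurable_s j).comp measurable_snd.fst)).abs) measurable_const
  have := E.ae_unit (p := fun w => |E.instr (ν j) w.2.1 w.2.2.2.2 / s j w.2.1| ≤ C) hmeas
    (h.bound j) i
  filter_upwards [this] with ω hω
  exact weight_eq_of_abs_le hω

theorem measurable_weight_unit (h : E.IsConsistent g C ν s m) (j : ℕ) :
    Measurable fun ω => E.weight C (ν j) (s j) (E.X 0 ω, E.Q 0 ω) :=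
  (measurable_weight (h.measurable_s j)).comp E.measurable_covQueue

theorem tendsto_weight_ae (h : E.IsConsistent g C ν s m) (hp : E.FixedQueue p)
    (hA : E.IndepArrivals) (hb : E.StableBudget β)
    (hσ : ∀ᵐ ω ∂P, 0 < E.errVar g (E.X 0 ω)) :
    ∀ᵐ ω ∂P, Tendsto (fun j => E.weight C (ν j) (s j) (E.X 0 ω, E.Q 0 ω)) atTop
      (𝓝 ((queueAlpha β p (E.Q 0 ω) - E.asympPropensity (E.X 0 ω)) / E.errVar g (E.X 0 ω))) := by
  filter_upwards [ae_all_iff.2 fun j => h.weight_ae j 0, tendsto_instr_ae hp hA hb, h.tendsto_s, hσ]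
    with ω h1 h2 h3 h4
  simp_rw [h1]
  exact (h2.comp h.tendsto_index).div h3 h4.ne'

/-- The information at the limiting instrument is finite. -/
theorem integrable_limitInfo (h : E.IsConsistent g C ν s m) (hp : E.FixedQueue p)
    (hA : E.IndepArrivals) (hb : E.StableBudget β)
    (hσ : ∀ᵐ ω ∂P, 0 < E.errVar g (E.X 0 ω)) :
    Integrable (fun ω => (queueAlpha β p (E.Q 0 ω) - E.asympPropensity (E.X 0 ω)) ^ 2
      / E.errVar g (E.X 0 ω)) P := by
  have h1 := h.tendsto_weight_ae hp hA hb hσ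
  have h2 := tendsto_instr_ae hp hA hb
  have hm1 := aestronglyMeasurable_of_tendsto_ae atTop
    (fun j => (h.measurable_weight_unit j).aestronglyMeasurable) h1
  have hm2 := aestronglyMeasurable_of_tendsto_ae atTop (fun n =>
    ((measurable_instr n).comp E.measurable_covQueue).aestronglyMeasurable) h2
  -- The integrand is (r/σ)·r, a product of almost sure limits of sequences bounded by C and by 1.
  -- No lower bound on σ is needed.
  have hint := Integrable.of_bound (C := C * 1) (hm1.mul hm2) (by
    filter_upwards [h1, h2] with ω h1ω h2ω
    rw [Pi.mul_apply, norm_mul]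
    refine mul_le_mul ?_ ?_ (norm_nonneg _) h.C_nonneg
    · exact le_of_tendsto h1ω.norm (Eventually.of_forall fun j => h.abs_weight_le j _)
    · exact le_of_tendsto h2ω.norm (Eventually.of_forall fun j => E.abs_instr_le_one _ _ _))
  refine hint.congr (ae_of_all _ fun ω => ?_)
  simp only [Pi.mul_apply]
  ring

/-- Dominated convergence with dominating function C²σ(X); the limit is (r/σ)² σ = r²/σ. -/
theorem tendsto_integral_weight_sq (h : E.IsConsistent g C ν s m) (hp : E.FixedQueue p)
    (hA : E.IndepArrivals) (hb : E.StableBudget β) (hm : E.IsPLIV ψ g)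
    (hσ : ∀ᵐ ω ∂P, 0 < E.errVar g (E.X 0 ω)) :
    Tendsto (fun j => ∫ ω, E.weight C (ν j) (s j) (E.X 0 ω, E.Q 0 ω) ^ 2
      * E.errVar g (E.X 0 ω) ∂P) atTop (𝓝 (E.limitInfo β p g)) := by
  refine tendsto_integral_of_dominated_convergence (fun ω => C ^ 2 * E.errVar g (E.X 0 ω))
    (fun j => ?_) (hm.integrable_errVar.const_mul _) (fun j => ?_) ?_
  · exact (((h.measurable_weight_unit j).pow_const 2).mul
      ((E.measurable_errVar g).comp (E.measurable_X 0))).aestronglyMeasurable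
  · filter_upwards [hσ] with ω hω
    rw [Real.norm_eq_abs, abs_mul, abs_of_pos hω, abs_of_nonneg (sq_nonneg _)]
    exact mul_le_mul_of_nonneg_right (h.weight_sq_le j _) hω.le
  · filter_upwards [h.tendsto_weight_ae hp hA hb hσ, hσ] with ω hω hpos
    have h1 := (hω.pow 2).mul_const (E.errVar g (E.X 0 ω))
    convert! h1 using 2
    field_simp

/-- Here the limiting integrand is (r/σ)·r, so the mean of the denominator has the same limit as the
variance of the numerator. This coincidence yields the efficiency bound. -/
theorem tendsto_integral_weight_mul (h : E.IsConsistent g C ν s m) (hp : E.FixedQueue p)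
    (hA : E.IndepArrivals) (hb : E.StableBudget β)
    (hσ : ∀ᵐ ω ∂P, 0 < E.errVar g (E.X 0 ω)) :
    Tendsto (fun j => ∫ ω, E.weight C (ν j) (s j) (E.X 0 ω, E.Q 0 ω)
      * (queueAlpha β p (E.Q 0 ω) - E.propensity (ν j) (E.X 0 ω)) ∂P) atTop
      (𝓝 (E.limitInfo β p g)) := by
  refine tendsto_integral_of_dominated_convergence (fun _ => C * 1)
    (fun j => ?_) (integrable_const _) (fun j => ae_of_all _ fun ω => ?_) ?_
  · exact ((h.measurable_weight_unit j).mul (((measurable_of_finite (queueAlpha β p)).comp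
      (E.measurable_Q 0)).sub ((measurable_propensity (E := E) (ν j)).comp
        (E.measurable_X 0)))).aestronglyMeasurable
  · rw [norm_mul]
    refine mul_le_mul (h.abs_weight_le j _) ?_ (norm_nonneg _) h.C_nonneg
    have h1 := E.propensity_mem (ν j) (E.X 0 ω)
    have h2 := queueAlpha_mem (β := β) (p := p) (E.Q 0 ω)
    rw [Real.norm_eq_abs, abs_le]
    constructor <;> linarith [h1.1, h1.2, h2.1, h2.2]
  · filter_upwards [h.tendsto_weight_ae hp hA hb hσ, asympPropensity_ae hp hA hb] with ω h1 h2
    have h3 := h1.mul ((h2.comp h.tendsto_index).const_sub (queueAlpha β p (E.Q 0 ω)))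
    convert! h3 using 2
    ring

theorem memLp_score (h : E.IsConsistent g C ν s m) (hm : E.IsPLIV ψ g) (j : ℕ) :
    MemLp (fun ω => E.score g C (ν j) (s j) (m j) (E.unit 0 ω)) 2 P := by
  refine ((hm.memLp_err.add (h.memLp_m j)).const_mul C).mono
    ((measurable_score hm.measurable_g (h.measurable_s j) (h.measurable_m j)).comp
      (E.measurable_unit 0)).aestronglyMeasurable (ae_of_all _ fun ω => ?_)
  rw [norm_mul, Real.norm_of_nonneg h.C_nonneg, score, norm_mul]
  exact mul_le_mul_of_nonneg_right (h.abs_weight_le j _) (norm_nonneg _)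

theorem integrable_weight_mul (h : E.IsConsistent g C ν s m) (j : ℕ) {f : Ω → ℝ}
    (hf : Integrable f P) :
    Integrable (fun ω => E.weight C (ν j) (s j) (E.X 0 ω, E.Q 0 ω) * f ω) P :=
  hf.bdd_mul (c := C) (h.measurable_weight_unit j).aestronglyMeasurable
    (ae_of_all _ fun _ => h.abs_weight_le j _)

theorem integrable_weight_sq_mul (h : E.IsConsistent g C ν s m) (j : ℕ) {f : Ω → ℝ}
    (hf : Integrable f P) :
    Integrable (fun ω => E.weight C (ν j) (s j) (E.X 0 ω, E.Q 0 ω) ^ 2 * f ω) P :=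
  hf.bdd_mul (c := C ^ 2) ((h.measurable_weight_unit j).pow_const 2).aestronglyMeasurable
    (ae_of_all _ fun _ => by
      rw [Real.norm_of_nonneg (sq_nonneg _)]
      exact h.weight_sq_le j _)

/-- The clipped instrument is uncorrelated with functions of the covariates. -/
theorem integral_weight_mul (h : E.IsConsistent g C ν s m) (j : ℕ)
    {φ : EuclideanSpace ℝ (Fin d) → ℝ} (hφ : Measurable φ)
    (hint : Integrable (fun ω => φ (E.X 0 ω)) P) :
    ∫ ω, E.weight C (ν j) (s j) (E.X 0 ω, E.Q 0 ω) * φ (E.X 0 ω) ∂P = 0 := by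
  have heq : (fun ω => E.weight C (ν j) (s j) (E.X 0 ω, E.Q 0 ω) * φ (E.X 0 ω)) =ᵐ[P]
      fun ω => (φ (E.X 0 ω) / s j (E.X 0 ω)) * E.instr (ν j) (E.X 0 ω) (E.Q 0 ω) := by
    filter_upwards [h.weight_ae j 0] with ω hω
    rw [hω]; ring
  rw [integral_congr_ae heq]
  exact integral_mul_instr (ν j) (φ := fun x => φ x / s j x) (hφ.div (h.measurable_s j))
    ((h.integrable_weight_mul j hint).congr heq)

/-- The error part vanishes because E(U | X, Q) = 0; the nuisance part is the weight times a
function of X, and vanishes because E(r_n | X) = 0. -/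
theorem integral_score (h : E.IsConsistent g C ν s m) (hm : E.IsPLIV ψ g) (j : ℕ) :
    ∫ ω, E.score g C (ν j) (s j) (m j) (E.unit 0 ω) ∂P = 0 := by
  have heq : ∀ ω, E.score g C (ν j) (s j) (m j) (E.unit 0 ω)
      = E.weight C (ν j) (s j) (E.X 0 ω, E.Q 0 ω) * E.err g 0 ω
      + E.weight C (ν j) (s j) (E.X 0 ω, E.Q 0 ω)
        * (E.outcomeReg (ν j) (E.X 0 ω) - m j (E.X 0 ω)) := fun ω => mul_add _ _ _
  have h1 := h.integrable_weight_mul j hm.integrable_err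
  have h2i := (h.memLp_m j).integrable one_le_two
  have h2 := h.integrable_weight_mul j h2i
  simp_rw [heq]
  rw [integral_add h1 h2, hm.integral_mul_err (measurable_weight (h.measurable_s j)) h1,
    h.integral_weight_mul j (φ := fun x => E.outcomeReg (ν j) x - m j x)
      ((E.measurable_outcomeReg _).sub (h.measurable_m j)) h2i, add_zero]

/-- In the expanded square the cross term has mean zero given (X, Q), U² may be replaced by σ(X),
and the squared nuisance error is at most C² times its vanishing mean square. -/
theorem tendsto_integral_score_sq (h : E.IsConsistent g C ν s m) (hp : E.FixedQueue p)
    (hA : E.IndepArrivals) (hb : E.StableBudget β) (hm : E.IsPLIV ψ g)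
    (hσ : ∀ᵐ ω ∂P, 0 < E.errVar g (E.X 0 ω)) :
    Tendsto (fun j => ∫ ω, E.score g C (ν j) (s j) (m j) (E.unit 0 ω) ^ 2 ∂P) atTop
      (𝓝 (E.limitInfo β p g)) := by
  set w : ℕ → Ω → ℝ := fun j ω => E.weight C (ν j) (s j) (E.X 0 ω, E.Q 0 ω) with hw
  set r : ℕ → Ω → ℝ := fun j ω => E.outcomeReg (ν j) (E.X 0 ω) - m j (E.X 0 ω) with hr
  have hsum : ∀ j, ∫ ω, E.score g C (ν j) (s j) (m j) (E.unit 0 ω) ^ 2 ∂P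
      = ∫ ω, w j ω ^ 2 * E.errVar g (E.X 0 ω) ∂P + ∫ ω, w j ω ^ 2 * r j ω ^ 2 ∂P := by
    intro j
    have heq : ∀ ω, E.score g C (ν j) (s j) (m j) (E.unit 0 ω) ^ 2
        = w j ω ^ 2 * E.err g 0 ω ^ 2 + 2 * (w j ω ^ 2 * (r j ω * E.err g 0 ω))
          + w j ω ^ 2 * r j ω ^ 2 := by
      intro ω
      change (w j ω * (E.err g 0 ω + r j ω)) ^ 2 = _
      ring
    have h1 : Integrable (fun ω => w j ω ^ 2 * E.err g 0 ω ^ 2) P :=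
      h.integrable_weight_sq_mul j hm.memLp_err.integrable_sq
    have h2 : Integrable (fun ω => w j ω ^ 2 * (r j ω * E.err g 0 ω)) P :=
      h.integrable_weight_sq_mul j ((h.memLp_m j).integrable_mul hm.memLp_err)
    have h3 : Integrable (fun ω => w j ω ^ 2 * r j ω ^ 2) P :=
      h.integrable_weight_sq_mul j (h.memLp_m j).integrable_sq
    have hwm := measurable_weight (E := E) (C := C) (n := ν j) (h.measurable_s j)
    have h4 : ∫ ω, w j ω ^ 2 * (r j ω * E.err g 0 ω) ∂P = 0 := by
      have h5 := hm.integral_mul_err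
        (φ := fun z => E.weight C (ν j) (s j) z ^ 2 * (E.outcomeReg (ν j) z.1 - m j z.1))
        ((hwm.pow_const 2).mul (((E.measurable_outcomeReg (ν j)).comp measurable_fst).sub
          ((h.measurable_m j).comp measurable_fst)))
        (h2.congr (ae_of_all _ fun ω => (mul_assoc _ _ _).symm))
      rw [← h5]
      exact integral_congr_ae (ae_of_all _ fun ω => (mul_assoc _ _ _).symm)
    have h6 : ∫ ω, w j ω ^ 2 * E.err g 0 ω ^ 2 ∂P
        = ∫ ω, w j ω ^ 2 * E.errVar g (E.X 0 ω) ∂P :=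
      hm.integral_mul_err_sq (φ := fun z => E.weight C (ν j) (s j) z ^ 2) (hwm.pow_const 2)
        (c := C ^ 2) fun z => by
          rw [abs_of_nonneg (sq_nonneg _)]
          exact h.weight_sq_le j z
    have h12 : Integrable (fun ω => w j ω ^ 2 * E.err g 0 ω ^ 2
        + 2 * (w j ω ^ 2 * (r j ω * E.err g 0 ω))) P := h1.add (h2.const_mul 2)
    simp_rw [heq]
    rw [integral_add h12 h3, integral_add h1 (h2.const_mul 2),
      integral_const_mul, h4, h6, mul_zero, add_zero]
  simp_rw [hsum]
  have hlim : Tendsto (fun j => ∫ ω, w j ω ^ 2 * r j ω ^ 2 ∂P) atTop (𝓝 0) := by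
    refine squeeze_zero (fun j => integral_nonneg fun ω => by positivity) (fun j => ?_)
      (by simpa using h.tendsto_m.const_mul (C ^ 2))
    rw [← integral_const_mul]
    refine integral_mono (h.integrable_weight_sq_mul j (h.memLp_m j).integrable_sq)
      ((h.memLp_m j).integrable_sq.const_mul _) fun ω => ?_
    change w j ω ^ 2 * r j ω ^ 2 ≤ C ^ 2 * r j ω ^ 2
    exact mul_le_mul_of_nonneg_right (h.weight_sq_le j _) (sq_nonneg _)
  simpa using (h.tendsto_integral_weight_sq hp hA hb hm hσ).add hlim

end IsConsistent

end QueueExperiment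

/-! ### Uniform integrability of the numerator and convergence of the denominator. -/

namespace QueueExperiment

/-- The truncated second moment of a square integrable function tends to zero. -/
theorem tendsto_setIntegral_sq_tail {Ω : Type*} [MeasurableSpace Ω] {P : Measure Ω} {f : Ω → ℝ}
    (hf : MemLp f 2 P) (hfm : Measurable f) :
    Tendsto (fun M : ℕ => ∫ ω, {ω | (M : ℝ) < |f ω|}.indicator (fun ω => f ω ^ 2) ω ∂P) atTop
      (𝓝 0) := by
  have h := tendsto_integral_of_dominated_convergence (μ := P)
    (F := fun (M : ℕ) ω => {ω | (M : ℝ) < |f ω|}.indicator (fun ω => f ω ^ 2) ω)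
    (f := fun _ => 0) (fun ω => f ω ^ 2)
    (fun M => ((hfm.pow_const 2).indicator
      (measurableSet_lt measurable_const hfm.abs)).aestronglyMeasurable) hf.integrable_sq
    (fun M => ae_of_all _ fun ω => by
      refine (norm_indicator_le_norm_self _ _).trans ?_
      rw [Real.norm_of_nonneg (sq_nonneg _)])
    (ae_of_all _ fun ω => by
      obtain ⟨N, hN⟩ := exists_nat_ge |f ω|
      refine tendsto_const_nhds.congr' ?_
      filter_upwards [eventually_ge_atTop N] with M hM
      have : (N : ℝ) ≤ M := by exact_mod_cast hM
      rw [Set.indicator_of_notMem]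
      exact fun hlt => absurd hlt (not_lt.2 (hN.trans this)))
  simpa using h

variable {Ω : Type*} [MeasurableSpace Ω] {P : Measure Ω} {d K : ℕ} [IsProbabilityMeasure P]
  {E : QueueExperiment P d K} {p : Fin K → ℝ} {β ψ : ℝ}
  {g : EuclideanSpace ℝ (Fin d) → ℝ} {C : ℝ} {ν : ℕ → ℕ}
  {s m : ℕ → EuclideanSpace ℝ (Fin d) → ℝ}

/-- From the pointwise bound |x| ≤ δ + x²/δ. -/
theorem integral_abs_le_add_sq_div {f : Ω → ℝ} (hf : MemLp f 2 P) {δ : ℝ} (hδ : 0 < δ) :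
    ∫ ω, |f ω| ∂P ≤ δ + (∫ ω, f ω ^ 2 ∂P) / δ := by
  have h : ∫ ω, |f ω| ∂P ≤ ∫ ω, (δ + f ω ^ 2 / δ) ∂P := by
    refine integral_mono (hf.integrable one_le_two).abs
      ((integrable_const _).add (hf.integrable_sq.div_const _)) fun ω => ?_
    change |f ω| ≤ δ + f ω ^ 2 / δ
    rw [← sq_abs, ← sub_nonneg]
    have : δ + |f ω| ^ 2 / δ - |f ω| = ((|f ω| - δ) ^ 2 + |f ω| * δ) / δ := by field_simp; ring
    rw [this]
    positivity
  rwa [integral_add (integrable_const _) (hf.integrable_sq.div_const _), integral_div,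
    integral_const, probReal_univ, one_smul] at h

namespace IsConsistent

/-- The squares of the normalized sums of scores are uniformly integrable. -/
theorem unifIntegrable_score (h : E.IsConsistent g C ν s m) (hm : E.IsPLIV ψ g) (ε : ℝ)
    (hε : 0 < ε) : ∃ δ : ℝ, 0 < δ ∧ ∀ᶠ j in atTop, ∀ B, MeasurableSet B → P.real B ≤ δ →
      ∫ ω in B, normalizedSum E.unit (E.score g C (ν j) (s j) (m j)) (ν j) ω ^ 2 ∂P ≤ ε := by
  have hC := h.C_nonneg
  have herr : Measurable (E.err g 0) := E.measurable_err hm.measurable_g 0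
  obtain ⟨M, hM⟩ := ((tendsto_setIntegral_sq_tail hm.memLp_err herr).eventually_le_const
    (show 0 < ε / (16 * (C ^ 2 + 1)) by positivity)).exists
  -- Neither the truncation level `M` nor `L` depends on `j`. `L` makes the fourth moment term equal
  -- to ε/4, the bound ε/(8L) on P(B) makes the next term at most ε/4, and the unbounded part
  -- contributes at most ε/2.
  set L : ℝ := 96 * Real.exp ((C * M) ^ 2 / 2) / (ε / 4) with hL
  have hLpos : 0 < L := by positivity
  refine ⟨ε / (8 * L), by positivity, ?_⟩
  filter_upwards [h.tendsto_m.eventually_le_const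
    (show 0 < ε / (16 * (C ^ 2 + 1)) by positivity)] with j hj B hB hPB
  -- the part of the score with truncated errors, and the rest
  set T : Set (ℝ × EuclideanSpace ℝ (Fin d) × ℝ × ℝ × Fin K) :=
    {w | (M : ℝ) < |w.2.2.1 - g w.2.1|} with hT
  have hum : Measurable fun w : ℝ × EuclideanSpace ℝ (Fin d) × ℝ × ℝ × Fin K =>
      w.2.2.1 - g w.2.1 := measurable_snd.snd.fst.sub (hm.measurable_g.comp measurable_snd.fst)
  have hTm : MeasurableSet T := measurableSet_lt measurable_const hum.abs
  have hwm : Measurable fun w : ℝ × EuclideanSpace ℝ (Fin d) × ℝ × ℝ × Fin K =>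
      E.weight C (ν j) (s j) (w.2.1, w.2.2.2.2) :=
    (measurable_weight (h.measurable_s j)).comp
      (measurable_snd.fst.prodMk measurable_snd.snd.snd.snd)
  set F₁ : ℝ × EuclideanSpace ℝ (Fin d) × ℝ × ℝ × Fin K → ℝ := fun w =>
    E.weight C (ν j) (s j) (w.2.1, w.2.2.2.2) * Tᶜ.indicator (fun w => w.2.2.1 - g w.2.1) w with hF₁
  set F₂ : ℝ × EuclideanSpace ℝ (Fin d) × ℝ × ℝ × Fin K → ℝ := fun w =>
    E.weight C (ν j) (s j) (w.2.1, w.2.2.2.2) * (T.indicator (fun w => w.2.2.1 - g w.2.1) w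
      + (E.outcomeReg (ν j) w.2.1 - m j w.2.1)) with hF₂
  have hsum : E.score g C (ν j) (s j) (m j) = fun w => F₁ w + F₂ w := by
    ext w
    have := congrFun (Set.indicator_compl_add_self T
      (fun w : ℝ × EuclideanSpace ℝ (Fin d) × ℝ × ℝ × Fin K => w.2.2.1 - g w.2.1)) w
    simp only [hF₁, hF₂, score, ← mul_add, ← this, Pi.add_apply]
    ring
  have hF₁m : Measurable F₁ := hwm.mul (hum.indicator hTm.compl)
  have hF₂m : Measurable F₂ := hwm.mul ((hum.indicator hTm).add
    (((E.measurable_outcomeReg _).comp measurable_snd.fst).sub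
      ((h.measurable_m j).comp measurable_snd.fst)))
  have hF₁b : ∀ w, |F₁ w| ≤ C * M := by
    intro w
    rw [hF₁, abs_mul]
    refine mul_le_mul (h.abs_weight_le j _) ?_ (abs_nonneg _) hC
    by_cases hw : w ∈ T
    · simp [hw]
    · rw [Set.indicator_of_mem (show w ∈ Tᶜ from hw)]
      exact not_lt.1 hw
  have htail : MemLp (fun ω => T.indicator (fun w => w.2.2.1 - g w.2.1) (E.unit 0 ω)) 2 P := by
    have := hm.memLp_err.indicator (s := {ω | (M : ℝ) < |E.err g 0 ω|})
      (measurableSet_lt measurable_const herr.abs)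
    exact this
  have hF₂L : MemLp (fun ω => F₂ (E.unit 0 ω)) 2 P := by
    refine ((htail.add (h.memLp_m j)).const_mul C).mono
      (hF₂m.comp (E.measurable_unit 0)).aestronglyMeasurable (ae_of_all _ fun ω => ?_)
    rw [hF₂, norm_mul, norm_mul, Real.norm_of_nonneg hC]
    exact mul_le_mul_of_nonneg_right (h.abs_weight_le j _) (norm_nonneg _)
  have h0 := h.integral_score hm j
  simp_rw [hsum] at h0 ⊢
  have hmain := setIntegral_normalizedSum_sq_le (n := ν j) E.iIndepFun_unit E.identDistrib_unit
    hF₁m hF₂m hF₁b hF₂L h0 (h.index_pos j) B hLpos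
  refine hmain.trans ?_
  have h1 : ∫ ω, F₂ (E.unit 0 ω) ^ 2 ∂P ≤ ε / 4 := by
    have hi1 : Integrable (fun ω =>
        {ω | (M : ℝ) < |E.err g 0 ω|}.indicator (fun ω => E.err g 0 ω ^ 2) ω) P :=
      hm.memLp_err.integrable_sq.indicator (measurableSet_lt measurable_const herr.abs)
    have hi2 := (h.memLp_m j).integrable_sq
    have hle : ∫ ω, F₂ (E.unit 0 ω) ^ 2 ∂P ≤ ∫ ω, (2 * C ^ 2) *
        ({ω | (M : ℝ) < |E.err g 0 ω|}.indicator (fun ω => E.err g 0 ω ^ 2) ω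
          + (E.outcomeReg (ν j) (E.X 0 ω) - m j (E.X 0 ω)) ^ 2) ∂P := by
      refine integral_mono hF₂L.integrable_sq ((hi1.add hi2).const_mul _) fun ω => ?_
      have hind : {ω | (M : ℝ) < |E.err g 0 ω|}.indicator (fun ω => E.err g 0 ω ^ 2) ω
          = ({ω | (M : ℝ) < |E.err g 0 ω|}.indicator (E.err g 0) ω) ^ 2 := by
        by_cases hω : (M : ℝ) < |E.err g 0 ω| <;> simp [Set.indicator, hω]
      rw [hind]
      set x := {ω | (M : ℝ) < |E.err g 0 ω|}.indicator (E.err g 0) ω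
      set y := E.outcomeReg (ν j) (E.X 0 ω) - m j (E.X 0 ω)
      change (E.weight C (ν j) (s j) (E.X 0 ω, E.Q 0 ω) * (x + y)) ^ 2
        ≤ 2 * C ^ 2 * (x ^ 2 + y ^ 2)
      rw [mul_pow]
      calc _ ≤ C ^ 2 * (x + y) ^ 2 :=
            mul_le_mul_of_nonneg_right (h.weight_sq_le j _) (sq_nonneg _)
        _ ≤ C ^ 2 * (2 * (x ^ 2 + y ^ 2)) := by
            gcongr; nlinarith [sq_nonneg (x - y)]
        _ = _ := by ring
    rw [integral_const_mul, integral_add hi1 hi2] at hle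
    calc _ ≤ _ := hle
      _ ≤ 2 * C ^ 2 * (ε / (16 * (C ^ 2 + 1)) + ε / (16 * (C ^ 2 + 1))) := by gcongr
      _ ≤ ε / 4 := by
        have : 2 * C ^ 2 * (ε / (16 * (C ^ 2 + 1)) + ε / (16 * (C ^ 2 + 1)))
          = ε / 4 * (C ^ 2 / (C ^ 2 + 1)) := by field_simp; ring
        rw [this]
        refine mul_le_of_le_one_right (by positivity) ?_
        rw [div_le_one (by positivity)]
        linarith
  have h2 : 2 * (L * P.real B) ≤ ε / 4 := by
    calc 2 * (L * P.real B) ≤ 2 * (L * (ε / (8 * L))) := by gcongr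
      _ = ε / 4 := by field_simp; norm_num
  have h3 : 2 * (48 * Real.exp ((C * M) ^ 2 / 2) / L) = ε / 4 := by
    rw [hL]; field_simp; norm_num
  linarith

/-- The denominator of the estimator converges in mean to the information. -/
theorem tendsto_integral_abs_clippedDen (h : E.IsConsistent g C ν s m) (hp : E.FixedQueue p)
    (hA : E.IndepArrivals) (hb : E.StableBudget β)
    (hσ : ∀ᵐ ω ∂P, 0 < E.errVar g (E.X 0 ω)) :
    Tendsto (fun j => ∫ ω, |E.clippedDen C (ν j) (s j) ω - E.limitInfo β p g| ∂P) atTop (𝓝 0) := by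
  have hC := h.C_nonneg
  choose u hu using fun k : Fin K => E.exists_arrCdf_eq (queueAlpha_mem (p := p) (β := β) k)
  -- the summands with limiting treatment status
  set F : ℕ → ℝ × EuclideanSpace ℝ (Fin d) × ℝ × ℝ × Fin K → ℝ := fun j w =>
    E.weight C (ν j) (s j) (w.2.1, w.2.2.2.2) *
      ((if w.1 ≤ u w.2.2.2.2 then 1 else 0) - E.propensity (ν j) w.2.1) with hF
  have hFm : ∀ j, Measurable (F j) := fun j =>
    ((measurable_weight (h.measurable_s j)).comp
      (measurable_snd.fst.prodMk measurable_snd.snd.snd.snd)).mul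
      ((Measurable.ite (measurableSet_le measurable_fst ((measurable_of_finite u).comp
        measurable_snd.snd.snd.snd)) measurable_const measurable_const).sub
        ((measurable_propensity _).comp measurable_snd.fst))
  have hlimZ : ∀ i ω, E.limitZ u i ω = if E.A i ω ≤ u (E.Q i ω) then 1 else 0 :=
    fun i ω => by simp [limitZ, Set.indicator]
  have hFunit : ∀ j i ω, F j (E.unit i ω) = E.weight C (ν j) (s j) (E.X i ω, E.Q i ω) *
      (E.limitZ u i ω - E.propensity (ν j) (E.X i ω)) := fun j i ω => by rw [hlimZ]; rfl
  have hFb : ∀ j i ω, |F j (E.unit i ω)| ≤ C := by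
    intro j i ω
    rw [hFunit, abs_mul]
    calc _ ≤ C * 1 := by
          refine mul_le_mul (h.abs_weight_le j _) ?_ (abs_nonneg _) hC
          have h1 := E.propensity_mem (ν j) (E.X i ω)
          rw [abs_le]
          rcases E.limitZ_eq_zero_or_one u i ω with h2 | h2 <;> rw [h2] <;>
          constructor <;> linarith [h1.1, h1.2]
      _ = C := mul_one C
  have hFL : ∀ j i, MemLp (fun ω => F j (E.unit i ω)) 2 P := fun j i =>
    MemLp.of_bound ((hFm j).comp (E.measurable_unit i)).aestronglyMeasurable C
      (ae_of_all _ fun ω => hFb j i ω)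
  set μ : ℕ → ℝ := fun j => ∫ ω, F j (E.unit 0 ω) ∂P with hμ
  -- the mean
  have hμlim : Tendsto μ atTop (𝓝 (E.limitInfo β p g)) := by
    refine (h.tendsto_integral_weight_mul hp hA hb hσ).congr fun j => ?_
    have hi1 : Integrable (fun ω => E.weight C (ν j) (s j) (E.X 0 ω, E.Q 0 ω)
        * E.limitZ u 0 ω) P := by
      refine h.integrable_weight_mul j (Integrable.of_bound (C := 1)
        (E.measurable_limitZ u 0).aestronglyMeasurable (ae_of_all _ fun ω => ?_))
      rcases E.limitZ_eq_zero_or_one u 0 ω with h2 | h2 <;> simp [h2]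
    have hi2 : Integrable (fun ω => E.weight C (ν j) (s j) (E.X 0 ω, E.Q 0 ω)
        * E.propensity (ν j) (E.X 0 ω)) P := by
      refine h.integrable_weight_mul j (Integrable.of_bound (C := 1)
        ((measurable_propensity _).comp (E.measurable_X 0)).aestronglyMeasurable
        (ae_of_all _ fun ω => ?_))
      have h1 := E.propensity_mem (ν j) (E.X 0 ω)
      rw [Real.norm_of_nonneg h1.1]
      exact h1.2
    have hi3 : Integrable (fun ω => E.weight C (ν j) (s j) (E.X 0 ω, E.Q 0 ω)
        * queueAlpha β p (E.Q 0 ω)) P := by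
      refine h.integrable_weight_mul j (Integrable.of_bound (C := 1)
        ((measurable_of_finite (queueAlpha β p)).comp (E.measurable_Q 0)).aestronglyMeasurable
        (ae_of_all _ fun ω => ?_))
      have h1 := queueAlpha_mem (β := β) (p := p) (E.Q 0 ω)
      rw [Real.norm_of_nonneg h1.1]
      exact h1.2
    simp only [hμ, hFunit, mul_sub]
    rw [integral_sub hi1 hi2, integral_sub hi3 hi2, integral_mul_limitZ hA hu
      (measurable_weight (h.measurable_s j)) (h.abs_weight_le j)]
  -- the average with limiting treatment status
  set A : ℕ → Ω → ℝ := fun j ω =>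
    (√(ν j : ℝ))⁻¹ * normalizedSum E.unit (fun w => F j w - μ j) (ν j) ω with hAdef
  have hAL : ∀ j, MemLp (A j) 2 P := fun j =>
    (memLp_normalizedSum (F := fun w => F j w - μ j) E.identDistrib_unit
      ((hFm j).sub_const _) ((hFL j 0).sub (memLp_const _))).const_mul _
  have hA2 : ∀ j, ∫ ω, A j ω ^ 2 ∂P ≤ C ^ 2 / ν j := by
    intro j
    have h1 := integral_normalizedSum_sq (n := ν j) (F := fun w => F j w - μ j) E.iIndepFun_unit
      E.identDistrib_unit ((hFm j).sub_const _) ((hFL j 0).sub (memLp_const _)) (by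
        rw [integral_sub ((hFL j 0).integrable one_le_two) (integrable_const _)]; simp [hμ])
      (h.index_pos j)
    have h2 : ∫ ω, (F j (E.unit 0 ω) - μ j) ^ 2 ∂P ≤ ∫ ω, F j (E.unit 0 ω) ^ 2 ∂P := by
      have := variance_le_expectation_sq (μ := P) (hFL j 0).aestronglyMeasurable
      rwa [variance_eq_integral (hFL j 0).aemeasurable] at this
    have h3 : ∫ ω, F j (E.unit 0 ω) ^ 2 ∂P ≤ C ^ 2 := by
      have : ∫ ω, F j (E.unit 0 ω) ^ 2 ∂P ≤ ∫ _, C ^ 2 ∂P := by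
        refine integral_mono (hFL j 0).integrable_sq (integrable_const _) fun ω => ?_
        change F j (E.unit 0 ω) ^ 2 ≤ C ^ 2
        rw [← sq_abs]
        exact pow_le_pow_left₀ (abs_nonneg _) (hFb j 0 ω) 2
      simpa using this
    simp only [hAdef, mul_pow]
    rw [integral_const_mul, h1, inv_pow, Real.sq_sqrt (Nat.cast_nonneg _), div_eq_inv_mul]
    gcongr
    exact h2.trans h3
  have hAabs : Tendsto (fun j => ∫ ω, |A j ω| ∂P) atTop (𝓝 0) := by
    have hinv : Tendsto (fun j => C ^ 2 / (ν j : ℝ)) atTop (𝓝 0) :=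
      tendsto_const_nhds.div_atTop (tendsto_natCast_atTop_atTop.comp h.tendsto_index)
    rw [Metric.tendsto_atTop']
    intro ε hε
    -- The threshold (ε/4)² is matched to the bound δ + E[A²]/δ with δ = ε/4.
    obtain ⟨N, hN⟩ := eventually_atTop.1 (hinv.eventually_lt_const
      (show 0 < (ε / 4) * (ε / 4) by positivity))
    refine ⟨N, fun j hj => ?_⟩
    have h1 := integral_abs_le_add_sq_div (hAL j) (show 0 < ε / 4 by positivity)
    have h2 : (∫ ω, A j ω ^ 2 ∂P) / (ε / 4) ≤ ε / 4 := by
      rw [div_le_iff₀ (by positivity)]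
      exact (hA2 j).trans (hN j hj.le).le
    rw [Real.dist_0_eq_abs, abs_of_nonneg (integral_nonneg fun ω => abs_nonneg _)]
    linarith
  -- replacing the treatment status by its limit
  set R : ℕ → Ω → ℝ := fun j ω => (1 / (ν j : ℝ)) * ∑ i ∈ Finset.range (ν j),
    E.weight C (ν j) (s j) (E.X i ω, E.Q i ω) * (E.Z (ν j) i ω - E.limitZ u i ω) with hR
  have hZi : ∀ j i, Integrable (fun ω => |E.Z (ν j) i ω - E.limitZ u i ω|) P := fun j i =>
    ((E.integrable_Z (ν j) i).sub (Integrable.of_bound (C := 1)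
      (E.measurable_limitZ u i).aestronglyMeasurable (ae_of_all _ fun ω => by
        rcases E.limitZ_eq_zero_or_one u i ω with h2 | h2 <;> simp [h2]))).abs
  -- Three errors: `R` from replacing the status by its limit, `A` from the fluctuation of an i.i.d.
  -- average, and the bias of its mean.
  have hdec : ∀ j ω, E.clippedDen C (ν j) (s j) ω - E.limitInfo β p g
      = R j ω + A j ω + (μ j - E.limitInfo β p g) := by
    intro j ω
    have hn : (ν j : ℝ) ≠ 0 := by exact_mod_cast (h.index_pos j).ne'
    have hsq : (√(ν j : ℝ))⁻¹ * (√(ν j : ℝ))⁻¹ = 1 / (ν j : ℝ) := by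
      rw [← mul_inv, Real.mul_self_sqrt (Nat.cast_nonneg _), one_div]
    have hA1 : A j ω = (1 / (ν j : ℝ)) * ∑ i ∈ Finset.range (ν j), F j (E.unit i ω) - μ j := by
      simp only [hAdef, normalizedSum]
      rw [← mul_assoc, hsq, Finset.sum_sub_distrib, Finset.sum_const, Finset.card_range,
        nsmul_eq_mul, mul_sub]
      congr 1
      field_simp
    have hsum : E.clippedDen C (ν j) (s j) ω
        = R j ω + (1 / (ν j : ℝ)) * ∑ i ∈ Finset.range (ν j), F j (E.unit i ω) := by
      rw [hR, clippedDen, ← mul_add, ← Finset.sum_add_distrib]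
      congr 1
      refine Finset.sum_congr rfl fun i _ => ?_
      rw [hFunit]
      ring
    rw [hA1, hsum]
    ring
  have hRb : ∀ j ω, |R j ω| ≤ (1 / (ν j : ℝ)) * ∑ i ∈ Finset.range (ν j),
      C * |E.Z (ν j) i ω - E.limitZ u i ω| := by
    intro j ω
    rw [hR, abs_mul, abs_of_nonneg (by positivity : (0 : ℝ) ≤ 1 / (ν j : ℝ))]
    refine mul_le_mul_of_nonneg_left ((Finset.abs_sum_le_sum_abs _ _).trans
      (Finset.sum_le_sum fun i _ => ?_)) (by positivity)
    rw [abs_mul]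
    exact mul_le_mul_of_nonneg_right (h.abs_weight_le j _) (abs_nonneg _)
  have hbi : ∀ j, Integrable (fun ω => (1 / (ν j : ℝ)) * ∑ i ∈ Finset.range (ν j),
      C * |E.Z (ν j) i ω - E.limitZ u i ω|) P := fun j =>
    (integrable_finsetSum _ fun i _ => (hZi j i).const_mul C).const_mul _
  have hRm : ∀ j, Measurable (R j) := fun j =>
    (Finset.measurable_fun_sum _ fun i _ => ((measurable_weight (h.measurable_s j)).comp
      ((E.measurable_X i).prodMk (E.measurable_Q i))).mul ((E.measurable_Z _ i).sub
        (E.measurable_limitZ u i))).const_mul _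
  have hRi : ∀ j, Integrable (R j) P := fun j =>
    (hbi j).mono' (hRm j).aestronglyMeasurable (ae_of_all _ fun ω => hRb j ω)
  have hRabs : Tendsto (fun j => ∫ ω, |R j ω| ∂P) atTop (𝓝 0) := by
    rw [Metric.tendsto_atTop']
    intro ε hε
    obtain ⟨N, hN⟩ := eventually_atTop.1 (h.tendsto_index.eventually
      (eventually_integral_Z_sub_limitZ_le hp hA hb hu (show 0 < ε / (2 * (C + 1)) by positivity)))
    refine ⟨N, fun j hj => ?_⟩
    have hj' := hN j hj.le
    rw [Real.dist_0_eq_abs, abs_of_nonneg (integral_nonneg fun ω => abs_nonneg _)]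
    have hn : (0 : ℝ) < ν j := by exact_mod_cast h.index_pos j
    calc ∫ ω, |R j ω| ∂P
        ≤ ∫ ω, (1 / (ν j : ℝ)) * ∑ i ∈ Finset.range (ν j),
          C * |E.Z (ν j) i ω - E.limitZ u i ω| ∂P :=
          integral_mono (hRi j).abs (hbi j) (hRb j)
      _ = (1 / (ν j : ℝ)) * ∑ i ∈ Finset.range (ν j),
          C * ∫ ω, |E.Z (ν j) i ω - E.limitZ u i ω| ∂P := by
          rw [integral_const_mul, integral_finsetSum _ fun i _ => (hZi j i).const_mul C]
          simp_rw [integral_const_mul]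
      _ ≤ (1 / (ν j : ℝ)) * ∑ i ∈ Finset.range (ν j), C * (ε / (2 * (C + 1))) := by
          refine mul_le_mul_of_nonneg_left (Finset.sum_le_sum fun i hi => ?_) (by positivity)
          exact mul_le_mul_of_nonneg_left (hj' i (Finset.mem_range.1 hi)) hC
      _ = C * (ε / (2 * (C + 1))) := by
          rw [Finset.sum_const, Finset.card_range, nsmul_eq_mul]
          field_simp
      _ < ε := by
          have : C * (ε / (2 * (C + 1))) = ε / 2 * (C / (C + 1)) := by field_simp
          rw [this]
          have hlt : C / (C + 1) ≤ 1 := by rw [div_le_one (by positivity)]; linarith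
          nlinarith
  have hlim := (hRabs.add hAabs).add
    ((tendsto_iff_norm_sub_tendsto_zero).1 hμlim)
  simp only [add_zero] at hlim
  refine squeeze_zero (fun j => integral_nonneg fun ω => abs_nonneg _) (fun j => ?_) hlim
  have hAi := ((hAL j).integrable one_le_two).abs
  have hint : Integrable (fun ω => |R j ω| + |A j ω|) P := (hRi j).abs.add hAi
  calc ∫ ω, |E.clippedDen C (ν j) (s j) ω - E.limitInfo β p g| ∂P
      ≤ ∫ ω, (|R j ω| + |A j ω| + |μ j - E.limitInfo β p g|) ∂P := by
        refine integral_mono ?_ (hint.add (integrable_const _)) fun ω => ?_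
        · simp_rw [hdec]
          exact (((hRi j).add ((hAL j).integrable one_le_two)).add (integrable_const _)).abs
        · simp only [hdec]
          exact (abs_add_le _ _).trans (add_le_add_left (abs_add_le _ _) _)
    _ = _ := by
        rw [integral_add hint (integrable_const _), integral_add (hRi j).abs hAi]
        simp

end IsConsistent

end QueueExperiment

/-! ### Efficiency along consistent sequences, and extraction of such sequences. -/

theorem MeasureTheory.MemLp.integral_sq_eq {Ω : Type*} [MeasurableSpace Ω] {P : Measure Ω}
    {f : Ω → ℝ} (hf : MemLp f 2 P) : ∫ ω, f ω ^ 2 ∂P = (eLpNorm f 2 P).toReal ^ 2 := by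
  have h0 : 0 ≤ ∫ ω, f ω ^ 2 ∂P := integral_nonneg fun ω => sq_nonneg _
  have h1 : ∀ ω, ‖f ω‖ ^ (2 : ℝ≥0∞).toReal = f ω ^ 2 := fun ω => by
    rw [ENNReal.toReal_ofNat, Real.rpow_two, Real.norm_eq_abs, sq_abs]
  rw [hf.eLpNorm_eq_integral_rpow_norm two_ne_zero ENNReal.ofNat_ne_top]
  simp_rw [h1]
  rw [ENNReal.toReal_ofReal (by positivity), ENNReal.toReal_ofNat, ← Real.rpow_two,
    ← Real.rpow_mul h0, inv_mul_cancel₀ two_ne_zero, Real.rpow_one]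

namespace QueueExperiment

variable {Ω : Type*} [MeasurableSpace Ω] {P : Measure Ω} {d K : ℕ} [IsProbabilityMeasure P]
  {E : QueueExperiment P d K} {p : Fin K → ℝ} {β ψ : ℝ}
  {g : EuclideanSpace ℝ (Fin d) → ℝ} {C : ℝ} {ν : ℕ → ℕ}
  {s m : ℕ → EuclideanSpace ℝ (Fin d) → ℝ}

/-- In the experiment of size `n` with nuisance functions `s` and `m`, the denominator of the
estimator is at least `c` with probability exceeding `1 - ε`, and the normalized variance of the
estimator on this event is within `ε` of the efficiency bound. -/
def IsNearlyEfficient (E : QueueExperiment P d K) (β : ℝ) (p : Fin K → ℝ)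
    (g : EuclideanSpace ℝ (Fin d) → ℝ) (c ε : ℝ) (n : ℕ)
    (s m : EuclideanSpace ℝ (Fin d) → ℝ) : Prop :=
  1 - ε < P.real {ω | c ≤ |E.ivDen n s ω|} ∧
  MemLp (E.ivEstimator n s m) 2 (P[|{ω | c ≤ |E.ivDen n s ω|}]) ∧
  |n * Var[E.ivEstimator n s m; P[|{ω | c ≤ |E.ivDen n s ω|}]] - (E.limitInfo β p g)⁻¹| < ε

namespace IsConsistent

theorem ivDen_ae (h : E.IsConsistent g C ν s m) (j : ℕ) :
    ∀ᵐ ω ∂P, E.ivDen (ν j) (s j) ω = E.clippedDen C (ν j) (s j) ω := by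
  filter_upwards [ae_all_iff.2 fun i => h.weight_ae j i] with ω hω
  simp only [ivDen, clippedDen, hω]

/-- The numerator of the estimator, in terms of the denominator and the sum of the scores. -/
theorem ivNum_ae (h : E.IsConsistent g C ν s m) (hm : E.IsPLIV ψ g) (j : ℕ) :
    ∀ᵐ ω ∂P, E.ivNum (ν j) (s j) (m j) ω = ψ * E.clippedDen C (ν j) (s j) ω
      + (√(ν j : ℝ))⁻¹ * normalizedSum E.unit (E.score g C (ν j) (s j) (m j)) (ν j) ω := by
  have hreg : ∀ i, ∀ᵐ ω ∂P,
      E.outcomeReg (ν j) (E.X i ω) = ψ * E.propensity (ν j) (E.X i ω) + g (E.X i ω) :=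
    E.ae_unit (p := fun w =>
      E.outcomeReg (ν j) w.2.1 = ψ * E.propensity (ν j) w.2.1 + g w.2.1)
      (measurableSet_eq_fun ((E.measurable_outcomeReg (ν j)).comp measurable_snd.fst)
        ((((measurable_propensity (E := E) (ν j)).comp measurable_snd.fst).const_mul ψ).add
          (hm.measurable_g.comp measurable_snd.fst)))
      (hm.outcomeReg_ae (h.index_pos j))
  have hout : ∀ᵐ ω ∂P, ∀ i, i < ν j →
      E.Y (ν j) i ω = ψ * E.Z (ν j) i ω + g (E.X i ω) + E.err g i ω :=
    ae_all_iff.2 fun i => eventually_imp_distrib_left.2 (hm.outcome_eq (ν j) i)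
  filter_upwards [ae_all_iff.2 fun i => h.weight_ae j i, ae_all_iff.2 hreg, hout] with ω h1 h2 h3
  have hsq : (√(ν j : ℝ))⁻¹ * (√(ν j : ℝ))⁻¹ = 1 / (ν j : ℝ) := by
    rw [← mul_inv, Real.mul_self_sqrt (Nat.cast_nonneg _), one_div]
  rw [normalizedSum, ← mul_assoc, hsq, clippedDen, mul_left_comm, ← mul_add, Finset.mul_sum,
    ← Finset.sum_add_distrib, ivNum]
  congr 1
  refine Finset.sum_congr rfl fun i hi => ?_
  have hs : E.score g C (ν j) (s j) (m j) (E.unit i ω) = E.weight C (ν j) (s j) (E.X i ω, E.Q i ω)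
      * (E.err g i ω + (E.outcomeReg (ν j) (E.X i ω) - m j (E.X i ω))) := rfl
  -- Termwise this is Y - m̂ = ψ(Z - π_n) + U + (m_n - m̂), multiplied by the weight.
  rw [hs, h3 i (Finset.mem_range.1 hi), h2 i, ← h1 i]
  ring

/-- Along a consistent sequence of nuisance functions, the estimator is asymptotically
efficient. -/
theorem eventually_isNearlyEfficient (h : E.IsConsistent g C ν s m) (hp : E.FixedQueue p)
    (hA : E.IndepArrivals) (hb : E.StableBudget β) (hm : E.IsPLIV ψ g)
    (hσ : ∀ᵐ ω ∂P, 0 < E.errVar g (E.X 0 ω)) {c ε : ℝ} (hc : 0 < c)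
    (hcI : c < E.limitInfo β p g) (hε : 0 < ε) :
    ∀ᶠ j in atTop, E.IsNearlyEfficient β p g c ε (ν j) (s j) (m j) := by
  set D : ℕ → Ω → ℝ := fun j => E.clippedDen C (ν j) (s j) with hDdef
  set G : ℕ → Ω → ℝ := fun j =>
    normalizedSum E.unit (E.score g C (ν j) (s j) (m j)) (ν j) with hGdef
  have hDm : ∀ j, Measurable (D j) := fun j => measurable_clippedDen (h.measurable_s j)
  have hFm : ∀ j, Measurable (E.score g C (ν j) (s j) (m j)) := fun j =>
    measurable_score hm.measurable_g (h.measurable_s j) (h.measurable_m j)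
  have hG : ∀ j, MemLp (G j) 2 P := fun j =>
    memLp_normalizedSum E.identDistrib_unit (hFm j) (h.memLp_score hm j)
  have hG0 : ∀ j, ∫ ω, G j ω ∂P = 0 := fun j =>
    integral_normalizedSum E.identDistrib_unit (hFm j)
      ((h.memLp_score hm j).integrable one_le_two) (h.integral_score hm j)
  have hG2 : Tendsto (fun j => ∫ ω, G j ω ^ 2 ∂P) atTop (𝓝 (E.limitInfo β p g)) :=
    (h.tendsto_integral_score_sq hp hA hb hm hσ).congr fun j =>
      (integral_normalizedSum_sq E.iIndepFun_unit E.identDistrib_unit (hFm j)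
        (h.memLp_score hm j) (h.integral_score hm j) (h.index_pos j)).symm
  have hDb : ∀ j, Integrable (fun ω => |D j ω - E.limitInfo β p g|) P := by
    intro j
    refine (Integrable.sub ?_ (integrable_const _)).abs
    refine (integrable_finsetSum _ fun i _ => ?_).const_mul _
    refine Integrable.bdd_mul (c := C) ((E.integrable_Z (ν j) i).sub ?_)
      ((measurable_weight (h.measurable_s j)).comp
        ((E.measurable_X i).prodMk (E.measurable_Q i))).aestronglyMeasurable
      (ae_of_all _ fun ω => h.abs_weight_le j _)
    refine Integrable.of_bound (C := 1)
      ((measurable_propensity (E := E) (ν j)).comp (E.measurable_X i)).aestronglyMeasurable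
      (ae_of_all _ fun ω => ?_)
    have h1 := E.propensity_mem (ν j) (E.X i ω)
    rw [Real.norm_of_nonneg h1.1]
    exact h1.2
  have hD : ∀ η : ℝ, 0 < η →
      Tendsto (fun j => P.real {ω | η ≤ |D j ω - E.limitInfo β p g|}) atTop (𝓝 0) := by
    intro η hη
    have hlim := (h.tendsto_integral_abs_clippedDen hp hA hb hσ).div_const η
    rw [zero_div] at hlim
    refine squeeze_zero (fun j => measureReal_nonneg) (fun j => ?_) hlim
    rw [le_div_iff₀ hη, mul_comm]
    exact mul_meas_ge_le_integral_of_nonneg (ae_of_all _ fun ω => abs_nonneg _) (hDb j) η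
  obtain ⟨h1, h2, h3, h4⟩ := tendsto_variance_ratio hc hcI hG hG0 hG2
    (h.unifIntegrable_score hm) hDm hD
  filter_upwards [h1.eventually_const_lt (show 1 - ε < 1 by linarith), h2,
    (Metric.tendsto_nhds.1 h4) ε hε] with j hj1 hj2 hj4
  have hset : {ω | c ≤ |E.ivDen (ν j) (s j) ω|} =ᵐ[P] {ω | c ≤ |D j ω|} := by
    filter_upwards [h.ivDen_ae j] with ω hω
    exact congrArg (fun x : ℝ => c ≤ |x|) hω
  -- The clipped and unclipped denominators agree almost surely, so they define the same conditional
  -- measure.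
  have hcond : P[|{ω | c ≤ |E.ivDen (ν j) (s j) ω|}] = P[|{ω | c ≤ |D j ω|}] := by
    rw [ProbabilityTheory.cond, ProbabilityTheory.cond, measure_congr hset,
      Measure.restrict_congr_set hset]
  have hn : (0 : ℝ) < ν j := by exact_mod_cast h.index_pos j
  -- On the event the denominator is nonzero, and the estimator is ψ plus n^{-1/2} times the ratio;
  -- the factor n in the claim then cancels exactly.
  have hest : E.ivEstimator (ν j) (s j) (m j) =ᵐ[P[|{ω | c ≤ |D j ω|}]]
      fun ω => ψ + (√(ν j : ℝ))⁻¹ * (G j ω / D j ω) := by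
    filter_upwards [cond_absolutelyContinuous.ae_le (h.ivDen_ae j),
      cond_absolutelyContinuous.ae_le (h.ivNum_ae hm j),
      ae_cond_mem (measurableSet_le measurable_const (hDm j).abs)] with ω hω1 hω2 hω3
    have hne : D j ω ≠ 0 := abs_pos.1 (hc.trans_le hω3)
    rw [ivEstimator, hω1, hω2]
    change (ψ * D j ω + (√(ν j : ℝ))⁻¹ * G j ω) / D j ω = _
    field_simp
  have hmem := ((h3 j).const_mul (√(ν j : ℝ))⁻¹)
  refine ⟨?_, ?_, ?_⟩
  · rwa [measureReal_congr hset]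
  · rw [hcond, memLp_congr_ae hest]
    exact (memLp_const ψ).add hmem
  · rw [hcond, variance_congr hest, variance_const_add hmem.aestronglyMeasurable,
      variance_const_mul, ← mul_assoc, inv_pow, Real.sq_sqrt hn.le, mul_inv_cancel₀ hn.ne', one_mul]
    exact hj4

/-- Relevance of the limiting instrument makes the information positive. -/
theorem limitInfo_pos (h : E.IsConsistent g C ν s m) (hp : E.FixedQueue p)
    (hA : E.IndepArrivals) (hb : E.StableBudget β)
    (hσ : ∀ᵐ ω ∂P, 0 < E.errVar g (E.X 0 ω))
    (hrel : 0 < ∫ ω, (queueAlpha β p (E.Q 0 ω) - E.asympPropensity (E.X 0 ω)) ^ 2 ∂P) :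
    0 < E.limitInfo β p g := by
  have hnn : 0 ≤ᵐ[P] fun ω => (queueAlpha β p (E.Q 0 ω) - E.asympPropensity (E.X 0 ω)) ^ 2
      / E.errVar g (E.X 0 ω) := by
    filter_upwards [hσ] with ω hω
    exact div_nonneg (sq_nonneg _) hω.le
  refine lt_of_le_of_ne (integral_nonneg_of_ae hnn) fun h0 => hrel.ne' ?_
  -- Integrability is essential here: a divergent integral would also have the value zero.
  have hz := (integral_eq_zero_iff_of_nonneg_ae hnn (h.integrable_limitInfo hp hA hb hσ)).1 h0.symm
  refine integral_eq_zero_of_ae ?_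
  filter_upwards [hz, hσ] with ω h1 h2
  exact (div_eq_zero_iff.1 h1).resolve_right h2.ne'

end IsConsistent

/-- Nuisance functions that converge in mean square have a consistent subsequence. -/
theorem exists_isConsistent (hν : ∀ j, j < ν j) (hs : ∀ j, Measurable (s j))
    (hm : ∀ j, Measurable (m j))
    (hs2 : ∀ j : ℕ, eLpNorm (fun x => s j x - E.errVar g x) 2 E.lawX < (j + 1 : ℝ≥0∞)⁻¹)
    (hm2 : ∀ j : ℕ, eLpNorm (fun x => m j x - E.outcomeReg (ν j) x) 2 E.lawX < (j + 1 : ℝ≥0∞)⁻¹)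
    (hbd : ∀ j, ∀ᵐ ω ∂P, |E.instr (ν j) (E.X 0 ω) (E.Q 0 ω) / s j (E.X 0 ω)| ≤ C) :
    ∃ φ : ℕ → ℕ, StrictMono φ ∧ E.IsConsistent g C (ν ∘ φ) (s ∘ φ) (m ∘ φ) := by
  have hX := E.measurable_X 0
  have hlim : Tendsto (fun j : ℕ => (j + 1 : ℝ≥0∞)⁻¹) atTop (𝓝 0) := by
    have := (tendsto_add_atTop_iff_nat 1).2 ENNReal.tendsto_inv_nat_nhds_zero
    simpa using this
  have hsP : ∀ j, eLpNorm ((fun ω => s j (E.X 0 ω)) - fun ω => E.errVar g (E.X 0 ω)) 2 P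
      < (j + 1 : ℝ≥0∞)⁻¹ := by
    intro j
    have := hs2 j
    rwa [lawX, eLpNorm_map_measure (g := fun x => s j x - E.errVar g x)
      ((hs j).sub (E.measurable_errVar g)).aestronglyMeasurable hX.aemeasurable] at this
  have hrm : ∀ j, Measurable fun ω => E.outcomeReg (ν j) (E.X 0 ω) - m j (E.X 0 ω) := fun j =>
    ((E.measurable_outcomeReg (ν j)).comp hX).sub ((hm j).comp hX)
  have hmP : ∀ j, eLpNorm (fun ω => E.outcomeReg (ν j) (E.X 0 ω) - m j (E.X 0 ω)) 2 P
      < (j + 1 : ℝ≥0∞)⁻¹ := by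
    intro j
    have := hm2 j
    rw [lawX, eLpNorm_map_measure (g := fun x => m j x - E.outcomeReg (ν j) x)
      ((hm j).sub (E.measurable_outcomeReg (ν j))).aestronglyMeasurable hX.aemeasurable,
      ← eLpNorm_neg] at this
    convert! this using 2
    ext ω
    simp
  have hmL : ∀ j, MemLp (fun ω => E.outcomeReg (ν j) (E.X 0 ω) - m j (E.X 0 ω)) 2 P := fun j =>
    ⟨(hrm j).aestronglyMeasurable, (hmP j).trans_le le_top⟩
  have hmT : Tendsto (fun j => ∫ ω, (E.outcomeReg (ν j) (E.X 0 ω) - m j (E.X 0 ω)) ^ 2 ∂P) atTop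
      (𝓝 0) := by
    have h1 := tendsto_of_tendsto_of_tendsto_of_le_of_le tendsto_const_nhds hlim
      (fun j => zero_le) (fun j => (hmP j).le)
    have h2 := ((ENNReal.tendsto_toReal ENNReal.zero_ne_top).comp h1).pow 2
    simp only [ENNReal.toReal_zero, ne_eq, OfNat.ofNat_ne_zero, not_false_eq_true, zero_pow] at h2
    exact h2.congr fun j => (hmL j).integral_sq_eq.symm
  -- Only σ̂ needs almost sure convergence, since it appears in a denominator; a subsequence
  -- supplies it. For m̂ convergence in mean square suffices.
  have hmeas := tendstoInMeasure_of_tendsto_eLpNorm two_ne_zero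
    (fun j => ((hs j).comp hX).aestronglyMeasurable)
    ((E.measurable_errVar g).comp hX).aestronglyMeasurable
    (tendsto_of_tendsto_of_tendsto_of_le_of_le tendsto_const_nhds hlim
      (fun j => zero_le) (fun j => (hsP j).le))
  obtain ⟨φ, hφ, hae⟩ := hmeas.exists_seq_tendsto_ae
  refine ⟨φ, hφ, ?_, fun j => (Nat.zero_le _).trans_lt (hν _), fun j => hs _, fun j => hm _, hae,
    fun j => hmL _, hmT.comp hφ.tendsto_atTop, fun j => hbd _⟩
  exact (tendsto_atTop_mono (fun j => (hν j).le) tendsto_id).comp hφ.tendsto_atTop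

/-- Passing to the law of X requires a measurable event, so the existence of some limit is
transferred and the limit is identified afterwards. -/
theorem lawX_tendsto_propensity (hp : E.FixedQueue p) (hA : E.IndepArrivals)
    (hb : E.StableBudget β) :
    ∀ᵐ x ∂E.lawX, Tendsto (fun n => E.propensity n x) atTop (𝓝 (E.asympPropensity x)) := by
  have hmeas : MeasurableSet {x | ∃ l, Tendsto (fun n => E.propensity n x) atTop (𝓝 l)} :=
    measurableSet_exists_tendsto fun n => measurable_propensity n
  have h := (ae_map_iff (E.measurable_X 0).aemeasurable hmeas).2
    ((asympPropensity_ae hp hA hb).mono fun ω hω => ⟨_, hω⟩)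
  filter_upwards [h] with x hx
  exact tendsto_nhds_limUnder hx

end QueueExperiment

end

/-! ### Uniformity over nuisance functions, and the theorem. -/

namespace QueueExperiment

/-- Near efficiency holds uniformly over nuisance functions that are close to their targets. -/
theorem exists_forall_isNearlyEfficient {Ω : Type*} [MeasurableSpace Ω] {P : Measure Ω} {d K : ℕ}
    [IsProbabilityMeasure P] {E : QueueExperiment P d K} {p : Fin K → ℝ} {β ψ : ℝ}
    {g : EuclideanSpace ℝ (Fin d) → ℝ} {C : ℝ} (hp : E.FixedQueue p) (hA : E.IndepArrivals)
    (hb : E.StableBudget β) (hm : E.IsPLIV ψ g) (hσ : ∀ᵐ ω ∂P, 0 < E.errVar g (E.X 0 ω))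
    {c ε : ℝ} (hc : 0 < c) (hcI : c < E.limitInfo β p g) (hε : 0 < ε) :
    ∃ δ : ℝ≥0∞, 0 < δ ∧ ∃ N : ℕ, ∀ n, N ≤ n → ∀ s m : EuclideanSpace ℝ (Fin d) → ℝ,
      Measurable s → Measurable m →
      eLpNorm (fun x => s x - E.errVar g x) 2 E.lawX < δ →
      eLpNorm (fun x => m x - E.outcomeReg n x) 2 E.lawX < δ →
      (∀ᵐ ω ∂P, |E.instr n (E.X 0 ω) (E.Q 0 ω) / s (E.X 0 ω)| ≤ C) →
      E.IsNearlyEfficient β p g c ε n s m := by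
  -- If no neighborhood works, counterexamples with radius 1/(j+1) and sample size above j exist for
  -- all j. A subsequence of them is consistent, hence eventually nearly efficient.
  by_contra! hcon
  choose ν hν s m hs hmm hs2 hm2 hbd hbad using fun j : ℕ =>
    hcon (j + 1 : ℝ≥0∞)⁻¹ (ENNReal.inv_pos.2 (by finiteness)) (j + 1)
  obtain ⟨φ, -, h⟩ := exists_isConsistent (fun j => hν j) hs hmm hs2 hm2 hbd
  obtain ⟨j, hj⟩ := (h.eventually_isNearlyEfficient hp hA hb hm hσ hc hcI hε).exists
  exact hbad (φ j) hj

end QueueExperiment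

theorem theorem6 {Ω Ω' : Type*} [MeasurableSpace Ω] [MeasurableSpace Ω']
    (P : Measure Ω) [IsProbabilityMeasure P] (P' : Measure Ω') [IsProbabilityMeasure P']
    {d K : ℕ} (E : QueueExperiment P d K)
    (p : Fin K → ℝ) (β : ℝ)
    (hqueue : E.FixedQueue p) (hbudget : E.StableBudget β) (harrival : E.IndepArrivals)
    (ψ : ℝ) (g : EuclideanSpace ℝ (Fin d) → ℝ) (hmodel : E.IsPLIV ψ g)
    (hσ : ∀ᵐ x ∂E.lawX, 0 < E.errVar g x)
    -- nuisance estimates, functions of an independent sample with values in `Ω'`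
    (σhat mhat : ℕ → Ω' → EuclideanSpace ℝ (Fin d) → ℝ)
    (hσhat_meas : ∀ n D, Measurable (σhat n D)) (hmhat_meas : ∀ n D, Measurable (mhat n D))
    (hσhat : ∀ ε : ℝ≥0∞, 0 < ε → Tendsto
      (fun n => P' {D | ε ≤ eLpNorm (fun x => σhat n D x - E.errVar g x) 2 E.lawX}) atTop (𝓝 0))
    (hmhat : ∀ ε : ℝ≥0∞, 0 < ε → Tendsto
      (fun n => P' {D | ε ≤ eLpNorm (fun x => mhat n D x - E.outcomeReg n x) 2 E.lawX})
      atTop (𝓝 0))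
    -- the estimated instruments are uniformly bounded
    (C : ℝ)
    (hbdd : ∀ n, ∀ᵐ D ∂P', ∀ᵐ ω ∂P, 0 < σhat n D (E.X 0 ω) ∧
      |E.instr n (E.X 0 ω) (E.Q 0 ω) / σhat n D (E.X 0 ω)| ≤ C)
    (γ : ℝ) (hγ : 0 < γ)
    (hrel : γ ≤ ∫ ω, (queueAlpha β p (E.Q 0 ω) - E.asympPropensity (E.X 0 ω)) ^ 2 ∂P) :
    -- the limit defining the asymptotic propensity score exists
    (∀ᵐ x ∂E.lawX, Tendsto (fun n => E.propensity n x) atTop (𝓝 (E.asympPropensity x))) ∧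
    0 < E.limitInfo β p g ∧
    -- given `D`, off an event of vanishing probability where the denominator of the estimator is
    -- nearly zero, `n` times the variance of the estimator converges to the efficiency bound
    ∀ c : ℝ, 0 < c → c < E.limitInfo β p g → ∀ ε : ℝ, 0 < ε → Tendsto
      (fun n : ℕ => P' {D | ¬ (
        1 - ε < P.real {ω | c ≤ |E.ivDen n (σhat n D) ω|} ∧
        MemLp (E.ivEstimator n (σhat n D) (mhat n D)) 2
          (P[|{ω | c ≤ |E.ivDen n (σhat n D) ω|}]) ∧
        |n * Var[E.ivEstimator n (σhat n D) (mhat n D);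
            P[|{ω | c ≤ |E.ivDen n (σhat n D) ω|}]] - (E.limitInfo β p g)⁻¹| < ε)})
      atTop (𝓝 0) := by
  have hσP : ∀ᵐ ω ∂P, 0 < E.errVar g (E.X 0 ω) := ae_of_ae_map (E.measurable_X 0).aemeasurable hσ
  -- Off the union of these events the estimates are δ-close to their targets and the instruments
  -- are bounded. `B` is null for each n and the other two have vanishing probability.
  set S : ℝ≥0∞ → ℕ → Set Ω' := fun δ n =>
    {D | δ ≤ eLpNorm (fun x => σhat n D x - E.errVar g x) 2 E.lawX} with hS
  set M : ℝ≥0∞ → ℕ → Set Ω' := fun δ n =>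
    {D | δ ≤ eLpNorm (fun x => mhat n D x - E.outcomeReg n x) 2 E.lawX} with hM
  set B : ℕ → Set Ω' := fun n => {D | ¬ ∀ᵐ ω ∂P, 0 < σhat n D (E.X 0 ω) ∧
    |E.instr n (E.X 0 ω) (E.Q 0 ω) / σhat n D (E.X 0 ω)| ≤ C} with hB
  have hlim : ∀ δ : ℝ≥0∞, 0 < δ → Tendsto (fun n => P' (S δ n ∪ M δ n ∪ B n)) atTop (𝓝 0) := by
    intro δ hδ
    refine tendsto_of_tendsto_of_tendsto_of_le_of_le tendsto_const_nhds
      (by simpa using (hσhat δ hδ).add (hmhat δ hδ)) (fun n => zero_le) fun n => ?_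
    calc P' (S δ n ∪ M δ n ∪ B n) ≤ P' (S δ n) + P' (M δ n) + P' (B n) :=
          (measure_union_le _ _).trans (add_le_add_left (measure_union_le _ _) _)
      _ = P' (S δ n) + P' (M δ n) := by
          rw [show P' (B n) = 0 from ae_iff.1 (hbdd n), add_zero]
  have hmem : ∀ {δ n D}, D ∉ S δ n ∪ M δ n ∪ B n →
      eLpNorm (fun x => σhat n D x - E.errVar g x) 2 E.lawX < δ ∧
      eLpNorm (fun x => mhat n D x - E.outcomeReg n x) 2 E.lawX < δ ∧
      ∀ᵐ ω ∂P, |E.instr n (E.X 0 ω) (E.Q 0 ω) / σhat n D (E.X 0 ω)| ≤ C := by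
    intro δ n D hD
    simp only [hS, hM, hB, Set.mem_union, Set.mem_ofPred_eq, not_or, not_le, not_not] at hD
    exact ⟨hD.1.1, hD.1.2, hD.2.mono fun ω hω => hω.2⟩
  have hpos : 0 < E.limitInfo β p g := by
    -- Positivity of I is a deterministic claim, but the finiteness of its integral comes from
    -- bounded instruments along a consistent sequence. Such a sequence exists because the bad
    -- events eventually have probability below one.
    have hex : ∀ j : ℕ, ∃ n, j < n ∧ ∃ D, D ∉ S (j + 1 : ℝ≥0∞)⁻¹ n ∪ M (j + 1 : ℝ≥0∞)⁻¹ n ∪ B n := by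
      intro j
      obtain ⟨n, hn1, hn2⟩ := (((hlim (j + 1 : ℝ≥0∞)⁻¹
        (ENNReal.inv_pos.2 (by finiteness))).eventually_lt_const one_pos).and
          (eventually_gt_atTop j)).exists
      refine ⟨n, hn2, ?_⟩
      by_contra! hall
      rw [Set.eq_univ_of_forall hall, measure_univ] at hn1
      exact lt_irrefl _ hn1
    choose n hn D hD using hex
    obtain ⟨φ, -, h⟩ := QueueExperiment.exists_isConsistent hn
      (fun j => hσhat_meas (n j) (D j)) (fun j => hmhat_meas (n j) (D j))
      (fun j => (hmem (hD j)).1) (fun j => (hmem (hD j)).2.1) (fun j => (hmem (hD j)).2.2)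
    exact h.limitInfo_pos hqueue harrival hbudget hσP (hγ.trans_le hrel)
  refine ⟨QueueExperiment.lawX_tendsto_propensity hqueue harrival hbudget, hpos,
    fun c hc hcI ε hε => ?_⟩
  obtain ⟨δ, hδ, N, hN⟩ := QueueExperiment.exists_forall_isNearlyEfficient (C := C)
    hqueue harrival hbudget hmodel hσP hc hcI hε
  refine tendsto_of_tendsto_of_tendsto_of_le_of_le' tendsto_const_nhds (hlim δ hδ)
    (Eventually.of_forall fun n => zero_le) ?_
  filter_upwards [eventually_ge_atTop N] with n hn
  refine measure_mono fun D hD => ?_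
  by_contra hDn
  obtain ⟨h1, h2, h3⟩ := hmem hDn
  exact hD (hN n hn _ _ (hσhat_meas n D) (hmhat_meas n D) h1 h2 h3)
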